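/- **Setting.** Let $d\ge1$, $p,q\ge0$ be integers and $k_0>0$. Let $R:\mathbb R^d\to\mathbb R$ be even, integrable, essentially bounded and continuous at $0$, with $\hat R(\xi)=\int_{\mathbb R^d}R(x)e^{-i\xi\cdot x}dx\ge0$. Let $\hat{\mathsf R}\in L^1(\mathbb R^d)$ be radially symmetric with $\hat R\le\hat{\mathsf R}$ a.e. If $d\ge3$, assume $\langle\xi\rangle^{d-2}\hat R(\xi)\in L^\infty(\mathbb R^d)$, where $\langle\xi\rangle=\sqrt{1+|\xi|^2}$. Put $C_0=\frac{k_0^2}{4}R(0)$. Write $v=(\xi_1,\dots,\xi_p,\zeta_1,\dots,\zeta_q)\in\mathbb R^{(p+q)d}$ and $v^{\rm t}\Theta w=\sum_{j\le p}v_j\cdot w_j-\sum_{p<l\le p+q}v_l\cdot w_l$. Let $\mathcal M_B$ be the space of finite complex Borel measures on $\mathbb R^{(p+q)d}$, where $\|\rho\|$ is the sum of the total variations of the real and imaginary parts of $\rho$; $\|\cdot\|$ also denotes the corresponding uniform norm of operators on $\mathcal M_B$. For $j\le p$, $l\le q$ let $A_{j,l}k$ $(k\in\mathbb R^d)$ be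 the vector with blocks $j$ and $p+l$ equal to $k$ and all others $0$; let $B_{j,j'}k$ be the vector with block $j$ equal to $k$, block $j'$ equal to $-k$, and all others $0$. For $\varepsilon,\eta>0$ and $z\ge0$ define on $\mathcal M_B$ $$L^{1}_{j,l}(z)\rho(v)=\frac{k_0^2}{4\eta^2}\int_{\mathbb R^d}\hat R(k)\,\rho(v-A_{j,l}k)\,e^{\frac{iz\eta}{k_0\varepsilon}k^{\rm t}A_{j,l}^{\rm t}\Theta v}\frac{dk}{(2\pi)^d},$$ $$L^{2}_{j,j'}(z)\rho(v)=-\frac{k_0^2}{4\eta^2}\int_{\mathbb R^d}\hat R(k)\,\rho(v-B_{j,j'}k)\,e^{\frac{iz\eta}{2k_0\varepsilon}(2k^{\rm t}B_{j,j'}^{\rm t}\Theta v-k^{\rm t}B_{j,j'}^{\rm t}\Theta B_{j,j'}k)}\frac{dk}{(2\pi)^d},$$ $$L^2=\sum_{1\le j<j'\le p}L^2_{j,j'}+\sum_{p+1\le l<l'\le p+q}L^2_{l,l'},\qquad L^\varepsilon_{p,q}=-\frac{p+q}{2}\frac{C_0}{\eta^2}+\sum_{j=1}^p\sum_{l=1}^qL^1_{j,l}+L^2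 .$$ Let $U^\varepsilon(z)$ and $U^\varepsilon_\gamma(z)$, for $\gamma=(j,l)$, be the solution operators of $\partial_zU^\varepsilon=L^\varepsilon_{p,q}U^\varepsilon$, $U^\varepsilon(0)=\mathbb I$, and of $\partial_zU^\varepsilon_\gamma=L^1_\gamma U^\varepsilon_\gamma$, $U^\varepsilon_\gamma(0)=\mathbb I$, for $z\ge0$; the equations are understood after application to any fixed $\rho\in\mathcal M_B$, with the $z$-derivative taken in total variation norm. Let $U_\eta(z)=e^{-C_0z/\eta^2}$. Let $\Lambda_\kappa$, $1\le\kappa\le K$, enumerate the non-empty sets of pairs $(j,l)$, $j\le p$, $l\le q$, in which any two distinct pairs differ in both components, and let $\bar\Lambda_\kappa$ be the set of pairs not in $\Lambda_\kappa$ that share a component with some pair in $\Lambda_\kappa$. Put $$N^\varepsilon_{p,q}=U_\eta^{\frac{p+q}2}\sum_{\kappa=1}^K\prod_{\gamma\in\Lambda_\kappa}(U^\varepsilon_\gamma-\mathbb I)+U_\eta^{\frac{p+q}2}.$$ For $f,g:\mathbb R^d\to[0,\infty)$ put $$\mathfrak C_1[\delta,f,g,d]=(\|f\|_1+\|f\|_\infty)(\|g\|_1+\|g\|_\infty)\,\delta\cdot\begin{cases}|\ln\delta|^2,&d=1\\|\ln\delta|,&d\ge2,\end{cases}$$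 $$\mathfrak C_2[\delta,f,d]=\begin{cases}2\pi\|f\|_\infty\sqrt\delta,&d=1\\ \|\langle\xi\rangle^{d-2}f\|_\infty\,\delta\ln\delta^{-1}+\|f\|_1\delta,&d\ge2.\end{cases}$$ **Theorem.** There are constants $c,C_2>0$, depending only on $d,p,q,k_0,R(0)$, such that the following holds. (i) For all $\varepsilon,\eta>0$ both evolution equations are well posed: the solution operators exist, are bounded on $\mathcal M_B$ for each $z\ge0$, and every solution is given by them. Moreover $U^\varepsilon_\gamma(z)$ and $U^\varepsilon_{\gamma'}(z')$ commute for all $z,z'\ge0$ when $\gamma,\gamma'$ differ in both components (so the products in $N^\varepsilon_{p,q}$ need no ordering), and $$U^\varepsilon=N^\varepsilon_{p,q}+E^\varepsilon_{p,q},$$ where the error solves $$\partial_zE^\varepsilon_{p,q}=L^\varepsilon_{p,q}E^\varepsilon_{p,q}+\mathcal E^\varepsilon_{p,q},\quad E^\varepsilon_{p,q}(0)=0,\qquad \mathcal E^\varepsilon_{p,q}=U_\eta^{\frac{p+q}2}\sum_{\kappa=1}^K\sum_{\gamma'\in\bar\Lambda_\kappa}L^1_{\gamma'}\prod_{\gamma\in\Lambda_\kappa}(U^\varepsilon_\gamma-\mathbb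 I)+L^2N^\varepsilon_{p,q}.$$ (ii) Let $\eta=\eta(\varepsilon)$ be either $1$ (kinetic scaling) or $(\ln|\ln\varepsilon|)^{-1}$ (diffusive scaling). For every $Z\ge0$ there is $\varepsilon_0>0$ such that for all $0\le z\le Z$ and $0<\varepsilon\le\varepsilon_0$, $$\sup_{0\le z'\le z}\|E^\varepsilon_{p,q}(z')\|\le\varepsilon^{1/3};$$ and, if $\hat{\mathsf R}$ is also essentially bounded (otherwise the middle term below is infinite), $$\sup_{0\le z'\le z}\|E^\varepsilon_{p,q}(z')\|\le c\,\langle z\rangle^2\eta^{-6}\Big(\mathfrak C_1\big[\tfrac{C_2\varepsilon}{\eta},\hat{\mathsf R},\hat R,d\big]+\mathfrak C_2\big[\tfrac{k_0\varepsilon}{\eta},\hat R,d\big]\Big)e^{\frac{(p+q)^2C_0z}{2\eta^2}}\le\varepsilon^{1/3}.$$ -/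

import Mathlib

open MeasureTheory Filter Topology
open scoped ENNReal

noncomputable section

namespace ItoSchrodinger

/-- The space `ℝ^d` of lateral variables (and of their dual variables). -/
abbrev Lateral (d : ℕ) : Type := EuclideanSpace ℝ (Fin d)

/-- The dual variables `v = (ξ₁, …, ξ_p, ζ₁, …, ζ_q) ∈ ℝ^{(p+q)d}`; `Sum.inl j` indexes `ξ_j` and
`Sum.inr l` indexes `ζ_l`. -/
abbrev DualVar (d p q : ℕ) : Type := Fin p ⊕ Fin q → Lateral d

/-- Complex-valued finite Borel measures on `ℝ^{(p+q)d}`. -/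
abbrev Meas (d p q : ℕ) : Type := ComplexMeasure (DualVar d p q)

/-- The total variation norm of a complex measure: the sum of the total variations of its real and
imaginary parts. -/
def tvNorm {d p q : ℕ} (ρ : Meas d p q) : ℝ :=
  ((ComplexMeasure.re ρ).totalVariation Set.univ).toReal +
    ((ComplexMeasure.im ρ).totalVariation Set.univ).toReal

/-- `‖T‖ ≤ B` for the uniform norm of operators on the space of measures. -/
def OpNormLE {d p q : ℕ} (T : Module.End ℂ (Meas d p q)) (B : ℝ) : Prop :=
  ∀ ρ : Meas d p q, tvNorm (T ρ) ≤ B * tvNorm ρ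

/-- `∂_z ψ = φ` on `[0, ∞)`, the derivative being taken in total variation (and one-sided at `0`). -/
def HasTVDeriv {d p q : ℕ} (ψ φ : ℝ → Meas d p q) : Prop :=
  ∀ z : ℝ, 0 ≤ z →
    Tendsto (fun z' : ℝ => tvNorm ((z' - z)⁻¹ • (ψ z' - ψ z) - φ z))
      (𝓝[Set.Ici 0 \ {z}] z) (𝓝 0)

/-- `U` is a solution operator on `[0, ∞)` of `∂_z U = L U`, `U(0) = 𝕀`: for every initial measure
`ρ`, the curve `z ↦ U(z) ρ` solves `∂_z ψ = L(z) ψ`. -/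
def IsSolutionOperator {d p q : ℕ} (L : ℝ → Meas d p q → Meas d p q)
    (U : ℝ → Module.End ℂ (Meas d p q)) : Prop :=
  U 0 = 1 ∧ ∀ ρ : Meas d p q, HasTVDeriv (fun z => U z ρ) (fun z => L z (U z ρ))

/-- The evolution equation `∂_z ψ = L(z) ψ` on `[0, ∞)` is well posed: it has a solution operator,
made of bounded operators, and every solution is given by it. -/
def IsWellPosed {d p q : ℕ} (L : ℝ → Meas d p q → Meas d p q) : Prop :=
  ∃ U : ℝ → Module.End ℂ (Meas d p q), IsSolutionOperator L U ∧
    (∀ z : ℝ, 0 ≤ z → ∃ B : ℝ, OpNormLE (U z) B) ∧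
    ∀ ψ : ℝ → Meas d p q, HasTVDeriv ψ (fun z => L z (ψ z)) →
      ∀ z : ℝ, 0 ≤ z → ψ z = U z (ψ 0)

/-- The power spectrum `R̂(ξ) = ∫ R(x) e^{-i ξ·x} dx`; it is real because `R` is even. -/
def powerSpectrum {d : ℕ} (R : Lateral d → ℝ) (ξ : Lateral d) : ℝ :=
  (∫ x, Complex.exp (-Complex.I * (inner ℝ ξ x : ℝ)) * (R x : ℂ)).re

/-- `⟨x⟩ = √(1 + |x|²)`. -/
def bracket {V : Type*} [Norm V] (x : V) : ℝ := Real.sqrt (1 + ‖x‖ ^ 2)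

/-- The assumptions on the covariance function `R`, with a radially symmetric integrable majorant
`S` of its power spectrum. -/
structure IsAdmissibleCovariance {d : ℕ} (R S : Lateral d → ℝ) : Prop where
  even : ∀ x, R (-x) = R x
  integrable : Integrable R
  bounded : MemLp R ∞
  continuousAt_zero : ContinuousAt R 0
  powerSpectrum_nonneg : ∀ ξ, 0 ≤ powerSpectrum R ξ
  majorant_radial : ∀ ξ ξ', ‖ξ‖ = ‖ξ'‖ → S ξ = S ξ'
  majorant_integrable : Integrable S
  powerSpectrum_le_majorant : ∀ᵐ ξ, powerSpectrum R ξ ≤ S ξ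
  weighted_bounded : 3 ≤ d → MemLp (fun ξ => bracket ξ ^ (d - 2) * powerSpectrum R ξ) ∞

/-- The bilinear form `vᵗ Θ w = ∑_j ξ_j·ξ'_j - ∑_l ζ_l·ζ'_l`. -/
def thetaForm {d p q : ℕ} (v w : DualVar d p q) : ℝ :=
  ∑ j, inner ℝ (v (Sum.inl j)) (w (Sum.inl j)) - ∑ l, inner ℝ (v (Sum.inr l)) (w (Sum.inr l))

/-- The matrix `lam ⊗ 𝕀_d` applied to `k`. -/
def blockShift {d p q : ℕ} (lam : Fin p ⊕ Fin q → ℝ) (k : Lateral d) : DualVar d p q :=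
  fun i => lam i • k

/-- The column `λ₁` of `A_{j,l} = λ₁ ⊗ 𝕀_d`. -/
def colA {p q : ℕ} (γ : Fin p × Fin q) : Fin p ⊕ Fin q → ℝ :=
  Pi.single (Sum.inl γ.1) 1 + Pi.single (Sum.inr γ.2) 1

/-- The column `λ₂` of `B_{j,j'} = λ₂ ⊗ 𝕀_d`. -/
def colB {p q : ℕ} (j j' : Fin p ⊕ Fin q) : Fin p ⊕ Fin q → ℝ :=
  Pi.single j 1 - Pi.single j' 1

/-- For a matrix `A = lam ⊗ 𝕀_d`, the operator
`ρ ↦ k₀²/(4η²) ∫ R̂(k) ρ(v - A k) exp(i z η/(2 k₀ ε) (2 kᵗAᵗΘv - kᵗAᵗΘAk)) dk/(2π)^d`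
on measures: `R̂(k) dk ρ(dv)` is multiplied by the phase taken at the shifted point `v + A k`, and
then pushed forward under `(k, v) ↦ v + A k`. -/
def transferOp {d p q : ℕ} (k₀ : ℝ) (R : Lateral d → ℝ) (ε η : ℝ) (lam : Fin p ⊕ Fin q → ℝ)
    (z : ℝ) (ρ : Meas d p q) : Meas d p q :=
  (k₀ ^ 2 / (4 * η ^ 2) / (2 * Real.pi) ^ d) •
    ((((volume : Measure (Lateral d)).withDensityᵥ (powerSpectrum R)).prod ρ
      (ContinuousLinearMap.lsmul ℝ ℝ)).withDensity
        (fun kv : Lateral d × DualVar d p q =>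
          Complex.exp (Complex.I * ((z * η / (2 * k₀ * ε) *
            (2 * thetaForm (blockShift lam kv.1) (kv.2 + blockShift lam kv.1)
              - thetaForm (blockShift lam kv.1) (blockShift lam kv.1)) : ℝ) : ℂ)))
        (ContinuousLinearMap.mul ℝ ℂ)).map
      (fun kv : Lateral d × DualVar d p q => kv.2 + blockShift lam kv.1)

/-- `L^{ε,1}_γ` for a pair `γ = (j, l)`; here `AᵗΘA = 0`, so the phase is
`exp(i z η/(k₀ ε) kᵗAᵗΘv)`. -/
def opL1 {d p q : ℕ} (k₀ : ℝ) (R : Lateral d → ℝ) (ε η : ℝ) (γ : Fin p × Fin q)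
    (z : ℝ) (ρ : Meas d p q) : Meas d p q :=
  transferOp k₀ R ε η (colA γ) z ρ

/-- `L^{ε,2}_{j,j'}`. -/
def opL2 {d p q : ℕ} (k₀ : ℝ) (R : Lateral d → ℝ) (ε η : ℝ) (j j' : Fin p ⊕ Fin q)
    (z : ℝ) (ρ : Meas d p q) : Meas d p q :=
  -transferOp k₀ R ε η (colB j j') z ρ

/-- `L^{ε,2}`, the sum of `L^{ε,2}_{j,j'}` over pairs `j < j'` of indices of the same kind. -/
def opL2Sum {d p q : ℕ} (k₀ : ℝ) (R : Lateral d → ℝ) (ε η : ℝ)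
    (z : ℝ) (ρ : Meas d p q) : Meas d p q :=
  ∑ jj ∈ (Finset.univ : Finset (Fin p × Fin p)).filter (fun jj => jj.1 < jj.2),
      opL2 k₀ R ε η (Sum.inl jj.1) (Sum.inl jj.2) z ρ +
    ∑ ll ∈ (Finset.univ : Finset (Fin q × Fin q)).filter (fun ll => ll.1 < ll.2),
      opL2 k₀ R ε η (Sum.inr ll.1) (Sum.inr ll.2) z ρ

/-- `C₀ = k₀² R(0) / 4`. -/
def dampC {d : ℕ} (k₀ : ℝ) (R : Lateral d → ℝ) : ℝ := k₀ ^ 2 / 4 * R 0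

/-- The generator `L^ε_{p,q} = (p+q)/2 L_η + L^{ε,1} + L^{ε,2}`, with `L_η = -C₀/η²`. -/
def generator {d p q : ℕ} (k₀ : ℝ) (R : Lateral d → ℝ) (ε η : ℝ)
    (z : ℝ) (ρ : Meas d p q) : Meas d p q :=
  (((p + q : ℕ) : ℝ) / 2 * (-(dampC k₀ R / η ^ 2))) • ρ +
    ∑ γ : Fin p × Fin q, opL1 k₀ R ε η γ z ρ + opL2Sum k₀ R ε η z ρ

/-- The scalar `U_η(z)^{(p+q)/2}`, where `U_η(z) = exp(-C₀ z/η²)`. -/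
def damping {d : ℕ} (p q : ℕ) (k₀ : ℝ) (R : Lateral d → ℝ) (η z : ℝ) : ℝ :=
  Real.exp (-(dampC k₀ R * z / η ^ 2)) ^ (((p + q : ℕ) : ℝ) / 2)

/-- The sets `Λ_κ`, `1 ≤ κ ≤ K`: non-empty sets of pairs `(j, l)` in which any two different pairs
differ in both components. -/
def pairings (p q : ℕ) : Finset (Finset (Fin p × Fin q)) :=
  (Finset.univ : Finset (Finset (Fin p × Fin q))).filter fun Λ =>
    Λ.Nonempty ∧ ∀ γ ∈ Λ, ∀ γ' ∈ Λ, γ ≠ γ' → γ.1 ≠ γ'.1 ∧ γ.2 ≠ γ'.2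

/-- `Λ̄_κ`: the pairs outside `Λ_κ` that share a component with some pair in `Λ_κ`. -/
def conflicting {p q : ℕ} (Λ : Finset (Fin p × Fin q)) : Finset (Fin p × Fin q) :=
  Finset.univ.filter fun γ' => γ' ∉ Λ ∧ ∃ γ ∈ Λ, γ'.1 = γ.1 ∨ γ'.2 = γ.2

/-- `∏_{γ ∈ Λ} (U_γ(z) - 𝕀)`, a composition of operators, taken in lexicographic order of the pairs
(the factors commute when `Λ` is one of the sets `Λ_κ`). -/
def pairProd {d p q : ℕ} (Uγ : Fin p × Fin q → ℝ → Module.End ℂ (Meas d p q))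
    (Λ : Finset (Fin p × Fin q)) (z : ℝ) : Module.End ℂ (Meas d p q) :=
  (((List.finRange p ×ˢ List.finRange q).filter (fun γ => γ ∈ Λ)).map
    (fun γ => Uγ γ z - 1)).prod

/-- `N^ε_{p,q} = U_η^{(p+q)/2} ∑_κ ∏_{γ ∈ Λ_κ} (U^ε_γ - 𝕀) + U_η^{(p+q)/2}`, in terms of the
solution operators `U^ε_γ` of `∂_z U_γ = L^{ε,1}_γ U_γ`. -/
def opN {d p q : ℕ} (k₀ : ℝ) (R : Lateral d → ℝ) (η : ℝ)
    (Uγ : Fin p × Fin q → ℝ → Module.End ℂ (Meas d p q)) (z : ℝ) : Module.End ℂ (Meas d p q) :=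
  damping p q k₀ R η z • ∑ Λ ∈ pairings p q, pairProd Uγ Λ z +
    damping p q k₀ R η z • (1 : Module.End ℂ (Meas d p q))

/-- The source
`U_η^{(p+q)/2} ∑_κ ∑_{γ' ∈ Λ̄_κ} L^{ε,1}_{γ'} ∏_{γ ∈ Λ_κ} (U^ε_γ - 𝕀) + L^{ε,2} N^ε_{p,q}`,
applied to the measure `ρ`. -/
def errorSource {d p q : ℕ} (k₀ : ℝ) (R : Lateral d → ℝ) (ε η : ℝ)
    (Uγ : Fin p × Fin q → ℝ → Module.End ℂ (Meas d p q)) (z : ℝ) (ρ : Meas d p q) : Meas d p q :=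
  damping p q k₀ R η z •
      ∑ Λ ∈ pairings p q, ∑ γ' ∈ conflicting Λ, opL1 k₀ R ε η γ' z (pairProd Uγ Λ z ρ) +
    opL2Sum k₀ R ε η z (opN k₀ R η Uγ z ρ)

/-- The `L^r` norm with respect to Lebesgue measure, as a real number. -/
def lpNorm' {d : ℕ} (f : Lateral d → ℝ) (r : ℝ≥0∞) : ℝ := (eLpNorm f r volume).toReal

/-- `𝔠₁[δ, f, g, d]`, up to a multiplicative constant. -/
def frakC1 {d : ℕ} (δ : ℝ) (f g : Lateral d → ℝ) : ℝ :=
  (lpNorm' f 1 + lpNorm' f ∞) * (lpNorm' g 1 + lpNorm' g ∞) * δ *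
    (if d = 1 then |Real.log δ| ^ 2 else |Real.log δ|)

/-- `𝔠₂[δ, f, d]`, up to a multiplicative constant. -/
def frakC2 {d : ℕ} (δ : ℝ) (f : Lateral d → ℝ) : ℝ :=
  if d = 1 then 2 * Real.pi * lpNorm' f ∞ * Real.sqrt δ
  else lpNorm' (fun ξ => bracket ξ ^ (d - 2) * f ξ) ∞ * δ * Real.log δ⁻¹ + lpNorm' f 1 * δ

/-- The explicit bound on the error operator. -/
def errorBound {d : ℕ} (p q : ℕ) (k₀ : ℝ) (R S : Lateral d → ℝ) (c C₂ ε η z : ℝ) : ℝ :=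
  c * bracket z ^ 2 * (η ^ 6)⁻¹ *
    (frakC1 (C₂ * ε / η) S (powerSpectrum R) + frakC2 (k₀ * ε / η) (powerSpectrum R)) *
    Real.exp (((p + q : ℕ) : ℝ) ^ 2 * dampC k₀ R * z / (2 * η ^ 2))

/-- The kinetic scaling `η(ε) = 1`. -/
def etaKinetic : ℝ → ℝ := fun _ => 1

/-- The diffusive scaling `η(ε) = 1 / ln |ln ε|`. -/
def etaDiffusive : ℝ → ℝ := fun ε => (Real.log |Real.log ε|)⁻¹

end ItoSchrodinger

end

/-!
The equation is linear with a bounded generator, so that the Dyson series gives the solution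
operators (`exists_solutionOperator`) and Gronwall's inequality their uniqueness
(`eq_of_linear_ode`). For this, complex measures are made a Banach space under the variation norm.

Each part of the generator lets a measure jump along `k ∈ ℝ^d`, with density `R̂(k)` and an
oscillating phase. The jumps of two pairs that differ in both components neither move nor see each
other's blocks; hence their generators and solution operators commute. Summing
`∏_{γ ∈ Λ} (U_γ - 1)` over all matchings `Λ` and applying the sum of all generators `L¹_γ`,
the pairs that belong to `Λ` or can be added to it reproduce the derivative of the sum; the pairs
that conflict with `Λ` and the generator `L²` remain (`PairSystem.sum_L_mul_total`). This is the
evolution equation of the error (`PairSystem.deriv_error`).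

The remaining terms are not small, but their antiderivatives in `z` are. For `L²` the phase is
quadratic in `k`. For a conflicting pair `γ'`, which shares a component with some `γ ∈ Λ`, the phase
of a jump `k'` of `γ'` after a jump `k` of `γ` contains `k'·k`; integration by parts moves the
integral onto `L¹_{γ'}` and produces this composition (`PairSystem.exists_corrector`). Subtracting
the antiderivative of the source from the error leaves an equation with a small source, to which
Gronwall's inequality applies (`PairSystem.norm_sub_approx_le`). The damping `U_η^{(p+q)/2}`
compensates the growth of the products, as a matching has at most `(p+q)/2` pairs.

Integrating the phases over an interval of length at most `⟨z⟩` replaces them by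
`1 / max(κ, |k'·(k+y)|)` and `1 / max(κ, |k·(k+y)|)`, with `κ = k₀ε/(η⟨z⟩)`. Integrated against the
power spectra these are at most logarithmic in `1/κ`, or of order `κ^{-1/2}` for the second one in
dimension one (`exists_double_integral_bound`, `exists_single_integral_bound`); the first bound uses
that a radial majorant only sees spherical means. This gives the explicit bound, in both scalings
of order `√ε` up to factors that grow slower than any power of `1/ε`, and so at most `ε^{1/3}`
(`exists_errorBound_le`). An unbounded majorant may be truncated at `∫ |R|`, which proves the bound
`ε^{1/3}` in general.
-/

noncomputable section

namespace ItoSchrodinger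

/-! ### The norm of complex measures, and duality -/

section ComplexMeasures

variable {X Y : Type*} [MeasurableSpace X] [MeasurableSpace Y]

theorem variation_le_re_add_im (ρ : ComplexMeasure X) :
    ρ.variation ≤ (ComplexMeasure.re ρ).totalVariation + (ComplexMeasure.im ρ).totalVariation := by
  refine VectorMeasure.variation_le_of_forall_enorm_le fun s _ => ?_
  have h1 := (ComplexMeasure.re ρ).enorm_le_totalVariation s
  have h2 := (ComplexMeasure.im ρ).enorm_le_totalVariation s
  have h3 : ‖ρ s‖ₑ ≤ ‖(ρ s).re‖ₑ + ‖(ρ s).im‖ₑ := by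
    simp only [← ofReal_norm]
    rw [← ENNReal.ofReal_add (norm_nonneg _) (norm_nonneg _)]
    exact ENNReal.ofReal_le_ofReal (Complex.norm_le_abs_re_add_abs_im _)
  exact h3.trans (add_le_add h1 h2)

instance isFiniteMeasure_variation (ρ : ComplexMeasure X) : IsFiniteMeasure ρ.variation :=
  isFiniteMeasure_of_le _ (variation_le_re_add_im ρ)

/-- The norm of a complex measure is the mass `|ρ|(X)` of its variation. It is equivalent to
`tvNorm`, with constants `1` and `2`, and is the one that is homogeneous over `ℂ`. -/
instance instNormMeas : Norm (ComplexMeasure X) := ⟨fun ρ => ρ.variation.real Set.univ⟩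

theorem norm_def (ρ : ComplexMeasure X) : ‖ρ‖ = ρ.variation.real Set.univ := rfl

instance : NormedAddCommGroup (ComplexMeasure X) :=
  AddGroupNorm.toNormedAddCommGroup
    { toFun := fun ρ => ρ.variation.real Set.univ
      map_zero' := by simp
      add_le' := fun ρ σ => by
        rw [← measureReal_add_apply]
        exact ENNReal.toReal_mono (measure_ne_top _ _) (VectorMeasure.variation_add_le _)
      neg' := fun ρ => by simp
      eq_zero_of_map_eq_zero' := fun ρ h => by
        rw [measureReal_eq_zero_iff, Measure.measure_univ_eq_zero] at h
        exact VectorMeasure.variation_eq_zero.1 h }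

instance : NormedSpace ℂ (ComplexMeasure X) where
  norm_smul_le c ρ := by
    simp only [norm_def, VectorMeasure.variation_smul]
    simp

theorem norm_withDensityᵥ {μ : Measure X} {h : X → ℂ} (hh : Integrable h μ) :
    ‖μ.withDensityᵥ h‖ = ∫ x, ‖h x‖ ∂μ := by
  rw [norm_def, Measure.variation_withDensityᵥ hh, measureReal_def,
    withDensity_apply _ MeasurableSet.univ, Measure.restrict_univ,
    integral_norm_eq_lintegral_enorm hh.1]

/-- The Radon–Nikodym theorem for complex measures, from their real and imaginary parts. -/
theorem exists_withDensityᵥ_eq (ρ : ComplexMeasure X) {μ : Measure X} [IsFiniteMeasure μ]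
    (h : ρ.variation ≪ μ) : ∃ f : X → ℂ, Measurable f ∧ Integrable f μ ∧ μ.withDensityᵥ f = ρ := by
  have key : ∀ s : SignedMeasure X, (∀ t, ρ t = 0 → s t = 0) →
      ∃ f : X → ℝ, Measurable f ∧ Integrable f μ ∧ μ.withDensityᵥ f = s := by
    intro s hs
    refine ⟨s.rnDeriv μ, SignedMeasure.measurable_rnDeriv _ _,
      SignedMeasure.integrable_rnDeriv _ _, SignedMeasure.withDensityᵥ_rnDeriv_eq _ _ ?_⟩
    refine VectorMeasure.AbsolutelyContinuous.mk fun t ht h0 => hs t ?_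
    rw [Measure.toENNRealVectorMeasure_apply_measurable ht] at h0
    have := VectorMeasure.enorm_measure_le_variation ρ t
    rw [h h0] at this
    simpa using this
  obtain ⟨f, hf, hfi, hfe⟩ := key (ComplexMeasure.re ρ) (fun t ht => congrArg Complex.re ht)
  obtain ⟨g, hg, hgi, hge⟩ := key (ComplexMeasure.im ρ) (fun t ht => congrArg Complex.im ht)
  have hi : Integrable (fun x => (f x : ℂ) + g x * Complex.I) μ :=
    hfi.ofReal.add (hgi.ofReal.mul_const _)
  refine ⟨fun x => f x + g x * Complex.I, by fun_prop, hi, ?_⟩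
  ext s hs
  have h1 : ((∫ x in s, f x ∂μ : ℝ) : ℂ) = (ρ s).re := by
    rw [← withDensityᵥ_apply hfi hs, hfe]
    rfl
  have h2 : ((∫ x in s, g x ∂μ : ℝ) : ℂ) = (ρ s).im := by
    rw [← withDensityᵥ_apply hgi hs, hge]
    rfl
  rw [withDensityᵥ_apply hi hs, integral_add hfi.ofReal.integrableOn.integrable
    (hgi.ofReal.mul_const _).integrableOn.integrable, integral_mul_const,
    integral_complex_ofReal, integral_complex_ofReal, h1, h2, Complex.re_add_im]

/-- Densities with respect to a fixed positive measure embed isometrically into the space of complex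
measures. -/
def densityIsometry (μ : Measure X) : Lp ℂ 1 μ →ₗᵢ[ℂ] ComplexMeasure X where
  toFun f := μ.withDensityᵥ f
  map_add' f g := by
    rw [WithDensityᵥEq.congr_ae (Lp.coeFn_add f g),
      withDensityᵥ_add (L1.integrable_coeFn f) (L1.integrable_coeFn g)]
  map_smul' c f := by
    rw [WithDensityᵥEq.congr_ae (Lp.coeFn_smul c f), withDensityᵥ_smul, RingHom.id_apply]
  norm_map' f := by
    simp only [LinearMap.coe_mk, AddHom.coe_mk]
    rw [norm_withDensityᵥ (L1.integrable_coeFn f), L1.norm_eq_integral_norm]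

/-- The terms of an absolutely convergent series all have densities with respect to the sum of their
variations, so that completeness follows from that of `L¹`. -/
instance : CompleteSpace (ComplexMeasure X) := by
  refine NormedAddCommGroup.completeSpace_of_summable_imp_tendsto fun u hu => ?_
  set μ : Measure X := Measure.sum fun n => (u n).variation with hμ
  have hfin : IsFiniteMeasure μ := ⟨by
    rw [hμ, Measure.sum_apply _ MeasurableSet.univ]
    have : ∀ n, (u n).variation Set.univ = ENNReal.ofReal ‖u n‖ := fun n => by
      rw [norm_def, ofReal_measureReal]
    simp_rw [this]
    exact hu.tsum_ofReal_lt_top⟩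
  have hac : ∀ n, (u n).variation ≪ μ := fun n =>
    Measure.absolutelyContinuous_of_le (Measure.le_sum _ n)
  choose f _ hfi hfe using fun n => exists_withDensityᵥ_eq (u n) (hac n)
  have hF : ∀ n, densityIsometry μ ((hfi n).toL1 (f n)) = u n := fun n => by
    rw [← hfe n]
    exact WithDensityᵥEq.congr_ae (Integrable.coeFn_toL1 (hfi n))
  have hs : Summable fun n => ‖(hfi n).toL1 (f n)‖ := by
    refine hu.congr fun n => ?_
    rw [← hF n, LinearIsometry.norm_map]
  refine ⟨densityIsometry μ (∑' n, (hfi n).toL1 (f n)), ?_⟩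
  have h2 := ((densityIsometry μ).continuous.tendsto _).comp hs.of_norm.hasSum.tendsto_sum_nat
  refine h2.congr fun n => ?_
  simp [hF]

/-- The integral of a function against a complex measure. It is used for bounded measurable
functions only, which are always integrable. -/
def pairing (ρ : ComplexMeasure X) (f : X → ℂ) : ℂ :=
  VectorMeasure.integral ρ f (ContinuousLinearMap.mul ℝ ℂ)

theorem pairing_add_right (ρ : ComplexMeasure X) {f g : X → ℂ} (hf : ρ.Integrable f)
    (hg : ρ.Integrable g) : pairing ρ (f + g) = pairing ρ f + pairing ρ g :=
  VectorMeasure.integral_add hf hg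

/-- The integral against a measure with a density is an ordinary integral. -/
theorem pairing_withDensityᵥ {μ : Measure X} {h f : X → ℂ} (hh : Integrable h μ)
    (hf : Measurable f) {C : ℝ} (hC : ∀ x, ‖f x‖ ≤ C) :
    pairing (μ.withDensityᵥ h) f = ∫ x, f x * h x ∂μ := by
  -- the case of simple functions; the general one follows by dominated convergence on both sides
  have hsimple : ∀ g : SimpleFunc X ℂ, pairing (μ.withDensityᵥ h) g = ∫ x, g x * h x ∂μ := by
    intro g
    induction g using SimpleFunc.induction with
    | const c hs =>
      rename_i s
      have h0 : (SimpleFunc.piecewise s hs (SimpleFunc.const X c) (SimpleFunc.const X 0) : X → ℂ) =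
          s.indicator fun _ => c := by
        ext x
        by_cases hx : x ∈ s <;> simp [hx]
      rw [h0, pairing]
      have h1 := VectorMeasure.integral_indicator_const (μ := μ.withDensityᵥ h)
        (B := ContinuousLinearMap.mul ℝ ℂ) c hs
      rw [withDensityᵥ_apply hh hs] at h1
      refine h1.trans ?_
      simp only [ContinuousLinearMap.mul_apply']
      rw [← integral_const_mul, ← MeasureTheory.integral_indicator hs]
      refine integral_congr_ae (Eventually.of_forall fun x => ?_)
      by_cases hx : x ∈ s <;> simp [hx]
    | add hd hf hg =>
      rename_i f g
      have hi : ∀ g : SimpleFunc X ℂ, (μ.withDensityᵥ h).Integrable g := fun g =>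
        SimpleFunc.integrable_of_isFiniteMeasure g
      have hi' : ∀ g : SimpleFunc X ℂ, Integrable (fun x => g x * h x) μ := fun g => by
        obtain ⟨C, hC⟩ := g.exists_forall_norm_le
        exact hh.bdd_mul g.aestronglyMeasurable (Eventually.of_forall hC)
      rw [SimpleFunc.coe_add, pairing_add_right _ (hi f) (hi g), hf, hg,
        ← MeasureTheory.integral_add (hi' f) (hi' g)]
      simp [add_mul]
  have hC0 : ∀ x, 0 ≤ C := fun x => (norm_nonneg _).trans (hC x)
  rcases isEmpty_or_nonempty X with hX | ⟨⟨x₀⟩⟩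
  · have : f = (0 : SimpleFunc X ℂ) := Subsingleton.elim _ _
    rw [this, hsimple]
  have hfs := hf.stronglyMeasurable
  have hlim : ∀ x, Tendsto (fun n => hfs.approxBounded C n x) atTop (𝓝 (f x)) := fun x =>
    hfs.tendsto_approxBounded_of_norm_le (hC x)
  have hbd : ∀ n x, ‖hfs.approxBounded C n x‖ ≤ C := fun n x =>
    hfs.norm_approxBounded_le (hC0 x₀) n x
  have t1 : Tendsto (fun n => pairing (μ.withDensityᵥ h) (hfs.approxBounded C n)) atTop
      (𝓝 (pairing (μ.withDensityᵥ h) f)) := by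
    refine tendsto_setToFun_of_dominated_convergence _ (fun _ => C)
      (fun n => (SimpleFunc.aestronglyMeasurable _)) (integrable_const _)
      (fun n => Eventually.of_forall (hbd n)) (Eventually.of_forall hlim)
  have t2 : Tendsto (fun n => ∫ x, hfs.approxBounded C n x * h x ∂μ) atTop
      (𝓝 (∫ x, f x * h x ∂μ)) := by
    refine tendsto_integral_of_dominated_convergence (fun x => C * ‖h x‖)
      (fun n => (SimpleFunc.aestronglyMeasurable _).mul hh.1) (hh.norm.const_mul _)
      (fun n => Eventually.of_forall fun x => ?_)
      (Eventually.of_forall fun x => (hlim x).mul_const _)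
    rw [norm_mul]
    exact mul_le_mul_of_nonneg_right (hbd n x) (norm_nonneg _)
  refine tendsto_nhds_unique t1 (t2.congr fun n => (hsimple _).symm)

/-- A complex measure has a density with respect to its variation. -/
theorem exists_eq_withDensityᵥ_variation (ρ : ComplexMeasure X) :
    ∃ f : X → ℂ, Measurable f ∧ Integrable f ρ.variation ∧ ρ.variation.withDensityᵥ f = ρ :=
  exists_withDensityᵥ_eq ρ Measure.AbsolutelyContinuous.rfl

theorem integrable_of_bounded (ρ : ComplexMeasure X) {f : X → ℂ} (hf : Measurable f) {C : ℝ}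
    (hC : ∀ x, ‖f x‖ ≤ C) : ρ.Integrable f :=
  Integrable.of_bound hf.aestronglyMeasurable C (Eventually.of_forall hC)

theorem norm_pairing_le (ρ : ComplexMeasure X) (f : X → ℂ) :
    ‖pairing ρ f‖ ≤ ∫ x, ‖f x‖ ∂ρ.variation :=
  VectorMeasure.norm_integral_le_integral_norm.trans <|
    mul_le_of_le_one_left (integral_nonneg fun _ => norm_nonneg _)
      (ContinuousLinearMap.opNorm_mul_le ℝ ℂ)

theorem pairing_add (ρ σ : ComplexMeasure X) {f : X → ℂ} (hf : Measurable f) {C : ℝ}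
    (hC : ∀ x, ‖f x‖ ≤ C) : pairing (ρ + σ) f = pairing ρ f + pairing σ f :=
  VectorMeasure.integral_add_vectorMeasure (integrable_of_bounded ρ hf hC)
    (integrable_of_bounded σ hf hC)

theorem pairing_smul (c : ℂ) (ρ : ComplexMeasure X) {f : X → ℂ} (hf : Measurable f) {C : ℝ}
    (hC : ∀ x, ‖f x‖ ≤ C) : pairing (c • ρ) f = c * pairing ρ f := by
  obtain ⟨h, -, hi, he⟩ := exists_eq_withDensityᵥ_variation ρ
  rw [← he, ← withDensityᵥ_smul, pairing_withDensityᵥ (hi.smul c) hf hC,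
    pairing_withDensityᵥ hi hf hC, ← integral_const_mul]
  refine integral_congr_ae (Eventually.of_forall fun x => ?_)
  simp only [Pi.smul_apply, smul_eq_mul]
  ring

theorem pairing_indicator (ρ : ComplexMeasure X) {s : Set X} (hs : MeasurableSet s) (c : ℂ) :
    pairing ρ (s.indicator fun _ => c) = c * ρ s := by
  exact (VectorMeasure.integral_indicator_const (μ := ρ)
    (B := ContinuousLinearMap.mul ℝ ℂ) c hs).trans (ContinuousLinearMap.mul_apply' ℝ ℂ _ _)

theorem ext_of_pairing {ρ σ : ComplexMeasure X}
    (h : ∀ f : X → ℂ, Measurable f → (∀ x, ‖f x‖ ≤ 1) → pairing ρ f = pairing σ f) : ρ = σ := by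
  ext s hs
  have := h (s.indicator fun _ => 1) (measurable_const.indicator hs) (fun x => by
    by_cases hx : x ∈ s <;> simp [hx])
  simpa [pairing_indicator _ hs] using this

theorem pairing_finset_sum (ρ : ComplexMeasure X) {ι : Type*} (P : Finset ι) {f : ι → X → ℂ}
    (hf : ∀ i ∈ P, ρ.Integrable (f i)) :
    pairing ρ (fun x => ∑ i ∈ P, f i x) = ∑ i ∈ P, pairing ρ (f i) :=
  VectorMeasure.integral_finsetSum P hf

/-- Duality: the total variation is at most the supremum of the integrals of measurable functions
bounded by one. -/
theorem norm_le_of_pairing_le {ρ : ComplexMeasure X} {B : ℝ}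
    (h : ∀ f : X → ℂ, Measurable f → (∀ x, ‖f x‖ ≤ 1) → ‖pairing ρ f‖ ≤ B) : ‖ρ‖ ≤ B := by
  refine le_of_forall_lt fun a ha => ?_
  have hB : 0 ≤ B := (norm_nonneg _).trans (h 0 measurable_const (by simp))
  rcases lt_or_ge a 0 with h0 | h0
  · exact h0.trans_le hB
  have ha' : ENNReal.ofReal a < ρ.variation Set.univ := by
    rwa [ENNReal.ofReal_lt_iff_lt_toReal h0 (measure_ne_top _ _)]
  obtain ⟨P, -, hd, hm, hP⟩ := VectorMeasure.exists_lt_sum_of_lt_variation ρ MeasurableSet.univ ha'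
  -- test against the phase of `ρ` on each cell of a nearly optimal partition
  set c : Set X → ℂ := fun t => (starRingEnd ℂ) (ρ t) / ‖ρ t‖ with hc
  have hc1 : ∀ t, ‖c t‖ ≤ 1 := fun t => by
    simp only [hc, norm_div, RCLike.norm_conj, Complex.norm_real, norm_norm]
    exact div_self_le_one _
  have hcρ : ∀ t, c t * ρ t = ‖ρ t‖ := fun t => by
    rcases eq_or_ne (ρ t) 0 with h0 | h0
    · simp [h0]
    · have : (‖ρ t‖ : ℂ) ≠ 0 := by exact_mod_cast norm_ne_zero_iff.2 h0
      simp only [hc]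
      rw [div_mul_eq_mul_div, mul_comm, Complex.mul_conj, Complex.normSq_eq_norm_sq]
      field_simp
      norm_cast
  have hmeas : Measurable fun x => ∑ t ∈ P, t.indicator (fun _ => c t) x :=
    Finset.measurable_fun_sum P fun t ht => measurable_const.indicator (hm t ht)
  have hle : ∀ x, ‖∑ t ∈ P, t.indicator (fun _ => c t) x‖ ≤ 1 := by
    intro x
    by_cases hx : ∃ t ∈ P, x ∈ t
    · obtain ⟨t, htP, hxt⟩ := hx
      rw [Finset.sum_eq_single_of_mem t htP]
      · simpa [hxt] using hc1 t
      · intro s hs hst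
        refine Set.indicator_of_notMem (fun hxs => ?_) _
        exact Set.disjoint_left.1 (hd hs htP hst) hxs hxt
    · rw [Finset.sum_eq_zero]
      · simp
      · intro t ht
        exact Set.indicator_of_notMem (fun hxt => hx ⟨t, ht, hxt⟩) _
  have h1 := h _ hmeas hle
  rw [pairing_finset_sum ρ P (fun t ht => (integrable_of_bounded ρ (C := 1)
    (measurable_const.indicator (hm t ht)) (fun x => by
      by_cases hx : x ∈ t <;> simp [hx, hc1 t])))] at h1
  rw [Finset.sum_congr rfl fun t ht => (pairing_indicator ρ (hm t ht) (c t)).trans (hcρ t),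
    ← Complex.ofReal_sum, Complex.norm_real, Real.norm_of_nonneg
      (Finset.sum_nonneg fun _ _ => norm_nonneg _)] at h1
  refine lt_of_lt_of_le ?_ h1
  have h2 : ∑ t ∈ P, ‖ρ t‖ₑ = ENNReal.ofReal (∑ t ∈ P, ‖ρ t‖) := by
    rw [ENNReal.ofReal_sum_of_nonneg fun _ _ => norm_nonneg _]
    simp
  rw [h2] at hP
  exact (ENNReal.ofReal_lt_ofReal_iff_of_nonneg h0).1 hP

theorem pairing_map {ρ : ComplexMeasure X} {φ : X → Y} (hφ : Measurable φ) {f : Y → ℂ}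
    (hf : Measurable f) {C : ℝ} (hC : ∀ x, ‖f x‖ ≤ C) :
    pairing (ρ.map φ) f = pairing ρ (fun x => f (φ x)) :=
  VectorMeasure.integral_map hφ hf.aestronglyMeasurable
    (integrable_of_bounded ρ (hf.comp hφ) (fun x => hC (φ x)))

theorem withDensity_withDensityᵥ {μ : Measure X} {h f : X → ℂ} (hh : Integrable h μ)
    (hf : Measurable f) {C : ℝ} (hC : ∀ x, ‖f x‖ ≤ C) :
    (μ.withDensityᵥ h).withDensity f (ContinuousLinearMap.mul ℝ ℂ) =
      μ.withDensityᵥ fun x => f x * h x := by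
  have hi : Integrable (fun x => f x * h x) μ :=
    hh.bdd_mul hf.aestronglyMeasurable (Eventually.of_forall hC)
  ext s hs
  rw [VectorMeasure.withDensity_apply (integrable_of_bounded _ hf hC), withDensityᵥ_apply hi hs,
    ← VectorMeasure.integral_indicator hs, ← MeasureTheory.integral_indicator hs]
  refine (pairing_withDensityᵥ hh (hf.indicator hs) (C := C) fun x => ?_).trans ?_
  · exact (norm_indicator_le_norm_self f x).trans (hC x)
  · refine integral_congr_ae (Eventually.of_forall fun x => ?_)
    by_cases hx : x ∈ s <;> simp [hx]

theorem prod_withDensityᵥ {μ : Measure X} {ν : Measure Y} [SFinite μ] [SFinite ν]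
    {r : X → ℝ} {h : Y → ℂ} (hr : Integrable r μ) (hh : Integrable h ν) :
    (μ.withDensityᵥ r).prod (ν.withDensityᵥ h) (ContinuousLinearMap.lsmul ℝ ℝ) =
      (μ.prod ν).withDensityᵥ fun x : X × Y => r x.1 • h x.2 := by
  refine VectorMeasure.prod_eq_of_forall_apply_prod fun s t hs ht => ?_
  rw [withDensityᵥ_apply (hr.smul_prod hh) (hs.prod ht), withDensityᵥ_apply hr hs,
    withDensityᵥ_apply hh ht, ← Measure.prod_restrict, integral_prod_smul]
  simp

instance : NormedSpace ℝ (ComplexMeasure X) where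
  norm_smul_le c ρ := by
    simp only [norm_def, VectorMeasure.variation_smul]
    simp

instance : SMulCommClass ℝ ℂ (ComplexMeasure X) where
  smul_comm a b ρ := by
    ext s _
    simp only [smul_apply]
    exact smul_comm a b (ρ s)

theorem real_smul_eq (c : ℝ) (ρ : ComplexMeasure X) : c • ρ = (c : ℂ) • ρ := by
  ext s _
  simp [smul_apply]

theorem pairing_const_mul (ρ : ComplexMeasure X) (c : ℂ) {f : X → ℂ}
    (hf : Measurable f) {C : ℝ} (hC : ∀ x, ‖f x‖ ≤ C) :
    pairing ρ (fun x => c * f x) = c * pairing ρ f := by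
  obtain ⟨h, hm, hi, he⟩ := exists_eq_withDensityᵥ_variation ρ
  rw [← he, pairing_withDensityᵥ hi hf hC, pairing_withDensityᵥ hi (hf.const_mul c)
    (C := ‖c‖ * C) (fun x => by
      rw [norm_mul]; exact mul_le_mul_of_nonneg_left (hC x) (norm_nonneg _)),
    ← integral_const_mul]
  refine integral_congr_ae (Eventually.of_forall fun k => ?_)
  simp only
  ring

theorem norm_pairing_le_of_enorm_le (ρ : ComplexMeasure X) {f : X → ℂ}
    {B : ℝ} (hB : 0 ≤ B) (h : ∀ w, ‖f w‖ₑ ≤ ENNReal.ofReal B) : ‖pairing ρ f‖ ≤ B * ‖ρ‖ := by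
  refine (norm_pairing_le _ _).trans ?_
  have h1 : ∀ w, ‖f w‖ ≤ B := fun w => by
    have := h w
    rwa [← ofReal_norm, ENNReal.ofReal_le_ofReal_iff hB] at this
  have : ∫ x, ‖f x‖ ∂ρ.variation ≤ ∫ x, B ∂ρ.variation :=
    integral_mono_of_nonneg (Eventually.of_forall fun _ => norm_nonneg _) (integrable_const _)
      (Eventually.of_forall h1)
  refine this.trans_eq ?_
  rw [integral_const, smul_eq_mul, norm_def, mul_comm]

variable {d p q : ℕ}

theorem norm_le_tvNorm (ρ : Meas d p q) : ‖ρ‖ ≤ tvNorm ρ := by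
  rw [norm_def, tvNorm, measureReal_def, ← ENNReal.toReal_add (measure_ne_top _ _)
    (measure_ne_top _ _), ← Measure.add_apply]
  exact ENNReal.toReal_mono (measure_ne_top _ _) (variation_le_re_add_im ρ _)

theorem tvNorm_le_two_mul_norm (ρ : Meas d p q) : tvNorm ρ ≤ 2 * ‖ρ‖ := by
  have key : ∀ s : SignedMeasure (DualVar d p q), (∀ t, |s t| ≤ ‖ρ t‖) →
      (s.totalVariation Set.univ).toReal ≤ ‖ρ‖ := by
    intro s hs
    rw [SignedMeasure.totalVariation_eq_variation]
    refine ENNReal.toReal_mono (measure_ne_top _ _) ?_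
    refine (VectorMeasure.variation_le_of_forall_enorm_le fun t _ => ?_) _
    refine le_trans ?_ (VectorMeasure.enorm_measure_le_variation ρ t)
    rw [← ofReal_norm, ← ofReal_norm]
    exact ENNReal.ofReal_le_ofReal (hs t)
  have h1 := key (ComplexMeasure.re ρ) fun t => Complex.abs_re_le_norm (ρ t)
  have h2 := key (ComplexMeasure.im ρ) fun t => Complex.abs_im_le_norm (ρ t)
  rw [tvNorm]
  linarith

/-- A bound of the operator norm for the variation norm bounds, up to a factor `2`, the operator
norm for the sum of the total variations of real and imaginary parts. -/
theorem opNormLE_of_norm_le {T : Module.End ℂ (Meas d p q)} {B : ℝ} (hB : 0 ≤ B)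
    (h : ∀ ρ, ‖T ρ‖ ≤ B * ‖ρ‖) : OpNormLE T (2 * B) := fun ρ =>
  calc tvNorm (T ρ) ≤ 2 * ‖T ρ‖ := tvNorm_le_two_mul_norm _
    _ ≤ 2 * (B * tvNorm ρ) := by
      have := mul_le_mul_of_nonneg_left (norm_le_tvNorm ρ) hB
      linarith [h ρ]
    _ = 2 * B * tvNorm ρ := by ring

/-- Derivatives in total variation are derivatives for the equivalent variation norm. -/
theorem hasTVDeriv_iff {ψ φ : ℝ → Meas d p q} :
    HasTVDeriv ψ φ ↔ ∀ z, 0 ≤ z → HasDerivWithinAt ψ (φ z) (Set.Ici 0) z := by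
  refine forall₂_congr fun z _ => ?_
  rw [hasDerivWithinAt_iff_tendsto_slope, tendsto_iff_norm_sub_tendsto_zero (f := slope ψ z)]
  change _ ↔ Tendsto (fun s => ‖(s - z)⁻¹ • (ψ s - ψ z) - φ z‖) _ _
  constructor
  · intro h
    exact squeeze_zero (fun _ => norm_nonneg _) (fun _ => norm_le_tvNorm _) h
  · intro h
    refine squeeze_zero (fun _ => (norm_nonneg _).trans (norm_le_tvNorm _))
      (fun _ => tvNorm_le_two_mul_norm _) ?_
    simpa using h.const_mul 2

end ComplexMeasures

/-! ### Strong calculus and linear evolution equations -/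

section StrongCalculus

set_option linter.unusedSectionVars false

variable {𝕜 E : Type*} [NontriviallyNormedField 𝕜] [NormedAddCommGroup E] [NormedSpace ℝ E]
  [NormedSpace 𝕜 E] [CompleteSpace E]

/-- Strong continuity of a family of bounded operators. -/
def StrongCont (A : ℝ → E →L[𝕜] E) : Prop := ∀ φ, Continuous fun z => A z φ

/-- `A'` is the strong derivative of the family of bounded operators `A`. -/
def StrongDeriv (A A' : ℝ → E →L[𝕜] E) : Prop :=
  ∀ φ z, HasDerivAt (fun s => A s φ) (A' z φ) z

theorem StrongDeriv.strongCont {A A' : ℝ → E →L[𝕜] E} (h : StrongDeriv A A') : StrongCont A :=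
  fun φ => continuous_iff_continuousAt.2 fun z => (h φ z).continuousAt

/-- By the uniform boundedness principle, strongly continuous families are locally bounded. -/
theorem StrongCont.exists_bound {A : ℝ → E →L[𝕜] E} (hA : StrongCont A) (a b : ℝ) :
    ∃ M, 0 ≤ M ∧ ∀ z ∈ Set.Icc a b, ‖A z‖ ≤ M := by
  obtain ⟨M, hM⟩ := banach_steinhaus (g := fun z : Set.Icc a b => A z) fun φ => by
    obtain ⟨C, hC⟩ :=
      isCompact_Icc.exists_bound_of_continuousOn (hA φ).continuousOn (s := Set.Icc a b)
    exact ⟨C, fun z => hC z z.2⟩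
  exact ⟨max M 0, le_max_right _ _, fun z hz => (hM ⟨z, hz⟩).trans (le_max_left _ _)⟩

/-- Joint continuity of `(z, ψ) ↦ A z ψ`, which follows from the local bound. -/
theorem StrongCont.tendsto_apply {A : ℝ → E →L[𝕜] E} (hA : StrongCont A) {ψ : ℝ → E} {φ : E} {z : ℝ}
    {l : Filter ℝ} (hl : l ≤ 𝓝 z) (hψ : Tendsto ψ l (𝓝 φ)) :
    Tendsto (fun s => A s (ψ s)) l (𝓝 (A z φ)) := by
  obtain ⟨M, hM0, hM⟩ := hA.exists_bound (z - 1) (z + 1)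
  have h1 : Tendsto (fun s => A s (ψ s - φ)) l (𝓝 0) := by
    have h2 : Tendsto (fun s => M * ‖ψ s - φ‖) l (𝓝 0) := by
      simpa using (tendsto_iff_norm_sub_tendsto_zero.1 hψ).const_mul M
    refine squeeze_zero_norm' ?_ h2
    filter_upwards [hl (Icc_mem_nhds (sub_one_lt z) (lt_add_one z))] with s hs
    exact (A s).le_of_opNorm_le (hM s hs) _
  have h3 := h1.add (((hA φ).tendsto z).mono_left hl)
  simpa using h3

theorem StrongCont.continuous_apply {A : ℝ → E →L[𝕜] E} (hA : StrongCont A) {ψ : ℝ → E}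
    (hψ : Continuous ψ) : Continuous fun s => A s (ψ s) :=
  continuous_iff_continuousAt.2 fun z => hA.tendsto_apply le_rfl (hψ.tendsto z)

theorem StrongCont.mul {A B : ℝ → E →L[𝕜] E} (hA : StrongCont A) (hB : StrongCont B) :
    StrongCont fun z => A z * B z := fun φ => hA.continuous_apply (hB φ)

theorem StrongCont.add {A B : ℝ → E →L[𝕜] E} (hA : StrongCont A) (hB : StrongCont B) :
    StrongCont fun z => A z + B z := fun φ => (hA φ).add (hB φ)

theorem strongCont_const (A : E →L[𝕜] E) : StrongCont fun _ => A := fun _ => continuous_const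

/-- The product rule for a strongly differentiable family applied to a differentiable curve. -/
theorem StrongDeriv.apply {A A' : ℝ → E →L[𝕜] E} (hA : StrongDeriv A A') {ψ : ℝ → E} {ψ' : E}
    {z : ℝ} (hψ : HasDerivAt ψ ψ' z) :
    HasDerivAt (fun s => A s (ψ s)) (A' z (ψ z) + A z ψ') z := by
  have h1 := hasDerivAt_iff_tendsto_slope.1 (hA (ψ z) z)
  have h2 := hA.strongCont.tendsto_apply (l := 𝓝[≠] z) nhdsWithin_le_nhds
    (hasDerivAt_iff_tendsto_slope.1 hψ)
  refine hasDerivAt_iff_tendsto_slope.2 ((h1.add h2).congr fun s => ?_)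
  have h3 : ∀ c : ℝ, ∀ φ, A s (c • φ) = c • A s φ := fun c φ =>
    map_real_smul (A s) (A s).continuous c φ
  simp only [slope, vsub_eq_sub, h3, map_sub, ← smul_add]
  congr 1
  abel

theorem StrongDeriv.mul {A A' B B' : ℝ → E →L[𝕜] E} (hA : StrongDeriv A A')
    (hB : StrongDeriv B B') : StrongDeriv (fun z => A z * B z) fun z => A' z * B z + A z * B' z :=
  fun φ z => hA.apply (hB φ z)

theorem StrongDeriv.add {A A' B B' : ℝ → E →L[𝕜] E} (hA : StrongDeriv A A')
    (hB : StrongDeriv B B') : StrongDeriv (fun z => A z + B z) fun z => A' z + B' z :=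
  fun φ z => (hA φ z).add (hB φ z)

theorem StrongDeriv.sub {A A' B B' : ℝ → E →L[𝕜] E} (hA : StrongDeriv A A')
    (hB : StrongDeriv B B') : StrongDeriv (fun z => A z - B z) fun z => A' z - B' z :=
  fun φ z => (hA φ z).sub (hB φ z)

theorem StrongDeriv.sum {ι : Type*} {s : Finset ι} {A A' : ι → ℝ → E →L[𝕜] E}
    (h : ∀ i ∈ s, StrongDeriv (A i) (A' i)) :
    StrongDeriv (fun z => ∑ i ∈ s, A i z) fun z => ∑ i ∈ s, A' i z := fun φ z => by
  simpa using HasDerivAt.fun_sum fun i hi => h i hi φ z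

theorem strongDeriv_const (A : E →L[𝕜] E) : StrongDeriv (fun _ => A) fun _ => 0 :=
  fun φ z => by simpa using hasDerivAt_const z (A φ)

/-- A strongly continuous family has a strong antiderivative, given by Bochner integrals. -/
theorem StrongCont.exists_integral {A : ℝ → E →L[𝕜] E} (hA : StrongCont A) [SMulCommClass ℝ 𝕜 E] :
    ∃ W : ℝ → E →L[𝕜] E, StrongDeriv W A ∧ ∀ z φ, W z φ = ∫ s in (0 : ℝ)..z, A s φ := by
  have hint : ∀ φ a b, IntervalIntegrable (fun s => A s φ) volume a b := fun φ a b =>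
    (hA φ).intervalIntegrable a b
  let W : ℝ → E →L[𝕜] E := fun z => LinearMap.mkContinuousOfExistsBound
    { toFun := fun φ => ∫ s in (0 : ℝ)..z, A s φ
      map_add' := fun φ ψ => by
        simp only [map_add]
        exact intervalIntegral.integral_add (hint φ _ _) (hint ψ _ _)
      map_smul' := fun c φ => by
        simp only [map_smul, RingHom.id_apply]
        exact intervalIntegral.integral_smul c _ }
    (by
      obtain ⟨M, hM0, hM⟩ := hA.exists_bound (-|z|) |z|
      refine ⟨M * |z|, fun φ => ?_⟩
      have := intervalIntegral.norm_integral_le_of_norm_le_const (a := 0) (b := z)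
        (f := fun s => A s φ) (C := M * ‖φ‖) fun s hs => (A s).le_of_opNorm_le (hM s (by
          rcases Set.mem_uIoc.1 hs with h | h
          · exact ⟨by linarith [abs_nonneg z], h.2.trans (le_abs_self z)⟩
          · exact ⟨by linarith [neg_abs_le z], by linarith [abs_nonneg z]⟩)) φ
      simp only [LinearMap.coe_mk, AddHom.coe_mk]
      calc _ ≤ _ := this
        _ = _ := by rw [sub_zero]; ring)
  refine ⟨W, fun φ z => ?_, fun z φ => rfl⟩
  exact intervalIntegral.integral_hasDerivAt_right (hint φ _ _)
    ((hA φ).stronglyMeasurableAtFilter _ _) (hA φ).continuousAt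

omit [NormedSpace 𝕜 E] [CompleteSpace E] in
/-- Gronwall's inequality for a curve with `‖ψ'‖ ≤ K ‖ψ‖ + ε`. -/
theorem norm_le_of_gronwall {ψ ψ' : ℝ → E} {K ε Z : ℝ} (hK : 0 ≤ K) (hε : 0 ≤ ε)
    (hψ : ∀ z ∈ Set.Icc 0 Z, HasDerivWithinAt ψ (ψ' z) (Set.Ici 0) z)
    (hb : ∀ z ∈ Set.Icc 0 Z, ‖ψ' z‖ ≤ K * ‖ψ z‖ + ε) :
    ∀ z ∈ Set.Icc 0 Z, ‖ψ z‖ ≤ (‖ψ 0‖ + ε * z) * Real.exp (K * z) := by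
  intro z hz
  have h := norm_le_gronwallBound_of_norm_deriv_right_le (f := ψ) (f' := ψ') (δ := ‖ψ 0‖) (K := K)
    (ε := ε) (a := 0) (b := Z)
    (fun x hx => ((hψ x hx).mono Set.Icc_subset_Ici_self).continuousWithinAt)
    (fun x hx => (hψ x ⟨hx.1, hx.2.le⟩).mono (Set.Ici_subset_Ici.2 hx.1)) le_rfl
    (fun x hx => hb x ⟨hx.1, hx.2.le⟩) z hz
  refine h.trans ?_
  rw [sub_zero]
  rcases eq_or_ne K 0 with rfl | hK0
  · rw [gronwallBound_K0]; simp
  · rw [gronwallBound_of_K_ne_0 hK0, add_mul]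
    have hK' : 0 < K := lt_of_le_of_ne hK (Ne.symm hK0)
    -- the quotient `(exp (K z) - 1) / K` is at most `z exp (K z)`, uniformly in `K`
    have h1 : Real.exp (K * z) - 1 ≤ K * z * Real.exp (K * z) := by
      have h2 := Real.add_one_le_exp (-(K * z))
      have h3 : Real.exp (K * z) * Real.exp (-(K * z)) = 1 := by rw [← Real.exp_add]; simp
      nlinarith [Real.exp_pos (K * z)]
    have h4 : ε / K * (Real.exp (K * z) - 1) ≤ ε / K * (K * z * Real.exp (K * z)) :=
      mul_le_mul_of_nonneg_left h1 (by positivity)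
    have h5 : ε / K * (K * z * Real.exp (K * z)) = ε * z * Real.exp (K * z) := by
      field_simp
    linarith

/-- Solutions of a linear equation on `[0, ∞)` with bounded generator are determined by their
initial value. -/
theorem eq_of_linear_ode {L : ℝ → E →L[𝕜] E} {M : ℝ} (hM : ∀ z, ‖L z‖ ≤ M) {ψ χ : ℝ → E}
    (hψ : ∀ z, 0 ≤ z → HasDerivWithinAt ψ (L z (ψ z)) (Set.Ici 0) z)
    (hχ : ∀ z, 0 ≤ z → HasDerivWithinAt χ (L z (χ z)) (Set.Ici 0) z) (h0 : ψ 0 = χ 0) {z : ℝ}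
    (hz : 0 ≤ z) : ψ z = χ z := by
  have h := norm_le_of_gronwall (ψ := fun s => ψ s - χ s)
    (ψ' := fun s => L s (ψ s) - L s (χ s)) (K := M) (ε := 0) (Z := z)
    ((norm_nonneg _).trans (hM 0)) le_rfl (fun s hs => (hψ s hs.1).sub (hχ s hs.1))
    (fun s _ => by rw [← map_sub, add_zero]; exact (L s).le_of_opNorm_le (hM s) _) z ⟨hz, le_rfl⟩
  simp only [h0, sub_self, norm_zero, zero_mul, add_zero] at h
  exact sub_eq_zero.1 (norm_le_zero_iff.1 h)

/-- Solutions on the whole line are determined by their initial value. -/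
theorem eq_of_linear_ode_univ {L : ℝ → E →L[𝕜] E} {M : ℝ} (hM : ∀ z, ‖L z‖ ≤ M) {ψ χ : ℝ → E}
    (hψ : ∀ z, HasDerivAt ψ (L z (ψ z)) z) (hχ : ∀ z, HasDerivAt χ (L z (χ z)) z)
    (h0 : ψ 0 = χ 0) (z : ℝ) : ψ z = χ z := by
  rcases le_total 0 z with hz | hz
  · exact eq_of_linear_ode hM (fun s _ => (hψ s).hasDerivWithinAt)
      (fun s _ => (hχ s).hasDerivWithinAt) h0 hz
  -- for negative times, reverse the direction of time
  · have key : ∀ φ : ℝ → E, (∀ z, HasDerivAt φ (L z (φ z)) z) → ∀ s,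
        HasDerivAt (fun s => φ (-s)) ((-L (-s)) (φ (-s))) s := fun φ hφ s => by
      simpa [Function.comp_def] using (hφ (-s)).scomp s (hasDerivAt_neg s)
    have h := eq_of_linear_ode (L := fun s => -L (-s)) (ψ := fun s => ψ (-s))
      (χ := fun s => χ (-s)) (M := M) (fun s => by rw [norm_neg]; exact hM _)
      (fun s _ => (key ψ hψ s).hasDerivWithinAt) (fun s _ => (key χ hχ s).hasDerivWithinAt)
      (by simpa using h0) (z := -z) (by linarith)
    simpa using h

/-- The terms of the Dyson series. -/
def dysonTerm (L : ℝ → E →L[𝕜] E) (ρ : E) : ℕ → ℝ → E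
  | 0 => fun _ => ρ
  | n + 1 => fun z => ∫ s in (0 : ℝ)..z, L s (dysonTerm L ρ n s)

theorem continuous_dysonTerm {L : ℝ → E →L[𝕜] E} (hL : StrongCont L) (ρ : E) (n : ℕ) :
    Continuous (dysonTerm L ρ n) := by
  induction n with
  | zero => exact continuous_const
  | succ n ih =>
    exact intervalIntegral.continuous_primitive
      (fun a b => (hL.continuous_apply ih).intervalIntegrable a b) 0

theorem hasDerivAt_dysonTerm {L : ℝ → E →L[𝕜] E} (hL : StrongCont L) (ρ : E) (n : ℕ) (z : ℝ) :
    HasDerivAt (dysonTerm L ρ (n + 1)) (L z (dysonTerm L ρ n z)) z := by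
  have h := hL.continuous_apply (continuous_dysonTerm hL ρ n)
  exact intervalIntegral.integral_hasDerivAt_right (h.intervalIntegrable _ _)
    (h.stronglyMeasurableAtFilter _ _) h.continuousAt

omit [NormedSpace 𝕜 E] [CompleteSpace E] in
theorem norm_integral_le_pow_factorial {g : ℝ → E} {M r z : ℝ} {n : ℕ} (hz : 0 ≤ z)
    (hg : ∀ s, 0 ≤ s → ‖g s‖ ≤ M * ((M * s) ^ n / n.factorial * r)) :
    ‖∫ s in (0 : ℝ)..z, g s‖ ≤ (M * z) ^ (n + 1) / (n + 1).factorial * r := by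
  have h1 : ‖∫ s in (0 : ℝ)..z, g s‖ ≤ ∫ s in (0 : ℝ)..z, M * ((M * s) ^ n / n.factorial * r) :=
    intervalIntegral.norm_integral_le_of_norm_le hz
      (Eventually.of_forall fun s hs => hg s hs.1.le)
      (Continuous.intervalIntegrable (by fun_prop) _ _)
  refine h1.trans_eq ?_
  have h2 : (fun s : ℝ => M * ((M * s) ^ n / n.factorial * r)) =
      fun s => (M ^ (n + 1) / n.factorial * r) * s ^ n := by
    ext s; rw [mul_pow]; ring
  rw [h2, intervalIntegral.integral_const_mul, integral_pow, Nat.factorial_succ]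
  push_cast
  field_simp
  ring

/-- The `n`-th Dyson term is an integral over a simplex of volume `|z|ⁿ / n!`. -/
theorem norm_dysonTerm_le {L : ℝ → E →L[𝕜] E} {M : ℝ} (hM : ∀ z, ‖L z‖ ≤ M) (ρ : E) (n : ℕ)
    (z : ℝ) : ‖dysonTerm L ρ n z‖ ≤ (M * |z|) ^ n / n.factorial * ‖ρ‖ := by
  have hM0 : 0 ≤ M := (norm_nonneg _).trans (hM 0)
  induction n generalizing z with
  | zero => simp [dysonTerm]
  | succ n ih =>
    have hb : ∀ s, ‖L s (dysonTerm L ρ n s)‖ ≤ M * ((M * |s|) ^ n / n.factorial * ‖ρ‖) :=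
      fun s => (L s).le_of_opNorm_le_of_le (hM s) (ih s)
    rcases le_total 0 z with hz | hz
    · rw [abs_of_nonneg hz]
      exact norm_integral_le_pow_factorial hz fun s hs => by
        simpa only [abs_of_nonneg hs] using hb s
    · rw [abs_of_nonpos hz]
      have h1 : dysonTerm L ρ (n + 1) z =
          -∫ s in (0 : ℝ)..(-z), L (-s) (dysonTerm L ρ n (-s)) := by
        rw [intervalIntegral.integral_comp_neg fun s => L s (dysonTerm L ρ n s),
          intervalIntegral.integral_symm]
        simp [dysonTerm]
      rw [h1, norm_neg]
      exact norm_integral_le_pow_factorial (by linarith) fun s hs => by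
        simpa only [abs_neg, abs_of_nonneg hs] using hb (-s)

/-- A strongly continuous, bounded family `L` generates a family of bounded solution operators of
`∂_z ψ = L(z) ψ`, the sum of the Dyson series. -/
theorem exists_solutionOperator [SMulCommClass ℝ 𝕜 E] {L : ℝ → E →L[𝕜] E} (hL : StrongCont L)
    {M : ℝ} (hM : ∀ z, ‖L z‖ ≤ M) :
    ∃ U : ℝ → E →L[𝕜] E, U 0 = 1 ∧ StrongDeriv U (fun z => L z * U z) ∧
      ∀ z, ‖U z‖ ≤ Real.exp (M * |z|) := by
  have hM0 : 0 ≤ M := (norm_nonneg _).trans (hM 0)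
  have hsum : ∀ ρ z, Summable fun n => dysonTerm L ρ n z := fun ρ z =>
    Summable.of_norm_bounded ((Real.summable_pow_div_factorial (M * |z|)).mul_right ‖ρ‖)
      fun n => norm_dysonTerm_le hM ρ n z
  have hadd : ∀ ρ σ n z, dysonTerm L (ρ + σ) n z = dysonTerm L ρ n z + dysonTerm L σ n z := by
    intro ρ σ n
    induction n with
    | zero => intro z; rfl
    | succ n ih =>
      intro z
      simp only [dysonTerm, ih, map_add]
      exact intervalIntegral.integral_add
        ((hL.continuous_apply (continuous_dysonTerm hL ρ n)).intervalIntegrable _ _)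
        ((hL.continuous_apply (continuous_dysonTerm hL σ n)).intervalIntegrable _ _)
  have hsmul : ∀ (c : 𝕜) ρ n z, dysonTerm L (c • ρ) n z = c • dysonTerm L ρ n z := by
    intro c ρ n
    induction n with
    | zero => intro z; rfl
    | succ n ih =>
      intro z
      simp only [dysonTerm, ih, map_smul]
      exact intervalIntegral.integral_smul c _
  have hexp : ∀ x : ℝ, HasSum (fun n : ℕ => x ^ n / n.factorial) (Real.exp x) := fun x => by
    rw [Real.exp_eq_exp_ℝ]
    exact NormedSpace.expSeries_div_hasSum_exp x
  let U : ℝ → E →L[𝕜] E := fun z => LinearMap.mkContinuous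
    { toFun := fun ρ => ∑' n, dysonTerm L ρ n z
      map_add' := fun ρ σ => by
        simp only [hadd]
        exact (hsum ρ z).tsum_add (hsum σ z)
      map_smul' := fun c ρ => by
        simp only [hsmul, RingHom.id_apply]
        exact (hsum ρ z).tsum_const_smul c }
    (Real.exp (M * |z|)) (fun ρ => tsum_of_norm_bounded ((hexp _).mul_right _)
      fun n => norm_dysonTerm_le hM ρ n z)
  have hUapp : ∀ z ρ, U z ρ = ∑' n, dysonTerm L ρ n z := fun z ρ => rfl
  refine ⟨U, ?_, fun ρ z => ?_, fun z => LinearMap.mkContinuous_norm_le _ (Real.exp_pos _).le _⟩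
  · ext ρ
    rw [hUapp, tsum_eq_single 0]
    · rfl
    · intro n hn
      obtain ⟨m, rfl⟩ := Nat.exists_eq_succ_of_ne_zero hn
      simp [dysonTerm]
  · have h1 : (fun s => U s ρ) = fun s => ρ + ∑' n, dysonTerm L ρ (n + 1) s := by
      ext s
      rw [hUapp, (hsum ρ s).tsum_eq_zero_add]
      rfl
    have h2 : (L z * U z) ρ = ∑' n, L z (dysonTerm L ρ n z) := by
      change L z (U z ρ) = _
      rw [hUapp]
      exact (L z).map_tsum (hsum ρ z)
    rw [h1, h2]
    refine HasDerivAt.const_add _ ?_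
    have hz : z ∈ Set.Ioo (-(|z| + 1)) (|z| + 1) := by
      constructor <;> linarith [neg_abs_le z, le_abs_self z]
    -- differentiate term by term on a bounded interval around `z`
    refine hasDerivAt_tsum_of_isPreconnected (g := fun n => dysonTerm L ρ (n + 1))
      (g' := fun n s => L s (dysonTerm L ρ n s)) (t := Set.Ioo (-(|z| + 1)) (|z| + 1)) (y₀ := z)
      (u := fun n => M * ((M * (|z| + 1)) ^ n / n.factorial * ‖ρ‖))
      (((Real.summable_pow_div_factorial _).mul_right _).mul_left _) isOpen_Ioo
      isPreconnected_Ioo (fun n y _ => hasDerivAt_dysonTerm hL ρ n y) (fun n y hy => ?_) hz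
      ((summable_nat_add_iff (f := fun n => dysonTerm L ρ n z) 1).2 (hsum ρ z)) hz
    refine (L y).le_of_opNorm_le_of_le (hM y) ((norm_dysonTerm_le hM ρ n y).trans ?_)
    have : |y| ≤ |z| + 1 := abs_le.2 ⟨hy.1.le, hy.2.le⟩
    gcongr

/-- An operator commuting with the generator commutes with the solution operators: `A U ρ` and `U A
ρ` solve the same equation with the same initial value. -/
theorem commute_solutionOperator {L U : ℝ → E →L[𝕜] E} {M : ℝ} (hM : ∀ z, ‖L z‖ ≤ M)
    (h0 : U 0 = 1) (hU : StrongDeriv U fun z => L z * U z) {A : E →L[𝕜] E}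
    (hA : ∀ z, Commute A (L z)) (z : ℝ) : Commute A (U z) := by
  ext ρ
  refine eq_of_linear_ode_univ (ψ := fun s => A (U s ρ)) (χ := fun s => U s (A ρ)) hM (fun s => ?_)
    (fun s => hU (A ρ) s) (by simp [h0]) z
  have h1 := (strongDeriv_const A).apply (hU ρ s)
  have h2 : A (L s (U s ρ)) = L s (A (U s ρ)) := DFunLike.congr_fun (hA s).eq (U s ρ)
  simpa [h2] using h1

/-- A strongly differentiable solution operator of a generator bounded by `M` grows at most like
`exp (M z)`. -/
theorem norm_solutionOperator_le {L U : ℝ → E →L[𝕜] E} {M : ℝ} (hM : ∀ z, ‖L z‖ ≤ M)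
    (h0 : U 0 = 1) (hU : StrongDeriv U fun z => L z * U z) {z : ℝ} (hz : 0 ≤ z) :
    ‖U z‖ ≤ Real.exp (M * z) := by
  refine ContinuousLinearMap.opNorm_le_bound _ (Real.exp_pos _).le fun ρ => ?_
  have := norm_le_of_gronwall (ψ := fun s => U s ρ) (ψ' := fun s => L s (U s ρ)) (K := M) (ε := 0)
    (Z := z) ((norm_nonneg _).trans (hM 0)) le_rfl (fun s _ => (hU ρ s).hasDerivWithinAt)
    (fun s _ => by rw [add_zero]; exact (L s).le_of_opNorm_le (hM s) _) z ⟨hz, le_rfl⟩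
  simpa [h0, mul_comm] using this

end StrongCalculus

/-! ### Matchings -/

section Matchings

variable {p q : ℕ}

/-- The product over a set of pairs in lexicographic order, as in `pairProd`. -/
def orderedProd {M : Type*} [Monoid M] (f : Fin p × Fin q → M) (Λ : Finset (Fin p × Fin q)) : M :=
  (((List.finRange p ×ˢ List.finRange q).filter (fun γ => γ ∈ Λ)).map f).prod

theorem orderedProd_empty {M : Type*} [Monoid M] (f : Fin p × Fin q → M) :
    orderedProd f ∅ = 1 := by
  simp [orderedProd]

/-- For commuting factors the order in `orderedProd` is irrelevant. -/
theorem orderedProd_insert {M : Type*} [Monoid M] {f : Fin p × Fin q → M}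
    {Λ : Finset (Fin p × Fin q)} {γ : Fin p × Fin q} (hγ : γ ∉ Λ)
    (hc : ∀ a ∈ insert γ Λ, ∀ b ∈ insert γ Λ, a ≠ b → Commute (f a) (f b)) :
    orderedProd f (insert γ Λ) = f γ * orderedProd f Λ := by
  have hnd : (List.finRange p ×ˢ List.finRange q).Nodup :=
    (List.nodup_finRange p).product (List.nodup_finRange q)
  have hmem : ∀ a, a ∈ List.finRange p ×ˢ List.finRange q := fun a =>
    List.mem_product.2 ⟨List.mem_finRange _, List.mem_finRange _⟩
  have hperm : ((List.finRange p ×ˢ List.finRange q).filter (fun a => a ∈ insert γ Λ)).Perm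
      (γ :: (List.finRange p ×ˢ List.finRange q).filter (fun a => a ∈ Λ)) := by
    refine (List.perm_ext_iff_of_nodup (hnd.filter _) (List.nodup_cons.2 ⟨?_, hnd.filter _⟩)).2 ?_
    · simp [hγ]
    · intro a
      simp [hmem]
  unfold orderedProd
  rw [(hperm.map f).prod_eq' ?_, List.map_cons, List.prod_cons]
  rw [List.pairwise_map]
  refine (hnd.filter _).imp_of_mem fun {a b} ha hb hab => hc a ?_ b ?_ hab
  · simpa using (List.mem_filter.1 ha).2
  · simpa using (List.mem_filter.1 hb).2

theorem map_orderedProd {M N : Type*} [Monoid M] [Monoid N] (φ : M →* N) (f : Fin p × Fin q → M)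
    (Λ : Finset (Fin p × Fin q)) : φ (orderedProd f Λ) = orderedProd (fun γ => φ (f γ)) Λ := by
  simp [orderedProd, map_list_prod, Function.comp_def]

/-- Any two different pairs of the set differ in both components. -/
def IsMatching (Λ : Finset (Fin p × Fin q)) : Prop :=
  ∀ γ ∈ Λ, ∀ γ' ∈ Λ, γ ≠ γ' → γ.1 ≠ γ'.1 ∧ γ.2 ≠ γ'.2

instance : DecidablePred (IsMatching (p := p) (q := q)) := fun Λ => by
  unfold IsMatching; infer_instance

theorem IsMatching.mono {Λ Λ' : Finset (Fin p × Fin q)} (h : IsMatching Λ) (hs : Λ' ⊆ Λ) :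
    IsMatching Λ' := fun γ hγ γ' hγ' => h γ (hs hγ) γ' (hs hγ')

theorem IsMatching.two_mul_card_le {Λ : Finset (Fin p × Fin q)} (h : IsMatching Λ) :
    2 * Λ.card ≤ p + q := by
  have h1 : Λ.card ≤ p := by
    have := Finset.card_le_card_of_injOn (t := Finset.univ) (s := Λ) Prod.fst (fun _ _ => by simp)
      (fun a ha b hb hab => by_contra fun hne => (h a ha b hb hne).1 hab)
    simpa using this
  have h2 : Λ.card ≤ q := by
    have := Finset.card_le_card_of_injOn (t := Finset.univ) (s := Λ) Prod.snd (fun _ _ => by simp)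
      (fun a ha b hb hab => by_contra fun hne => (h a ha b hb hne).2 hab)
    simpa using this
  omega

/-- All matchings, the empty one included. -/
def matchings (p q : ℕ) : Finset (Finset (Fin p × Fin q)) := Finset.univ.filter IsMatching

theorem mem_matchings {Λ : Finset (Fin p × Fin q)} : Λ ∈ matchings p q ↔ IsMatching Λ := by
  simp [matchings]

theorem matchings_eq_insert : matchings p q = insert ∅ (pairings p q) := by
  ext Λ
  rw [mem_matchings, Finset.mem_insert, pairings, Finset.mem_filter]
  constructor
  · intro h
    rcases Λ.eq_empty_or_nonempty with h0 | h0
    · exact Or.inl h0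
    · exact Or.inr ⟨Finset.mem_univ _, h0, h⟩
  · rintro (rfl | h)
    · intro γ hγ; simp at hγ
    · exact h.2.2

theorem sum_matchings {M : Type*} [AddCommMonoid M] (f : Finset (Fin p × Fin q) → M) :
    ∑ Λ ∈ matchings p q, f Λ = f ∅ + ∑ Λ ∈ pairings p q, f Λ := by
  rw [matchings_eq_insert, Finset.sum_insert]
  simp [pairings]

theorem conflicting_empty : conflicting (∅ : Finset (Fin p × Fin q)) = ∅ := by
  simp [conflicting]

/-- Summing over all pairs splits into the pairs in the matching, those conflicting with it, and
those that can be added to it. -/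
theorem sum_univ_eq_of_matching {M : Type*} [AddCommMonoid M] (f : Fin p × Fin q → M)
    (Λ : Finset (Fin p × Fin q)) :
    ∑ γ, f γ = ∑ γ ∈ Λ, f γ + ∑ γ ∈ conflicting Λ, f γ +
      ∑ γ with γ ∉ Λ ∧ ∀ γ' ∈ Λ, γ.1 ≠ γ'.1 ∧ γ.2 ≠ γ'.2, f γ := by
  rw [← Finset.sum_filter_add_sum_filter_not Finset.univ (fun γ => γ ∈ Λ), add_assoc]
  congr 1
  · exact Finset.sum_congr (by ext; simp) fun _ _ => rfl
  · rw [← Finset.sum_filter_add_sum_filter_not (Finset.univ.filter fun γ => γ ∉ Λ)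
      (fun γ => ∃ γ' ∈ Λ, γ.1 = γ'.1 ∨ γ.2 = γ'.2), Finset.filter_filter, Finset.filter_filter]
    congr 1
    refine Finset.sum_congr ?_ fun _ _ => rfl
    ext γ
    simp

/-- Adding an admissible pair to a matching is inverse to removing a pair from a matching. -/
theorem sum_matchings_insert {M : Type*} [AddCommMonoid M]
    (f : Fin p × Fin q → Finset (Fin p × Fin q) → M) :
    ∑ Λ ∈ matchings p q, ∑ γ with γ ∉ Λ ∧ ∀ γ' ∈ Λ, γ.1 ≠ γ'.1 ∧ γ.2 ≠ γ'.2, f γ Λ =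
      ∑ Λ ∈ matchings p q, ∑ γ ∈ Λ, f γ (Λ.erase γ) := by
  rw [Finset.sum_sigma', Finset.sum_sigma']
  refine Finset.sum_bij' (fun x _ => ⟨insert x.2 x.1, x.2⟩) (fun x _ => ⟨x.1.erase x.2, x.2⟩)
    ?_ ?_ ?_ ?_ ?_
  · rintro ⟨Λ, γ⟩ h
    simp only [Finset.mem_sigma, mem_matchings, Finset.mem_filter, Finset.mem_univ, true_and] at h
    simp only [Finset.mem_sigma, mem_matchings, Finset.mem_insert_self, and_true]
    obtain ⟨h1, h2, h3⟩ := h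
    intro a ha b hb hab
    rcases Finset.mem_insert.1 ha with rfl | ha' <;> rcases Finset.mem_insert.1 hb with rfl | hb'
    · exact absurd rfl hab
    · exact h3 b hb'
    · exact ⟨(h3 a ha').1.symm, (h3 a ha').2.symm⟩
    · exact h1 a ha' b hb' hab
  · rintro ⟨Λ, γ⟩ h
    simp only [Finset.mem_sigma, mem_matchings] at h
    simp only [Finset.mem_sigma, mem_matchings, Finset.mem_filter, Finset.mem_univ, true_and]
    refine ⟨h.1.mono (Finset.erase_subset _ _), by simp, fun γ' hγ' => ?_⟩
    exact h.1 γ h.2 γ' (Finset.mem_of_mem_erase hγ') (Finset.ne_of_mem_erase hγ').symm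
  · rintro ⟨Λ, γ⟩ h
    simp only [Finset.mem_sigma, Finset.mem_filter] at h
    simp [Finset.erase_insert h.2.2.1]
  · rintro ⟨Λ, γ⟩ h
    simp only [Finset.mem_sigma] at h
    simp [Finset.insert_erase h.2]
  · rintro ⟨Λ, γ⟩ h
    simp only [Finset.mem_sigma, Finset.mem_filter] at h
    simp [Finset.erase_insert h.2.2.1]

end Matchings

/-! ### The expansion over matchings -/

section Expansion

set_option linter.unusedSectionVars false

variable {p q : ℕ} {𝕜 E : Type*} [NontriviallyNormedField 𝕜] [NormedAddCommGroup E]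
  [NormedSpace ℝ E] [NormedSpace 𝕜 E] [CompleteSpace E] [SMulCommClass ℝ 𝕜 E]
  [SMulCommClass 𝕜 ℝ E]

theorem StrongDeriv.smul {A A' : ℝ → E →L[𝕜] E} (hA : StrongDeriv A A') {f f' : ℝ → ℝ}
    (hf : ∀ z, HasDerivAt f (f' z) z) :
    StrongDeriv (fun z => f z • A z) fun z => f' z • A z + f z • A' z := fun φ z => by
  have := (hf z).smul (hA φ z)
  rw [add_comm] at this
  exact this

theorem real_smul_mul (A B : E →L[𝕜] E) (c : ℝ) : (c • A) * B = c • (A * B) := rfl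

theorem mul_real_smul (A B : E →L[𝕜] E) (c : ℝ) : A * (c • B) = c • (A * B) :=
  ContinuousLinearMap.ext fun φ => map_real_smul A A.continuous c (B φ)

variable (𝕜 E p q) in
/-- Generators `L γ` and solution operators `V γ`, indexed by pairs `γ = (j, l)`; the generators of
pairs without a common component commute. -/
structure PairSystem where
  /-- the generators -/
  L : Fin p × Fin q → ℝ → E →L[𝕜] E
  /-- the solution operators -/
  V : Fin p × Fin q → ℝ → E →L[𝕜] E
  /-- a bound of the generators -/
  κ : ℝ
  norm_L : ∀ γ z, ‖L γ z‖ ≤ κ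
  strongCont_L : ∀ γ, StrongCont (L γ)
  commute_L : ∀ γ γ' : Fin p × Fin q, γ.1 ≠ γ'.1 → γ.2 ≠ γ'.2 → ∀ z z', Commute (L γ z) (L γ' z')
  V_zero : ∀ γ, V γ 0 = 1
  deriv_V : ∀ γ, StrongDeriv (V γ) fun z => L γ z * V γ z

namespace PairSystem

variable (S : PairSystem p q 𝕜 E)

theorem commute_L_V {γ γ' : Fin p × Fin q} (h1 : γ.1 ≠ γ'.1) (h2 : γ.2 ≠ γ'.2) (z z' : ℝ) :
    Commute (S.L γ z) (S.V γ' z') :=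
  commute_solutionOperator (S.norm_L γ') (S.V_zero γ') (S.deriv_V γ')
    (fun s => S.commute_L γ γ' h1 h2 z s) z'

theorem commute_V {γ γ' : Fin p × Fin q} (h1 : γ.1 ≠ γ'.1) (h2 : γ.2 ≠ γ'.2) (z z' : ℝ) :
    Commute (S.V γ z) (S.V γ' z') :=
  commute_solutionOperator (S.norm_L γ') (S.V_zero γ') (S.deriv_V γ')
    (fun s => (S.commute_L_V h1.symm h2.symm s z).symm) z'

/-- `∏_{γ ∈ Λ} (V_γ - 1)`. -/
def prod (Λ : Finset (Fin p × Fin q)) (z : ℝ) : E →L[𝕜] E :=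
  orderedProd (fun γ => S.V γ z - 1) Λ

theorem prod_empty (z : ℝ) : S.prod ∅ z = 1 := orderedProd_empty _

theorem prod_insert {Λ : Finset (Fin p × Fin q)} {γ : Fin p × Fin q} (hγ : γ ∉ Λ)
    (h : IsMatching (insert γ Λ)) (z : ℝ) :
    S.prod (insert γ Λ) z = (S.V γ z - 1) * S.prod Λ z := by
  refine orderedProd_insert hγ fun a ha b hb hab => ?_
  have h1 := S.commute_V (h a ha b hb hab).1 (h a ha b hb hab).2 z z
  exact (h1.sub_left (Commute.one_left _)).sub_right (Commute.one_right _)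

theorem prod_erase {Λ : Finset (Fin p × Fin q)} {γ : Fin p × Fin q} (hγ : γ ∈ Λ)
    (h : IsMatching Λ) (z : ℝ) :
    (S.V γ z - 1) * S.prod (Λ.erase γ) z = S.prod Λ z := by
  rw [← S.prod_insert (Finset.notMem_erase _ _) (by rwa [Finset.insert_erase hγ]),
    Finset.insert_erase hγ]

/-- The strong derivative of `∏_{γ ∈ Λ} (V_γ - 1)`. -/
def prodDeriv (Λ : Finset (Fin p × Fin q)) (z : ℝ) : E →L[𝕜] E :=
  ∑ γ ∈ Λ, S.L γ z * S.V γ z * S.prod (Λ.erase γ) z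

/-- The product rule; the factors may be brought into any order since they commute. -/
theorem deriv_prod {Λ : Finset (Fin p × Fin q)} (h : IsMatching Λ) :
    StrongDeriv (S.prod Λ) (S.prodDeriv Λ) := by
  induction Λ using Finset.induction_on with
  | empty =>
    have h1 : S.prod ∅ = fun _ => 1 := funext S.prod_empty
    have h2 : S.prodDeriv ∅ = fun _ => 0 := funext fun z => by simp [prodDeriv]
    rw [h1, h2]
    exact strongDeriv_const 1
  | insert γ Λ hγ ih =>
    have hΛ : IsMatching Λ := h.mono (Finset.subset_insert _ _)
    have h1 : S.prod (insert γ Λ) = fun z => (S.V γ z - 1) * S.prod Λ z :=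
      funext (S.prod_insert hγ h)
    have h2 := ((S.deriv_V γ).sub (strongDeriv_const 1)).mul (ih hΛ)
    rw [h1]
    convert h2 using 1
    funext z
    rw [prodDeriv, Finset.sum_insert hγ, Finset.erase_insert hγ, sub_zero, prodDeriv,
      Finset.mul_sum]
    congr 1
    refine Finset.sum_congr rfl fun γ' hγ' => ?_
    have hne : γ ≠ γ' := fun h => hγ (h ▸ hγ')
    have hd := h γ (Finset.mem_insert_self _ _) γ' (Finset.mem_insert_of_mem hγ') hne
    rw [Finset.erase_insert_of_ne hne, S.prod_insert (fun h => hγ (Finset.mem_of_mem_erase h))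
      (h.mono (Finset.insert_subset_insert _ (Finset.erase_subset _ _))), ← mul_assoc, ← mul_assoc]
    congr 1
    have c1 : Commute (S.V γ z - 1) (S.L γ' z) :=
      ((S.commute_L_V hd.1.symm hd.2.symm z z).symm).sub_left (Commute.one_left _)
    have c2 : Commute (S.V γ z - 1) (S.V γ' z) :=
      (S.commute_V hd.1 hd.2 z z).sub_left (Commute.one_left _)
    exact (c1.mul_right c2).eq.symm

/-- The sum of `∏_{γ ∈ Λ} (V_γ - 1)` over all matchings `Λ`, the empty one included. -/
def total (z : ℝ) : E →L[𝕜] E := ∑ Λ ∈ matchings p q, S.prod Λ z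

/-- The strong derivative of the sum over all matchings. -/
def totalDeriv (z : ℝ) : E →L[𝕜] E := ∑ Λ ∈ matchings p q, S.prodDeriv Λ z

theorem deriv_total : StrongDeriv S.total S.totalDeriv :=
  StrongDeriv.sum fun _ hΛ => S.deriv_prod (mem_matchings.1 hΛ)

theorem prod_zero {Λ : Finset (Fin p × Fin q)} (h : IsMatching Λ) (hne : Λ.Nonempty) :
    S.prod Λ 0 = 0 := by
  obtain ⟨γ, hγ⟩ := hne
  rw [← S.prod_erase hγ h, S.V_zero, sub_self, zero_mul]

theorem total_zero : S.total 0 = 1 := by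
  rw [total, sum_matchings, prod_empty, Finset.sum_eq_zero, add_zero]
  intro Λ hΛ
  have : Λ ∈ matchings p q := by
    rw [matchings_eq_insert]; exact Finset.mem_insert_of_mem hΛ
  exact S.prod_zero (mem_matchings.1 this) (Finset.mem_filter.1 hΛ).2.1

/-- The combinatorial identity behind the expansion: applying all the generators to the sum over
matchings reproduces its derivative, up to the pairs that conflict with the matching. -/
theorem sum_L_mul_total (z : ℝ) :
    (∑ γ, S.L γ z) * S.total z = S.totalDeriv z +
      ∑ Λ ∈ matchings p q, ∑ γ' ∈ conflicting Λ, S.L γ' z * S.prod Λ z := by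
  have h1 : ∀ Λ ∈ matchings p q, S.prodDeriv Λ z =
      ∑ γ ∈ Λ, S.L γ z * S.prod Λ z + ∑ γ ∈ Λ, S.L γ z * S.prod (Λ.erase γ) z := by
    intro Λ hΛ
    rw [prodDeriv, ← Finset.sum_add_distrib]
    refine Finset.sum_congr rfl fun γ hγ => ?_
    rw [← S.prod_erase hγ (mem_matchings.1 hΛ)]
    noncomm_ring
  rw [totalDeriv, Finset.sum_congr rfl h1, Finset.sum_add_distrib,
    ← sum_matchings_insert (fun γ Λ => S.L γ z * S.prod Λ z), total, Finset.mul_sum,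
    ← Finset.sum_add_distrib, ← Finset.sum_add_distrib]
  refine Finset.sum_congr rfl fun Λ _ => ?_
  rw [Finset.sum_mul, sum_univ_eq_of_matching _ Λ]
  abel

/-! ### Norm bounds and the abstract error estimate -/

theorem norm_V_le (γ : Fin p × Fin q) {z : ℝ} (hz : 0 ≤ z) : ‖S.V γ z‖ ≤ Real.exp (S.κ * z) :=
  norm_solutionOperator_le (S.norm_L γ) (S.V_zero γ) (S.deriv_V γ) hz

theorem norm_prod_le {Λ : Finset (Fin p × Fin q)} (h : IsMatching Λ) (hκ : 0 ≤ S.κ) {z : ℝ}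
    (hz : 0 ≤ z) : ‖S.prod Λ z‖ ≤ (2 * Real.exp (S.κ * z)) ^ Λ.card := by
  induction Λ using Finset.induction_on with
  | empty =>
    rw [prod_empty]
    simpa using! ContinuousLinearMap.norm_id_le (𝕜 := 𝕜) (E := E)
  | insert γ Λ hγ ih =>
    have h1 : ‖S.V γ z - 1‖ ≤ 2 * Real.exp (S.κ * z) := by
      have h2 : ‖(1 : E →L[𝕜] E)‖ ≤ 1 := ContinuousLinearMap.norm_id_le
      have h3 : 1 ≤ Real.exp (S.κ * z) := Real.one_le_exp (by positivity)
      linarith [norm_sub_le (S.V γ z) 1, S.norm_V_le γ hz]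
    rw [S.prod_insert hγ h, Finset.card_insert_of_notMem hγ, pow_succ']
    exact (norm_mul_le _ _).trans (mul_le_mul h1 (ih (h.mono (Finset.subset_insert _ _)))
      (norm_nonneg _) (by positivity))

theorem norm_prodDeriv_le {Λ : Finset (Fin p × Fin q)} (h : IsMatching Λ) (hκ : 0 ≤ S.κ) {z : ℝ}
    (hz : 0 ≤ z) :
    ‖S.prodDeriv Λ z‖ ≤ Λ.card * S.κ * (2 * Real.exp (S.κ * z)) ^ Λ.card := by
  have h1 : ∀ γ ∈ Λ, ‖S.L γ z * S.V γ z * S.prod (Λ.erase γ) z‖ ≤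
      S.κ * (2 * Real.exp (S.κ * z)) ^ Λ.card := by
    intro γ hγ
    have hc : Λ.card = (Λ.erase γ).card + 1 := (Finset.card_erase_add_one hγ).symm
    calc _ ≤ ‖S.L γ z‖ * ‖S.V γ z‖ * ‖S.prod (Λ.erase γ) z‖ :=
          (norm_mul_le _ _).trans (mul_le_mul_of_nonneg_right (norm_mul_le _ _) (norm_nonneg _))
      _ ≤ S.κ * (2 * Real.exp (S.κ * z)) * (2 * Real.exp (S.κ * z)) ^ (Λ.erase γ).card := by
          have := S.norm_V_le γ hz
          have := Real.exp_pos (S.κ * z)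
          refine mul_le_mul (mul_le_mul (S.norm_L γ z) (by linarith) (norm_nonneg _) hκ)
            (S.norm_prod_le (h.mono (Finset.erase_subset _ _)) hκ hz) (norm_nonneg _)
            (by positivity)
      _ = _ := by rw [hc, pow_succ]; ring
  refine (norm_sum_le_of_le _ h1).trans_eq ?_
  rw [Finset.sum_const, nsmul_eq_mul]
  ring

/-- If the increments of an antiderivative `J` of `L_{γ'}` are small on the range of `L_γ`, then
`L_{γ'} (V_γ - 1)` has a small antiderivative, even though `L_{γ'}` itself is not small. -/
theorem exists_corrector {γ γ' : Fin p × Fin q} {J : ℝ → E →L[𝕜] E}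
    (hJ : StrongDeriv J (S.L γ')) {Z σ : ℝ} (hκ : 0 ≤ S.κ)
    (hσ : ∀ a ∈ Set.Icc 0 Z, ∀ b ∈ Set.Icc 0 Z, ‖(J b - J a) * S.L γ a‖ ≤ σ) :
    ∃ K : ℝ → E →L[𝕜] E, StrongDeriv K (fun z => S.L γ' z * (S.V γ z - 1)) ∧
      ∀ z ∈ Set.Icc 0 Z, ‖K z‖ ≤ z * σ * Real.exp (S.κ * z) := by
  have hLV : StrongCont fun z => S.L γ z * S.V γ z :=
    (S.strongCont_L γ).mul (S.deriv_V γ).strongCont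
  have hJc := hJ.strongCont
  obtain ⟨W, hW, hWi⟩ := (hJc.mul hLV).exists_integral
  -- integrate by parts: `∫ L_{γ'} (V_γ - 1) = J (V_γ - 1) - ∫ J L_γ V_γ`
  refine ⟨fun z => J z * (S.V γ z - 1) - W z, ?_, fun z hz => ?_⟩
  · have h := (hJ.mul ((S.deriv_V γ).sub (strongDeriv_const 1))).sub hW
    convert h using 1
    funext z
    rw [sub_zero]
    abel
  · have hσ0 : 0 ≤ σ := (norm_nonneg _).trans (hσ z hz z hz)
    have hz0 := hz.1
    refine ContinuousLinearMap.opNorm_le_bound _ (by positivity) fun φ => ?_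
    have h1 : ∫ s in (0 : ℝ)..z, S.L γ s (S.V γ s φ) = S.V γ z φ - φ := by
      have h0 := intervalIntegral.integral_eq_sub_of_hasDerivAt (a := 0) (b := z)
        (fun s _ => S.deriv_V γ φ s) ((hLV φ).intervalIntegrable _ _)
      rw [S.V_zero] at h0
      exact h0
    -- as `V_γ z - 1 = ∫ L_γ V_γ`, only increments of `J`, applied after `L_γ`, remain
    have h2 : (J z * (S.V γ z - 1) - W z) φ =
        ∫ s in (0 : ℝ)..z, ((J z - J s) * S.L γ s) (S.V γ s φ) := by
      have h3 : (J z * (S.V γ z - 1) - W z) φ = J z (S.V γ z φ - φ) - W z φ := rfl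
      have h4 : J z (∫ s in (0 : ℝ)..z, S.L γ s (S.V γ s φ)) =
          ∫ s in (0 : ℝ)..z, J z (S.L γ s (S.V γ s φ)) := by
        have h5 := ContinuousLinearMap.intervalIntegral_comp_comm
          (⟨(AddMonoidHom.toRealLinearMap (J z).toLinearMap.toAddMonoidHom
            (J z).continuous).toLinearMap, (J z).continuous⟩ : E →L[ℝ] E)
          (μ := volume) (a := 0) (b := z) ((hLV φ).intervalIntegrable _ _)
        exact h5.symm
      rw [h3, ← h1, h4, hWi, ← intervalIntegral.integral_sub]
      · rfl
      · exact ((strongCont_const (J z)).continuous_apply (hLV φ)).intervalIntegrable _ _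
      · exact (hJc.mul hLV φ).intervalIntegrable _ _
    rw [h2]
    have h6 := intervalIntegral.norm_integral_le_of_norm_le_const (a := 0) (b := z)
      (f := fun s => ((J z - J s) * S.L γ s) (S.V γ s φ))
      (C := σ * (Real.exp (S.κ * z) * ‖φ‖)) fun s hs => by
        rw [Set.uIoc_of_le hz0] at hs
        refine ContinuousLinearMap.le_of_opNorm_le_of_le _
          (hσ s ⟨hs.1.le, hs.2.trans hz.2⟩ z hz) ?_
        refine ContinuousLinearMap.le_of_opNorm_le _ ((S.norm_V_le γ hs.1.le).trans ?_) _
        exact Real.exp_le_exp.2 (mul_le_mul_of_nonneg_left hs.2 hκ)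
    refine h6.trans_eq ?_
    rw [sub_zero, abs_of_nonneg hz0]
    ring

/-- The approximate solution operator: the damped sum over matchings. -/
def approx (z : ℝ) : E →L[𝕜] E :=
  Real.exp (-(((p + q : ℕ) : ℝ) / 2 * S.κ * z)) • S.total z

/-- The strong derivative of the approximate solution operator. -/
def approxDeriv (z : ℝ) : E →L[𝕜] E :=
  (-(((p + q : ℕ) : ℝ) / 2 * S.κ) * Real.exp (-(((p + q : ℕ) : ℝ) / 2 * S.κ * z))) • S.total z +
    Real.exp (-(((p + q : ℕ) : ℝ) / 2 * S.κ * z)) • S.totalDeriv z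

/-- The defect of the approximate solution operator as a solution of the full equation. -/
def source (L2 : ℝ → E →L[𝕜] E) (z : ℝ) : E →L[𝕜] E :=
  Real.exp (-(((p + q : ℕ) : ℝ) / 2 * S.κ * z)) •
      ∑ Λ ∈ matchings p q, ∑ γ' ∈ conflicting Λ, S.L γ' z * S.prod Λ z +
    L2 z * S.approx z

/-- The full generator: the damping, the generators of all pairs and a further generator `L2`. -/
def fullGen (L2 : ℝ → E →L[𝕜] E) (z : ℝ) : E →L[𝕜] E :=
  -(((p + q : ℕ) : ℝ) / 2 * S.κ) • (1 : E →L[𝕜] E) + ∑ γ, S.L γ z + L2 z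

theorem hasDerivAt_damping (a z : ℝ) :
    HasDerivAt (fun z => Real.exp (-(a * z))) (-a * Real.exp (-(a * z))) z := by
  have := ((hasDerivAt_id z).const_mul a).neg.exp
  simpa [mul_comm] using this

theorem deriv_approx : StrongDeriv S.approx S.approxDeriv :=
  S.deriv_total.smul fun z => hasDerivAt_damping _ z

/-- The approximate solution operator solves the full equation up to `source`. -/
theorem fullGen_mul_approx (L2 : ℝ → E →L[𝕜] E) (z : ℝ) :
    S.fullGen L2 z * S.approx z = S.approxDeriv z + S.source L2 z := by
  have h := S.sum_L_mul_total z
  rw [fullGen, add_mul, add_mul, source, approxDeriv, ← add_assoc]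
  congr 1
  rw [approx, mul_real_smul, mul_real_smul, h, real_smul_mul, one_mul, smul_smul, smul_add,
    mul_comm (Real.exp _)]
  abel

/-- The error of the approximation solves the full equation with a source. -/
theorem deriv_error {L2 U : ℝ → E →L[𝕜] E} (hU : StrongDeriv U fun z => S.fullGen L2 z * U z) :
    StrongDeriv (fun z => U z - S.approx z)
      fun z => S.fullGen L2 z * (U z - S.approx z) + S.source L2 z := by
  have h := hU.sub S.deriv_approx
  convert h using 1
  funext z
  rw [mul_sub, S.fullGen_mul_approx]
  abel

/-- The constant in the abstract error estimate. -/
def errConst (p q : ℕ) : ℝ :=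
  (matchings p q).card * 2 ^ (p + q) * (1 + p * q) * (2 + 3 * (p + q) ^ 2)

/-- The damping compensates the growth of the products, because a matching has at most `(p + q) / 2`
pairs. -/
theorem damping_mul_pow_le (hκ : 0 ≤ S.κ) {Λ : Finset (Fin p × Fin q)} (h : IsMatching Λ) {z : ℝ}
    (hz : 0 ≤ z) {m : ℕ} (hm : m = Λ.card) :
    Real.exp (-(((p + q : ℕ) : ℝ) / 2 * S.κ * z)) * (2 * Real.exp (S.κ * z)) ^ m ≤
      2 ^ (p + q) := by
  have h1 := h.two_mul_card_le
  have h2 : (2 * (m : ℝ)) ≤ ((p + q : ℕ) : ℝ) := by subst hm; exact_mod_cast h1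
  rw [mul_pow, ← Real.exp_nat_mul, mul_left_comm, ← Real.exp_add]
  have h3 : Real.exp (-(((p + q : ℕ) : ℝ) / 2 * S.κ * z) + m * (S.κ * z)) ≤ 1 := by
    refine Real.exp_le_one_iff.2 ?_
    have : 0 ≤ S.κ * z := by positivity
    nlinarith
  have h4 : (2 : ℝ) ^ m ≤ 2 ^ (p + q) := pow_le_pow_right₀ one_le_two (by omega)
  calc (2 : ℝ) ^ m * _ ≤ 2 ^ (p + q) * 1 :=
        mul_le_mul h4 h3 (Real.exp_pos _).le (by positivity)
    _ = _ := mul_one _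

theorem norm_approx_le (hκ : 0 ≤ S.κ) {z : ℝ} (hz : 0 ≤ z) :
    ‖S.approx z‖ ≤ (matchings p q).card * 2 ^ (p + q) := by
  rw [approx, total, Finset.smul_sum]
  refine (norm_sum_le_of_le _ (n := fun _ => (2 : ℝ) ^ (p + q)) fun Λ hΛ => ?_).trans_eq (by simp)
  rw [norm_smul, Real.norm_of_nonneg (Real.exp_pos _).le]
  exact (mul_le_mul_of_nonneg_left (S.norm_prod_le (mem_matchings.1 hΛ) hκ hz)
    (Real.exp_pos _).le).trans (S.damping_mul_pow_le hκ (mem_matchings.1 hΛ) hz rfl)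

theorem norm_approxDeriv_le (hκ : 0 ≤ S.κ) {z : ℝ} (hz : 0 ≤ z) :
    ‖S.approxDeriv z‖ ≤
      2 * ((p + q : ℕ) : ℝ) * S.κ * ((matchings p q).card * 2 ^ (p + q)) := by
  have h1 : S.approxDeriv z = (-(((p + q : ℕ) : ℝ) / 2 * S.κ)) • S.approx z +
      Real.exp (-(((p + q : ℕ) : ℝ) / 2 * S.κ * z)) • S.totalDeriv z := by
    rw [approxDeriv, approx, smul_smul]
  have h2 : ‖(-(((p + q : ℕ) : ℝ) / 2 * S.κ)) • S.approx z‖ ≤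
      ((p + q : ℕ) : ℝ) / 2 * S.κ * ((matchings p q).card * 2 ^ (p + q)) := by
    rw [norm_smul, norm_neg, Real.norm_of_nonneg (by positivity)]
    exact mul_le_mul_of_nonneg_left (S.norm_approx_le hκ hz) (by positivity)
  have h3 : ‖Real.exp (-(((p + q : ℕ) : ℝ) / 2 * S.κ * z)) • S.totalDeriv z‖ ≤
      ((p + q : ℕ) : ℝ) * S.κ * ((matchings p q).card * 2 ^ (p + q)) := by
    rw [totalDeriv, Finset.smul_sum]
    refine (norm_sum_le_of_le _ (n := fun _ => ((p + q : ℕ) : ℝ) * S.κ * 2 ^ (p + q))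
      fun Λ hΛ => ?_).trans_eq (by simp; ring)
    rw [norm_smul, Real.norm_of_nonneg (Real.exp_pos _).le]
    have hm := mem_matchings.1 hΛ
    have h4 := S.norm_prodDeriv_le hm hκ hz
    have h5 := S.damping_mul_pow_le hκ hm hz rfl
    have h6 : (Λ.card : ℝ) ≤ ((p + q : ℕ) : ℝ) := by
      have := hm.two_mul_card_le
      exact_mod_cast (by omega : Λ.card ≤ p + q)
    calc _ ≤ Real.exp (-(((p + q : ℕ) : ℝ) / 2 * S.κ * z)) *
          (Λ.card * S.κ * (2 * Real.exp (S.κ * z)) ^ Λ.card) :=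
          mul_le_mul_of_nonneg_left h4 (Real.exp_pos _).le
      _ = Λ.card * S.κ * (Real.exp (-(((p + q : ℕ) : ℝ) / 2 * S.κ * z)) *
          (2 * Real.exp (S.κ * z)) ^ Λ.card) := by ring
      _ ≤ ((p + q : ℕ) : ℝ) * S.κ * 2 ^ (p + q) :=
          mul_le_mul (mul_le_mul_of_nonneg_right h6 hκ) h5 (by positivity) (by positivity)
  rw [h1]
  refine (norm_add_le _ _).trans ((add_le_add h2 h3).trans ?_)
  have : 0 ≤ ((p + q : ℕ) : ℝ) * S.κ * ((matchings p q).card * 2 ^ (p + q)) := by positivity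
  linarith

/-- For a matching `Λ` and a conflicting pair `γ'`, the damped `L_{γ'} ∏_{γ ∈ Λ} (V_γ - 1)` has a
small antiderivative `C`, up to a small remainder `R`. The smallness comes from the factor `V_γ - 1`
of a pair `γ ∈ Λ` that shares a component with `γ'`; the derivatives of the damping and of the other
factors make up the remainder. -/
theorem exists_pair_corrector (hκ : 0 ≤ S.κ) {J : Fin p × Fin q → ℝ → E →L[𝕜] E}
    (hJ : ∀ γ, StrongDeriv (J γ) (S.L γ)) {Z σ : ℝ} (hσ0 : 0 ≤ σ)
    (hσ : ∀ γ γ' : Fin p × Fin q, γ' ≠ γ → (γ'.1 = γ.1 ∨ γ'.2 = γ.2) →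
      ∀ a ∈ Set.Icc 0 Z, ∀ b ∈ Set.Icc 0 Z, ‖(J γ' b - J γ' a) * S.L γ a‖ ≤ σ)
    {Λ : Finset (Fin p × Fin q)} (h : IsMatching Λ) {γ' : Fin p × Fin q}
    (hγ' : γ' ∈ conflicting Λ) :
    ∃ C R : ℝ → E →L[𝕜] E,
      StrongDeriv C (fun z => Real.exp (-(((p + q : ℕ) : ℝ) / 2 * S.κ * z)) •
        (S.L γ' z * S.prod Λ z) + R z) ∧
      (∀ z ∈ Set.Icc 0 Z, ‖C z‖ ≤ z * σ * 2 ^ (p + q)) ∧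
      ∀ z ∈ Set.Icc 0 Z, ‖R z‖ ≤ 2 * ((p + q : ℕ) : ℝ) * S.κ * (z * σ * 2 ^ (p + q)) := by
  obtain ⟨hγΛ, γ, hγ, hs⟩ := (Finset.mem_filter.1 hγ').2
  have hne : γ' ≠ γ := fun h => hγΛ (h ▸ hγ)
  obtain ⟨K, hK, hKn⟩ := S.exists_corrector (hJ γ') hκ (hσ γ γ' hne hs)
  set n : ℝ := ((p + q : ℕ) : ℝ) with hn
  have hn0 : 0 ≤ n := by positivity
  set D : ℝ → ℝ := fun z => Real.exp (-(n / 2 * S.κ * z)) with hD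
  have hm' : IsMatching (Λ.erase γ) := h.mono (Finset.erase_subset _ _)
  have hcard : Λ.card = (Λ.erase γ).card + 1 := (Finset.card_erase_add_one hγ).symm
  have hP := S.deriv_prod hm'
  have hC := (hK.mul hP).smul fun z => hasDerivAt_damping (n / 2 * S.κ) z
  -- the bound common to all the terms: one factor `exp (κ z)` comes from `K`
  have hDK : ∀ z ∈ Set.Icc 0 Z, D z * (‖K z‖ * (2 * Real.exp (S.κ * z)) ^ (Λ.erase γ).card) ≤
      z * σ * 2 ^ (p + q) := by
    intro z hz
    have hz0 := hz.1
    have he := Real.exp_pos (S.κ * z)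
    have hDz : 0 < D z := Real.exp_pos _
    calc _ ≤ D z * (z * σ * (2 * Real.exp (S.κ * z)) *
          (2 * Real.exp (S.κ * z)) ^ (Λ.erase γ).card) := by
          have h1 : z * σ * Real.exp (S.κ * z) ≤ z * σ * (2 * Real.exp (S.κ * z)) :=
            mul_le_mul_of_nonneg_left (by linarith) (by positivity)
          exact mul_le_mul_of_nonneg_left (mul_le_mul_of_nonneg_right ((hKn z hz).trans h1)
            (by positivity)) hDz.le
      _ = z * σ * (D z * (2 * Real.exp (S.κ * z)) ^ Λ.card) := by rw [hcard, pow_succ]; ring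
      _ ≤ _ := mul_le_mul_of_nonneg_left (S.damping_mul_pow_le hκ h hz0 rfl) (by positivity)
  have hCn : ∀ z ∈ Set.Icc 0 Z, ‖D z • (K z * S.prod (Λ.erase γ) z)‖ ≤ z * σ * 2 ^ (p + q) := by
    intro z hz
    rw [norm_smul, Real.norm_of_nonneg (Real.exp_pos _).le]
    refine le_trans (mul_le_mul_of_nonneg_left ((norm_mul_le _ _).trans
      (mul_le_mul_of_nonneg_left (S.norm_prod_le hm' hκ hz.1) (norm_nonneg _)))
      (Real.exp_pos _).le) (hDK z hz)
  refine ⟨fun z => D z • (K z * S.prod (Λ.erase γ) z),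
    fun z => (-(n / 2 * S.κ) * D z) • (K z * S.prod (Λ.erase γ) z) +
      D z • (K z * S.prodDeriv (Λ.erase γ) z), ?_, hCn, fun z hz => ?_⟩
  · convert hC using 1
    funext z
    rw [mul_assoc (S.L γ' z), S.prod_erase hγ h, smul_add]
    simp only [hD]
    abel
  · have hz0 := hz.1
    have h1 : ‖(-(n / 2 * S.κ) * D z) • (K z * S.prod (Λ.erase γ) z)‖ ≤
        n / 2 * S.κ * (z * σ * 2 ^ (p + q)) := by
      rw [mul_smul, norm_smul, norm_neg, Real.norm_of_nonneg (by positivity)]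
      exact mul_le_mul_of_nonneg_left (hCn z hz) (by positivity)
    have h2 : ‖D z • (K z * S.prodDeriv (Λ.erase γ) z)‖ ≤ n * S.κ * (z * σ * 2 ^ (p + q)) := by
      have h3 : ((Λ.erase γ).card : ℝ) ≤ n := by
        have := h.two_mul_card_le
        rw [hn]
        exact_mod_cast (by omega : (Λ.erase γ).card ≤ p + q)
      have h4 := S.norm_prodDeriv_le hm' hκ hz0
      have hDz : 0 < D z := Real.exp_pos _
      rw [norm_smul, Real.norm_of_nonneg hDz.le]
      calc _ ≤ D z * (‖K z‖ * ((Λ.erase γ).card * S.κ *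
            (2 * Real.exp (S.κ * z)) ^ (Λ.erase γ).card)) :=
            mul_le_mul_of_nonneg_left ((norm_mul_le _ _).trans
              (mul_le_mul_of_nonneg_left h4 (norm_nonneg _))) hDz.le
        _ = (Λ.erase γ).card * S.κ *
            (D z * (‖K z‖ * (2 * Real.exp (S.κ * z)) ^ (Λ.erase γ).card)) := by ring
        _ ≤ _ := mul_le_mul (mul_le_mul_of_nonneg_right h3 hκ) (hDK z hz) (by positivity)
            (by positivity)
    refine (norm_add_le _ _).trans ((add_le_add h1 h2).trans ?_)
    have : 0 ≤ n * S.κ * (z * σ * 2 ^ (p + q)) := by positivity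
    linarith

/-- The abstract error estimate: the approximation is as good as the bounds `σ₁`, `σ₂` of the
oscillatory integrals of the generators. The source of the error equation is large, but it has a
small antiderivative `cor`, up to a small remainder; so Gronwall's inequality applies to the
difference of the error and `cor`. -/
theorem norm_sub_approx_le (hκ : 0 ≤ S.κ) {J : Fin p × Fin q → ℝ → E →L[𝕜] E}
    (hJ : ∀ γ, StrongDeriv (J γ) (S.L γ)) {L2 J2 U : ℝ → E →L[𝕜] E} (hJ2 : StrongDeriv J2 L2)
    (hG : ∀ z, ‖S.fullGen L2 z‖ ≤ ((p + q : ℕ) : ℝ) ^ 2 / 2 * S.κ)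
    (hU0 : U 0 = 1) (hU : StrongDeriv U fun z => S.fullGen L2 z * U z)
    {Z σ₁ σ₂ : ℝ} (hσ₁0 : 0 ≤ σ₁) (hσ₂0 : 0 ≤ σ₂)
    (hσ₁ : ∀ γ γ' : Fin p × Fin q, γ' ≠ γ → (γ'.1 = γ.1 ∨ γ'.2 = γ.2) →
      ∀ a ∈ Set.Icc 0 Z, ∀ b ∈ Set.Icc 0 Z, ‖(J γ' b - J γ' a) * S.L γ a‖ ≤ σ₁)
    (hσ₂ : ∀ z ∈ Set.Icc 0 Z, ‖J2 z‖ ≤ σ₂) {z : ℝ} (hz : z ∈ Set.Icc 0 Z) :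
    ‖U z - S.approx z‖ ≤ errConst p q * (1 + S.κ * Z) * (Z * σ₁ + σ₂) *
      Real.exp (((p + q : ℕ) : ℝ) ^ 2 / 2 * S.κ * Z) := by
  set n : ℝ := ((p + q : ℕ) : ℝ) with hn
  have hn0 : 0 ≤ n := by positivity
  have hZ0 : 0 ≤ Z := hz.1.trans hz.2
  have hex : ∀ Λ γ', ∃ C R : ℝ → E →L[𝕜] E, Λ ∈ matchings p q → γ' ∈ conflicting Λ →
      (StrongDeriv C (fun z => Real.exp (-(n / 2 * S.κ * z)) •
        (S.L γ' z * S.prod Λ z) + R z) ∧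
      (∀ z ∈ Set.Icc 0 Z, ‖C z‖ ≤ z * σ₁ * 2 ^ (p + q)) ∧
      ∀ z ∈ Set.Icc 0 Z, ‖R z‖ ≤ 2 * n * S.κ * (z * σ₁ * 2 ^ (p + q))) := by
    intro Λ γ'
    by_cases h : Λ ∈ matchings p q ∧ γ' ∈ conflicting Λ
    · obtain ⟨C, R, h1⟩ := S.exists_pair_corrector hκ hJ hσ₁0 hσ₁ (mem_matchings.1 h.1) h.2
      exact ⟨C, R, fun _ _ => h1⟩
    · exact ⟨0, 0, fun h1 h2 => absurd ⟨h1, h2⟩ h⟩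
  choose C R hCR using hex
  set A : ℝ := (matchings p q).card * 2 ^ (p + q) * (1 + p * q) with hA
  have hA0 : 0 ≤ A := by positivity
  set cor : ℝ → E →L[𝕜] E := fun z =>
    ∑ Λ ∈ matchings p q, ∑ γ' ∈ conflicting Λ, C Λ γ' z + J2 z * S.approx z with hcor
  set rem : ℝ → E →L[𝕜] E := fun z =>
    ∑ Λ ∈ matchings p q, ∑ γ' ∈ conflicting Λ, R Λ γ' z + J2 z * S.approxDeriv z with hrem
  have hcor' : StrongDeriv cor fun z => S.source L2 z + rem z := by
    have h1 : StrongDeriv _ _ := StrongDeriv.sum (s := matchings p q) (A := fun Λ z =>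
      ∑ γ' ∈ conflicting Λ, C Λ γ' z) fun Λ hΛ => StrongDeriv.sum fun γ' hγ' =>
        (hCR Λ γ' hΛ hγ').1
    have h2 := h1.add (hJ2.mul S.deriv_approx)
    convert h2 using 1
    funext z
    simp only [source, hrem, Finset.sum_add_distrib, Finset.smul_sum, hn]
    abel
  have hsum : ∀ (F : Finset (Fin p × Fin q) → Fin p × Fin q → E →L[𝕜] E) (b : ℝ), 0 ≤ b →
      (∀ Λ ∈ matchings p q, ∀ γ' ∈ conflicting Λ, ‖F Λ γ'‖ ≤ b) →
      ‖∑ Λ ∈ matchings p q, ∑ γ' ∈ conflicting Λ, F Λ γ'‖ ≤ (matchings p q).card * (p * q * b) := by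
    intro F b hb hF
    refine (norm_sum_le_of_le _ (n := fun _ => (p * q * b : ℝ)) fun Λ hΛ => ?_).trans_eq (by simp)
    refine (norm_sum_le_of_le _ (hF Λ hΛ)).trans ?_
    rw [Finset.sum_const, nsmul_eq_mul]
    refine mul_le_mul_of_nonneg_right ?_ hb
    have := Finset.card_le_univ (conflicting Λ)
    simp only [Fintype.card_prod, Fintype.card_fin] at this
    exact_mod_cast this
  have hcorn : ∀ s ∈ Set.Icc 0 Z, ‖cor s‖ ≤ A * (Z * σ₁ + σ₂) := by
    intro s hs
    have hs0 := hs.1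
    have h1 := hsum (fun Λ γ' => C Λ γ' s) (Z * σ₁ * 2 ^ (p + q)) (by positivity)
      fun Λ hΛ γ' hγ' => ((hCR Λ γ' hΛ hγ').2.1 s hs).trans (by
        have := hs.2
        gcongr)
    have h2 : ‖J2 s * S.approx s‖ ≤ σ₂ * ((matchings p q).card * 2 ^ (p + q)) :=
      (norm_mul_le _ _).trans (mul_le_mul (hσ₂ s hs) (S.norm_approx_le hκ hs.1) (norm_nonneg _)
        hσ₂0)
    refine (norm_add_le _ _).trans ((add_le_add h1 h2).trans ?_)
    have h3 : 0 ≤ ((matchings p q).card : ℝ) * 2 ^ (p + q) * (Z * σ₁ + p * q * σ₂) := by positivity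
    rw [hA]
    linarith
  have hremn : ∀ s ∈ Set.Icc 0 Z, ‖rem s‖ ≤ 2 * n * S.κ * (A * (Z * σ₁ + σ₂)) := by
    intro s hs
    have hs0 := hs.1
    have h1 := hsum (fun Λ γ' => R Λ γ' s) (2 * n * S.κ * (Z * σ₁ * 2 ^ (p + q))) (by positivity)
      fun Λ hΛ γ' hγ' => ((hCR Λ γ' hΛ hγ').2.2 s hs).trans (by
        have := hs.2
        gcongr)
    have h2 : ‖J2 s * S.approxDeriv s‖ ≤
        σ₂ * (2 * n * S.κ * ((matchings p q).card * 2 ^ (p + q))) :=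
      (norm_mul_le _ _).trans (mul_le_mul (hσ₂ s hs) (S.norm_approxDeriv_le hκ hs.1)
        (norm_nonneg _) hσ₂0)
    refine (norm_add_le _ _).trans ((add_le_add h1 h2).trans ?_)
    have h3 : 0 ≤ 2 * n * S.κ *
      (((matchings p q).card : ℝ) * 2 ^ (p + q) * (Z * σ₁ + p * q * σ₂)) := by positivity
    rw [hA]
    linarith
  set B : ℝ := A * (Z * σ₁ + σ₂) with hB
  have hB0 : 0 ≤ B := by positivity
  have hdiff : ‖U z - S.approx z - cor z‖ ≤
      (1 + 3 * n ^ 2 * S.κ * Z) * B * Real.exp (n ^ 2 / 2 * S.κ * Z) := by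
    refine ContinuousLinearMap.opNorm_le_bound _ (by positivity) fun ρ => ?_
    have hd : ∀ s, HasDerivAt (fun s => (U s - S.approx s - cor s) ρ)
        (S.fullGen L2 s ((U s - S.approx s - cor s) ρ) +
          (S.fullGen L2 s (cor s ρ) - rem s ρ)) s := by
      intro s
      have h1 := ((S.deriv_error hU).sub hcor') ρ s
      convert h1 using 1
      simp only [sub_apply, add_apply, map_sub,
        ContinuousLinearMap.mul_def, ContinuousLinearMap.comp_apply]
      abel
    have hb : ∀ s ∈ Set.Icc 0 Z, ‖S.fullGen L2 s (cor s ρ) - rem s ρ‖ ≤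
        3 * n ^ 2 * S.κ * B * ‖ρ‖ := by
      intro s hs
      have h1 : ‖S.fullGen L2 s (cor s ρ)‖ ≤ n ^ 2 / 2 * S.κ * (B * ‖ρ‖) :=
        ContinuousLinearMap.le_of_opNorm_le_of_le _ (hG s)
          (ContinuousLinearMap.le_of_opNorm_le _ (hcorn s hs) ρ)
      have h2 : ‖rem s ρ‖ ≤ 2 * n * S.κ * B * ‖ρ‖ :=
        ContinuousLinearMap.le_of_opNorm_le _ (hremn s hs) ρ
      refine (norm_sub_le _ _).trans ((add_le_add h1 h2).trans ?_)
      have h3 : n ≤ n ^ 2 := by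
        rw [hn]
        exact_mod_cast Nat.le_self_pow two_ne_zero (p + q)
      have h4 : 0 ≤ S.κ * B * ‖ρ‖ := by positivity
      nlinarith [sq_nonneg n, mul_nonneg (sub_nonneg.2 h3) h4, mul_nonneg (sq_nonneg n) h4]
    have h := norm_le_of_gronwall (K := n ^ 2 / 2 * S.κ) (ε := 3 * n ^ 2 * S.κ * B * ‖ρ‖)
      (Z := Z) (by positivity) (by positivity) (fun s _ => (hd s).hasDerivWithinAt)
      (fun s hs => (norm_add_le _ _).trans
        (add_le_add (ContinuousLinearMap.le_of_opNorm_le _ (hG s) _) (hb s hs))) z hz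
    have h0 : ‖(U 0 - S.approx 0 - cor 0) ρ‖ ≤ B * ‖ρ‖ := by
      have h1 : S.approx 0 = 1 := by simp [approx, S.total_zero]
      rw [hU0, h1, sub_self, zero_sub, neg_apply, norm_neg]
      exact ContinuousLinearMap.le_of_opNorm_le _ (hcorn 0 ⟨le_rfl, hZ0⟩) ρ
    refine h.trans ?_
    have hz1 := hz.1
    have hz2 := hz.2
    calc _ ≤ (B * ‖ρ‖ + 3 * n ^ 2 * S.κ * B * ‖ρ‖ * Z) * Real.exp (n ^ 2 / 2 * S.κ * Z) := by
          gcongr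
      _ = _ := by ring
  have h1 : ‖U z - S.approx z‖ ≤ ‖U z - S.approx z - cor z‖ + ‖cor z‖ := by
    simpa using norm_add_le (U z - S.approx z - cor z) (cor z)
  have h2 : 1 ≤ Real.exp (n ^ 2 / 2 * S.κ * Z) := Real.one_le_exp (by positivity)
  calc _ ≤ (1 + 3 * n ^ 2 * S.κ * Z) * B * Real.exp (n ^ 2 / 2 * S.κ * Z) +
        B * Real.exp (n ^ 2 / 2 * S.κ * Z) :=
        h1.trans (add_le_add hdiff ((hcorn z hz).trans (le_mul_of_one_le_right hB0 h2)))
    _ = (2 + 3 * n ^ 2 * (S.κ * Z)) * B * Real.exp (n ^ 2 / 2 * S.κ * Z) := by ring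
    _ ≤ ((2 + 3 * n ^ 2) * (1 + S.κ * Z)) * B * Real.exp (n ^ 2 / 2 * S.κ * Z) := by
        gcongr
        have : 0 ≤ S.κ * Z := by positivity
        nlinarith [sq_nonneg n]
    _ = _ := by
        rw [errConst, hB, hA, hn]
        push_cast
        ring

end PairSystem

end Expansion

/-! ### Operators on measures given by jumps with a phase -/

section PhaseKernels

open scoped BoundedContinuousFunction

variable {K X : Type*} [MeasurableSpace K] [MeasurableSpace X]

instance : SMulCommClass ℂ ℝ (ComplexMeasure X) := SMulCommClass.symm _ _ _

/-- Data of an operator `ρ ↦ ∫ weight(k) g(phase(k, w)) δ_{shift(k, w)} μ(dk) ρ(dw)` on measures,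
for a bounded continuous function `g` of the phase that is kept as a separate argument. -/
structure PhaseKernel (K X : Type*) [MeasurableSpace K] [MeasurableSpace X] (μ : Measure K) where
  /-- the density of the jump variable `k` -/
  weight : K → ℝ
  /-- the point to which the jump `k` leads from `w` -/
  shift : K × X → X
  /-- the phase acquired in the jump `k` from `w` -/
  phase : K × X → ℝ
  integrable_weight : Integrable weight μ
  measurable_weight : Measurable weight
  measurable_shift : Measurable shift
  measurable_phase : Measurable phase

namespace PhaseKernel

variable {μ : Measure K} (P : PhaseKernel K X μ)

/-- The operator on measures defined by a phase kernel and a function of the phase; the form is that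
of the definition of `transferOp`. -/
def toFun (g : ℝ → ℂ) (ρ : ComplexMeasure X) : ComplexMeasure X :=
  (((μ.withDensityᵥ P.weight).prod ρ (ContinuousLinearMap.lsmul ℝ ℝ)).withDensity
    (fun kw => g (P.phase kw)) (ContinuousLinearMap.mul ℝ ℂ)).map P.shift

/-- The dual operator on functions. -/
def adjoint (g : ℝ → ℂ) (f : X → ℂ) (w : X) : ℂ :=
  ∫ k, P.weight k * g (P.phase (k, w)) * f (P.shift (k, w)) ∂μ

theorem measurable_integrand {g : ℝ → ℂ} (hg : Measurable g) {f : X → ℂ} (hf : Measurable f) :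
    Measurable fun kw : K × X =>
      (P.weight kw.1 : ℂ) * g (P.phase kw) * f (P.shift kw) := by
  have h1 := P.measurable_weight
  have h2 := hg.comp P.measurable_phase
  have h3 := hf.comp P.measurable_shift
  exact ((Complex.measurable_ofReal.comp (h1.comp measurable_fst)).mul h2).mul h3

theorem measurable_adjoint [SFinite μ] {g : ℝ → ℂ} (hg : Measurable g) {f : X → ℂ}
    (hf : Measurable f) : Measurable (P.adjoint g f) :=
  ((P.measurable_integrand hg hf).stronglyMeasurable.integral_prod_left' (μ := μ)).measurable

theorem enorm_adjoint_le (g : ℝ → ℂ) (f : X → ℂ) (w : X) :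
    ‖P.adjoint g f w‖ₑ ≤
      ∫⁻ k, ‖P.weight k‖ₑ * ‖g (P.phase (k, w))‖ₑ * ‖f (P.shift (k, w))‖ₑ ∂μ := by
  refine (enorm_integral_le_lintegral_enorm _).trans_eq (lintegral_congr fun k => ?_)
  rw [enorm_mul, enorm_mul, ← ofReal_norm (P.weight k : ℂ), Complex.norm_real, ofReal_norm]

theorem enorm_adjoint_le_of_le_one (g : ℝ → ℂ) {f : X → ℂ} (hf : ∀ x, ‖f x‖ ≤ 1) (w : X) :
    ‖P.adjoint g f w‖ₑ ≤ ∫⁻ k, ‖P.weight k‖ₑ * ‖g (P.phase (k, w))‖ₑ ∂μ := by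
  refine (P.enorm_adjoint_le g f w).trans (lintegral_mono fun k => ?_)
  refine mul_le_of_le_one_right' ?_
  rw [← ofReal_norm]
  exact ENNReal.ofReal_le_one.2 (hf _)

theorem norm_integrand_le {g : ℝ → ℂ} {f : X → ℂ} {G C : ℝ} (hg : ∀ x, ‖g x‖ ≤ G)
    (hf : ∀ x, ‖f x‖ ≤ C) (kw : K × X) :
    ‖(P.weight kw.1 : ℂ) * g (P.phase kw) * f (P.shift kw)‖ ≤ G * C * ‖P.weight kw.1‖ := by
  rw [norm_mul, norm_mul, Complex.norm_real]
  have h0 : 0 ≤ G := (norm_nonneg _).trans (hg 0)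
  calc _ ≤ ‖P.weight kw.1‖ * G * C := by
        gcongr
        exacts [hg _, hf _]
    _ = _ := by ring

theorem norm_adjoint_le {g : ℝ → ℂ} {f : X → ℂ} {G C : ℝ} (hg : ∀ x, ‖g x‖ ≤ G)
    (hf : ∀ x, ‖f x‖ ≤ C) (w : X) :
    ‖P.adjoint g f w‖ ≤ G * C * ∫ k, ‖P.weight k‖ ∂μ := by
  rw [← integral_const_mul]
  exact norm_integral_le_of_norm_le (P.integrable_weight.norm.const_mul _)
    (Eventually.of_forall fun k => P.norm_integrand_le hg hf (k, w))

/-- Integrals against the image of a measure are integrals of the dual operator applied to the test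
function. By duality, norms and identities of operators on measures are read off from the dual ones.
-/
theorem pairing_toFun [SFinite μ] {g : ℝ → ℂ} (hg : Measurable g) {G : ℝ} (hG : ∀ x, ‖g x‖ ≤ G)
    (ρ : ComplexMeasure X) {f : X → ℂ} (hf : Measurable f) {C : ℝ} (hC : ∀ x, ‖f x‖ ≤ C) :
    pairing (P.toFun g ρ) f = pairing ρ (P.adjoint g f) := by
  obtain ⟨h, hm, hi, he⟩ := exists_eq_withDensityᵥ_variation ρ
  have hgm : Measurable fun kw : K × X => g (P.phase kw) := hg.comp P.measurable_phase
  have hi1 : Integrable (fun x : K × X => P.weight x.1 • h x.2) (μ.prod ρ.variation) :=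
    P.integrable_weight.smul_prod hi
  have hi2 : Integrable (fun x : K × X => g (P.phase x) * P.weight x.1 • h x.2)
      (μ.prod ρ.variation) :=
    hi1.bdd_mul hgm.aestronglyMeasurable (Eventually.of_forall fun _ => hG _)
  have hfm : Measurable fun x : K × X => f (P.shift x) := hf.comp P.measurable_shift
  have h1 : P.toFun g ρ = ((μ.prod ρ.variation).withDensityᵥ
      fun x : K × X => g (P.phase x) * P.weight x.1 • h x.2).map P.shift := by
    conv_lhs => rw [toFun, ← he]
    rw [prod_withDensityᵥ P.integrable_weight hi,
      withDensity_withDensityᵥ hi1 hgm (fun _ => hG _)]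
  have hi3 : Integrable (fun x : K × X => f (P.shift x) * (g (P.phase x) * P.weight x.1 • h x.2))
      (μ.prod ρ.variation) :=
    hi2.bdd_mul hfm.aestronglyMeasurable (Eventually.of_forall fun _ => hC _)
  rw [h1, pairing_map P.measurable_shift hf hC, pairing_withDensityᵥ hi2 hfm (fun _ => hC _)]
  conv_rhs => rw [← he]
  rw [pairing_withDensityᵥ hi (P.measurable_adjoint hg hf) (P.norm_adjoint_le hG hC),
    integral_prod_symm _ hi3]
  refine integral_congr_ae (Eventually.of_forall fun w => ?_)
  simp only [adjoint]
  rw [← integral_mul_const]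
  refine integral_congr_ae (Eventually.of_forall fun k => ?_)
  simp only [Complex.real_smul]
  ring

theorem adjoint_add {g : ℝ → ℂ} (hg : Measurable g) {G : ℝ} (hG : ∀ x, ‖g x‖ ≤ G) {g' : ℝ → ℂ}
    (hg' : Measurable g') {G' : ℝ} (hG' : ∀ x, ‖g' x‖ ≤ G') {f : X → ℂ} (hf : Measurable f) {C : ℝ}
    (hC : ∀ x, ‖f x‖ ≤ C) :
    P.adjoint (fun x => g x + g' x) f = P.adjoint g f + P.adjoint g' f := by
  funext w
  have hi : ∀ {g : ℝ → ℂ} (hg : Measurable g) {G : ℝ} (hG : ∀ x, ‖g x‖ ≤ G),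
      Integrable (fun k => (P.weight k : ℂ) * g (P.phase (k, w)) * f (P.shift (k, w))) μ := by
    intro g hg G hG
    refine (P.integrable_weight.norm.const_mul (G * C)).mono'
      ((P.measurable_integrand hg hf).comp measurable_prodMk_right).aestronglyMeasurable
      (Eventually.of_forall fun k => P.norm_integrand_le hG hC (k, w))
  rw [Pi.add_apply, adjoint, adjoint, adjoint, ← integral_add (hi hg hG) (hi hg' hG')]
  refine integral_congr_ae (Eventually.of_forall fun k => ?_)
  simp only
  ring

theorem adjoint_smul (c : ℂ) (g : ℝ → ℂ) (f : X → ℂ) :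
    P.adjoint (fun x => c * g x) f = fun w => c * P.adjoint g f w := by
  funext w
  rw [adjoint, adjoint, ← integral_const_mul]
  refine integral_congr_ae (Eventually.of_forall fun k => ?_)
  simp only
  ring

variable [SFinite μ]

theorem norm_toFun_le {g : ℝ → ℂ} (hg : Measurable g) {G : ℝ} (hG : ∀ x, ‖g x‖ ≤ G)
    (ρ : ComplexMeasure X) : ‖P.toFun g ρ‖ ≤ G * (∫ k, ‖P.weight k‖ ∂μ) * ‖ρ‖ := by
  refine norm_le_of_pairing_le fun f hf hf1 => ?_
  rw [P.pairing_toFun hg hG ρ hf hf1]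
  refine (norm_pairing_le _ _).trans ?_
  have h := P.norm_adjoint_le hG hf1
  have : ∫ x, ‖P.adjoint g f x‖ ∂ρ.variation ≤ ∫ x, G * 1 * ∫ k, ‖P.weight k‖ ∂μ ∂ρ.variation :=
    integral_mono_of_nonneg (Eventually.of_forall fun _ => norm_nonneg _) (integrable_const _)
      (Eventually.of_forall h)
  refine this.trans_eq ?_
  rw [integral_const, smul_eq_mul, norm_def]
  ring

/-- The bounded operators on measures defined by a phase kernel, as a linear function of the bounded
continuous function of the phase. -/
def op : (ℝ →ᵇ ℂ) →ₗ[ℂ] ComplexMeasure X →L[ℂ] ComplexMeasure X where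
  toFun g := LinearMap.mkContinuous
    { toFun := P.toFun g
      map_add' := fun ρ σ => ext_of_pairing fun f hf hf1 => by
        have hg := g.continuous.measurable
        have hG := g.norm_coe_le_norm
        rw [pairing_add _ _ hf hf1, P.pairing_toFun hg hG _ hf hf1, P.pairing_toFun hg hG _ hf hf1,
          P.pairing_toFun hg hG _ hf hf1,
          pairing_add _ _ (P.measurable_adjoint hg hf) (P.norm_adjoint_le hG hf1)]
      map_smul' := fun c ρ => ext_of_pairing fun f hf hf1 => by
        have hg := g.continuous.measurable
        have hG := g.norm_coe_le_norm
        rw [RingHom.id_apply, pairing_smul _ _ hf hf1, P.pairing_toFun hg hG _ hf hf1,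
          P.pairing_toFun hg hG _ hf hf1,
          pairing_smul _ _ (P.measurable_adjoint hg hf) (P.norm_adjoint_le hG hf1)] }
    (‖g‖ * ∫ k, ‖P.weight k‖ ∂μ)
    fun ρ => P.norm_toFun_le g.continuous.measurable g.norm_coe_le_norm ρ
  map_add' g g' := ContinuousLinearMap.ext fun ρ => ext_of_pairing fun f hf hf1 => by
    have hg := g.continuous.measurable
    have hG := g.norm_coe_le_norm
    have hg' := g'.continuous.measurable
    have hG' := g'.norm_coe_le_norm
    have h1 := P.pairing_toFun (g + g').continuous.measurable (g + g').norm_coe_le_norm ρ hf hf1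
    refine h1.trans ?_
    rw [add_apply, pairing_add _ _ hf hf1]
    refine Eq.trans ?_ (congrArg₂ (· + ·) (P.pairing_toFun hg hG ρ hf hf1)
      (P.pairing_toFun hg' hG' ρ hf hf1)).symm
    rw [BoundedContinuousFunction.coe_add]
    refine (congrArg _ (P.adjoint_add hg hG hg' hG' hf hf1)).trans ?_
    exact pairing_add_right _
      (integrable_of_bounded _ (P.measurable_adjoint hg hf) (P.norm_adjoint_le hG hf1))
      (integrable_of_bounded _ (P.measurable_adjoint hg' hf) (P.norm_adjoint_le hG' hf1))
  map_smul' c g := ContinuousLinearMap.ext fun ρ => ext_of_pairing fun f hf hf1 => by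
    have hg := g.continuous.measurable
    have hG := g.norm_coe_le_norm
    have h1 := P.pairing_toFun (c • g).continuous.measurable (c • g).norm_coe_le_norm ρ hf hf1
    refine h1.trans ?_
    rw [RingHom.id_apply, smul_apply, pairing_smul _ _ hf hf1]
    refine Eq.trans ?_ (congrArg (c * ·) (P.pairing_toFun hg hG ρ hf hf1)).symm
    refine (congrArg _ (P.adjoint_smul c g f)).trans ?_
    exact pairing_const_mul _ _ (P.measurable_adjoint hg hf) (P.norm_adjoint_le hG hf1)

theorem op_apply (g : ℝ →ᵇ ℂ) (ρ : ComplexMeasure X) : P.op g ρ = P.toFun g ρ := rfl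

theorem pairing_op (g : ℝ →ᵇ ℂ) (ρ : ComplexMeasure X) {f : X → ℂ} (hf : Measurable f) {C : ℝ}
    (hC : ∀ x, ‖f x‖ ≤ C) : pairing (P.op g ρ) f = pairing ρ (P.adjoint g f) :=
  P.pairing_toFun g.continuous.measurable g.norm_coe_le_norm ρ hf hC

theorem norm_op_le (g : ℝ →ᵇ ℂ) : ‖P.op g‖ ≤ ‖g‖ * ∫ k, ‖P.weight k‖ ∂μ :=
  ContinuousLinearMap.opNorm_le_bound _
    (mul_nonneg (norm_nonneg _) (integral_nonneg fun _ => norm_nonneg _))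
    fun ρ => P.norm_toFun_le g.continuous.measurable g.norm_coe_le_norm ρ

/-- The operator norm is controlled by the integrals of the modulus of the kernel. -/
theorem norm_op_le_of_lintegral_le (g : ℝ →ᵇ ℂ) {B : ℝ} (hB : 0 ≤ B)
    (h : ∀ w, ∫⁻ k, ‖P.weight k‖ₑ * ‖g (P.phase (k, w))‖ₑ ∂μ ≤ ENNReal.ofReal B) :
    ‖P.op g‖ ≤ B := by
  refine ContinuousLinearMap.opNorm_le_bound _ hB fun ρ => norm_le_of_pairing_le fun f hf hf1 => ?_
  rw [P.pairing_op g ρ hf hf1]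
  exact norm_pairing_le_of_enorm_le ρ hB fun w =>
    (P.enorm_adjoint_le_of_le_one g hf1 w).trans (h w)

/-- The norm of a product is controlled by the integrals over two successive jumps, `k` first and
`k'` second. -/
theorem norm_op_mul_op_le (P' : PhaseKernel K X μ) (g g' : ℝ →ᵇ ℂ) (hg : ∀ x, ‖g x‖ ≤ 1)
    {B : ℝ} (hB : 0 ≤ B)
    (h : ∀ w, ∫⁻ k, ‖P.weight k‖ₑ * ∫⁻ k', ‖P'.weight k'‖ₑ *
      ‖g' (P'.phase (k', P.shift (k, w)))‖ₑ ∂μ ∂μ ≤ ENNReal.ofReal B) :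
    ‖P'.op g' * P.op g‖ ≤ B := by
  refine ContinuousLinearMap.opNorm_le_bound _ hB fun ρ => norm_le_of_pairing_le fun f hf hf1 => ?_
  have hg' := g'.continuous.measurable
  have hG' := g'.norm_coe_le_norm
  change ‖pairing (P'.op g' (P.op g ρ)) f‖ ≤ _
  rw [P'.pairing_op g' _ hf hf1, P.pairing_op g ρ (P'.measurable_adjoint hg' hf)
    (P'.norm_adjoint_le hG' hf1)]
  refine norm_pairing_le_of_enorm_le ρ hB fun w => (P.enorm_adjoint_le _ _ w).trans
    (le_trans (lintegral_mono fun k => ?_) (h w))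
  refine mul_le_mul' (mul_le_of_le_one_right' ?_) (P'.enorm_adjoint_le_of_le_one g' hf1 _)
  rw [← ofReal_norm]
  exact ENNReal.ofReal_le_one.2 (hg _)

/-- Dominated convergence for the operators of a phase kernel. -/
theorem tendsto_op_zero {ι : Type*} {l : Filter ι} [l.IsCountablyGenerated] {g : ι → ℝ →ᵇ ℂ}
    {M : ℝ} (hM : ∀ᶠ i in l, ∀ x, ‖g i x‖ ≤ M) (h0 : ∀ x, Tendsto (fun i => g i x) l (𝓝 0))
    (ρ : ComplexMeasure X) : Tendsto (fun i => P.op (g i) ρ) l (𝓝 0) := by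
  -- `D g w` is the absolute integral over all jumps from `w`
  set D : (ℝ →ᵇ ℂ) → X → ℝ := fun g w => ∫ k, ‖P.weight k‖ * ‖g (P.phase (k, w))‖ ∂μ with hD
  have hmeas : ∀ g : ℝ →ᵇ ℂ, Measurable fun kw : K × X => ‖P.weight kw.1‖ * ‖g (P.phase kw)‖ :=
    fun g => ((P.measurable_weight.comp measurable_fst).norm).mul
      (g.continuous.measurable.comp P.measurable_phase).norm
  have hDm : ∀ g, Measurable (D g) := fun g =>
    ((hmeas g).stronglyMeasurable.integral_prod_left' (μ := μ)).measurable
  have hle : ∀ g : ℝ →ᵇ ℂ, ‖P.op g ρ‖ ≤ ∫ w, D g w ∂ρ.variation := by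
    intro g
    have hDi : Integrable (D g) ρ.variation := by
      refine Integrable.of_bound (hDm g).aestronglyMeasurable ((∫ k, ‖P.weight k‖ ∂μ) * ‖g‖)
        (Eventually.of_forall fun w => ?_)
      rw [← integral_mul_const]
      refine norm_integral_le_of_norm_le (P.integrable_weight.norm.mul_const _)
        (Eventually.of_forall fun k => ?_)
      rw [norm_mul, norm_norm, norm_norm]
      gcongr
      exact g.norm_coe_le_norm _
    refine norm_le_of_pairing_le fun f hf hf1 => ?_
    rw [P.pairing_op g ρ hf hf1]
    refine (norm_pairing_le _ _).trans (integral_mono_of_nonneg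
      (Eventually.of_forall fun _ => norm_nonneg _) hDi (Eventually.of_forall fun w => ?_))
    refine norm_integral_le_of_norm_le ((P.integrable_weight.norm.mul_const ‖g‖).mono'
      ((hmeas g).comp measurable_prodMk_right).aestronglyMeasurable
      (Eventually.of_forall fun k => ?_)) (Eventually.of_forall fun k => ?_)
    · simp only [norm_mul, norm_norm]
      gcongr
      exact g.norm_coe_le_norm _
    · rw [norm_mul, norm_mul, Complex.norm_real]
      exact mul_le_of_le_one_right (by positivity) (hf1 _)
  refine squeeze_zero_norm (fun i => hle (g i)) ?_
  have hpt : ∀ w, Tendsto (fun i => D (g i) w) l (𝓝 0) := by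
    intro w
    have := tendsto_integral_filter_of_dominated_convergence (μ := μ) (l := l)
      (F := fun i k => ‖P.weight k‖ * ‖g i (P.phase (k, w))‖) (f := fun _ => 0)
      (fun k => ‖P.weight k‖ * M)
      (Eventually.of_forall fun i => ((hmeas (g i)).comp
        measurable_prodMk_right).aestronglyMeasurable)
      (hM.mono fun i hi => Eventually.of_forall fun k => by
        rw [norm_mul, norm_norm, norm_norm]
        exact mul_le_mul_of_nonneg_left (hi _) (norm_nonneg _))
      (P.integrable_weight.norm.mul_const _)
      (Eventually.of_forall fun k => by
        have := ((h0 (P.phase (k, w))).norm).const_mul ‖P.weight k‖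
        simpa using this)
    rwa [integral_zero] at this
  have := tendsto_integral_filter_of_dominated_convergence (μ := ρ.variation) (l := l)
    (F := fun i w => D (g i) w) (f := fun _ => 0) (fun _ => (∫ k, ‖P.weight k‖ ∂μ) * M)
    (Eventually.of_forall fun i => (hDm (g i)).aestronglyMeasurable)
    (hM.mono fun i hi => Eventually.of_forall fun w => by
      rw [← integral_mul_const]
      refine norm_integral_le_of_norm_le (P.integrable_weight.norm.mul_const _)
        (Eventually.of_forall fun k => ?_)
      rw [norm_mul, norm_norm, norm_norm]
      exact mul_le_mul_of_nonneg_left (hi _) (norm_nonneg _))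
    (integrable_const _) (Eventually.of_forall hpt)
  simpa using this

/-- Operators commute if neither of the jumps affects the phase of the other. -/
theorem commute_op (P' : PhaseKernel K X μ)
    (hs : ∀ k k' w, P.shift (k, P'.shift (k', w)) = P'.shift (k', P.shift (k, w)))
    (hp : ∀ k k' w, P.phase (k, P'.shift (k', w)) = P.phase (k, w))
    (hp' : ∀ k k' w, P'.phase (k', P.shift (k, w)) = P'.phase (k', w)) (g g' : ℝ →ᵇ ℂ) :
    Commute (P.op g) (P'.op g') := by
  refine ContinuousLinearMap.ext fun ρ => ext_of_pairing fun f hf hf1 => ?_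
  have hg := g.continuous.measurable
  have hG := g.norm_coe_le_norm
  have hg' := g'.continuous.measurable
  have hG' := g'.norm_coe_le_norm
  change pairing (P.op g (P'.op g' ρ)) f = pairing (P'.op g' (P.op g ρ)) f
  rw [P'.pairing_op g' _ hf hf1, P.pairing_op g _ hf hf1,
    P.pairing_op g ρ (P'.measurable_adjoint hg' hf) (P'.norm_adjoint_le hG' hf1),
    P'.pairing_op g' ρ (P.measurable_adjoint hg hf) (P.norm_adjoint_le hG hf1)]
  congr 1
  funext w
  simp only [adjoint, ← integral_const_mul, hp, hp', hs]
  rw [integral_integral_swap]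
  · refine integral_congr_ae (Eventually.of_forall fun k => integral_congr_ae
      (Eventually.of_forall fun k' => ?_))
    simp only
    ring
  · have h1 : Measurable fun kw : K × K => (P'.shift (kw.1, P.shift (kw.2, w))) :=
      P'.measurable_shift.comp (measurable_fst.prodMk
        (P.measurable_shift.comp (measurable_snd.prodMk measurable_const)))
    have h2 : Measurable fun k : K => g (P.phase (k, w)) :=
      (hg.comp P.measurable_phase).comp measurable_prodMk_right
    have h3 : Measurable fun k : K => g' (P'.phase (k, w)) :=
      (hg'.comp P'.measurable_phase).comp measurable_prodMk_right
    have h4 := P.measurable_weight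
    have h5 := P'.measurable_weight
    refine ((P'.integrable_weight.norm.mul_prod P.integrable_weight.norm).const_mul
      (‖g'‖ * ‖g‖)).mono' ?_ (Eventually.of_forall fun kk => ?_)
    · refine Measurable.aestronglyMeasurable ?_
      have h6 := hf.comp h1
      have h7 : Measurable fun kk : K × K => g (P.phase (kk.2, w)) := h2.comp measurable_snd
      have h8 : Measurable fun kk : K × K => g' (P'.phase (kk.1, w)) := h3.comp measurable_fst
      have h9 : Measurable fun kk : K × K => (P'.weight kk.1 : ℂ) :=
        Complex.measurable_ofReal.comp (h5.comp measurable_fst)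
      have h10 : Measurable fun kk : K × K => (P.weight kk.2 : ℂ) :=
        Complex.measurable_ofReal.comp (h4.comp measurable_snd)
      exact (h9.mul h8).mul ((h10.mul h7).mul h6)
    · simp only [Function.uncurry, norm_mul, Complex.norm_real]
      have := hG (P.phase (kk.2, w))
      have := hG' (P'.phase (kk.1, w))
      have := hf1 (P'.shift (kk.1, P.shift (kk.2, w)))
      calc _ ≤ ‖P'.weight kk.1‖ * ‖g'‖ * (‖P.weight kk.2‖ * ‖g‖ * 1) := by gcongr
        _ = _ := by ring

end PhaseKernel

/-- The function `x ↦ exp(i z x)` of the phase. -/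
def phaseExp (z : ℝ) : ℝ →ᵇ ℂ :=
  BoundedContinuousFunction.ofNormedAddCommGroup
    (fun x => Complex.exp (Complex.I * ((z * x : ℝ) : ℂ)))
    (by fun_prop) 1 fun x => by rw [mul_comm, Complex.norm_exp_ofReal_mul_I]

theorem phaseExp_apply (z x : ℝ) :
    phaseExp z x = Complex.exp (Complex.I * ((z * x : ℝ) : ℂ)) := rfl

theorem norm_phaseExp_apply (z x : ℝ) : ‖phaseExp z x‖ = 1 := by
  rw [phaseExp_apply, mul_comm, Complex.norm_exp_ofReal_mul_I]

theorem continuous_phaseExp_left (x : ℝ) : Continuous fun z => phaseExp z x := by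
  simp only [phaseExp_apply]
  fun_prop

/-- The antiderivative `x ↦ ∫_0^z exp(i s x) ds` of `exp(i z x)` with respect to `z`. -/
def phaseInt (z : ℝ) : ℝ →ᵇ ℂ :=
  BoundedContinuousFunction.ofNormedAddCommGroup (fun x => ∫ s in (0 : ℝ)..z, phaseExp s x)
    (by
      refine intervalIntegral.continuous_parametric_intervalIntegral_of_continuous' ?_ _ _
      simp only [Function.uncurry_def, phaseExp_apply]
      fun_prop) |z| fun x => by
        simpa using intervalIntegral.norm_integral_le_of_norm_le_const (a := 0) (b := z) (C := 1)
          fun s _ => (norm_phaseExp_apply s x).le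

theorem phaseInt_apply (z x : ℝ) : phaseInt z x = ∫ s in (0 : ℝ)..z, phaseExp s x := rfl

theorem phaseInt_sub_apply (a b x : ℝ) :
    (phaseInt b - phaseInt a) x = ∫ s in a..b, phaseExp s x := by
  rw [BoundedContinuousFunction.sub_apply, phaseInt_apply, phaseInt_apply]
  exact intervalIntegral.integral_interval_sub_left
    ((continuous_phaseExp_left x).intervalIntegrable _ _)
    ((continuous_phaseExp_left x).intervalIntegrable _ _)

theorem norm_phaseInt_sub_le (a b x : ℝ) : ‖(phaseInt b - phaseInt a) x‖ ≤ |b - a| := by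
  rw [phaseInt_sub_apply]
  simpa using intervalIntegral.norm_integral_le_of_norm_le_const (a := a) (b := b) (C := 1)
    fun s _ => (norm_phaseExp_apply s x).le

theorem norm_phaseInt_sub_le_div (a b : ℝ) {x : ℝ} (hx : x ≠ 0) :
    ‖(phaseInt b - phaseInt a) x‖ ≤ 2 / |x| := by
  have hc : Complex.I * (x : ℂ) ≠ 0 := mul_ne_zero Complex.I_ne_zero (by exact_mod_cast hx)
  have h := integral_exp_mul_complex (a := a) (b := b) hc
  rw [phaseInt_sub_apply]
  have h1 : ∀ s : ℝ, phaseExp s x = Complex.exp (Complex.I * x * s) := fun s => by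
    rw [phaseExp_apply]
    push_cast
    ring_nf
  simp only [h1]
  rw [h, norm_div, norm_mul, Complex.norm_I, one_mul, Complex.norm_real, Real.norm_eq_abs]
  gcongr
  refine (norm_sub_le _ _).trans_eq ?_
  have h2 : ∀ s : ℝ, ‖Complex.exp (Complex.I * x * s)‖ = 1 := fun s => by
    rw [← h1, norm_phaseExp_apply]
  rw [h2, h2]
  norm_num

/-- The oscillatory integral over an interval of length at most `T` decays like the inverse of the
frequency, which is here `x / δ`. -/
theorem norm_phaseInt_sub_le_div_max {a b x T δ : ℝ} (hT : 0 < T) (hδ : 0 < δ) (hab : |b - a| ≤ T) :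
    ‖(phaseInt b - phaseInt a) (x / δ)‖ ≤ 2 * δ / max (δ / T) |x| := by
  rcases le_total (δ / T) |x| with h | h
  · rw [max_eq_right h]
    have hx : x ≠ 0 := by
      rintro rfl
      rw [abs_zero] at h
      exact absurd h (not_le.2 (by positivity))
    refine (norm_phaseInt_sub_le_div a b (div_ne_zero hx hδ.ne')).trans_eq ?_
    rw [abs_div, abs_of_pos hδ, div_div_eq_mul_div]
  · rw [max_eq_left h]
    refine (norm_phaseInt_sub_le a b _).trans (hab.trans ?_)
    rw [le_div_iff₀ (by positivity)]
    field_simp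
    linarith

theorem phaseInt_zero : phaseInt 0 = 0 := by
  ext x
  rw [phaseInt_apply, intervalIntegral.integral_same]
  rfl

theorem hasDerivAt_phaseInt (x z : ℝ) : HasDerivAt (fun s => phaseInt s x) (phaseExp z x) z :=
  intervalIntegral.integral_hasDerivAt_right
    ((continuous_phaseExp_left x).intervalIntegrable _ _)
    ((continuous_phaseExp_left x).stronglyMeasurableAtFilter _ _)
    (continuous_phaseExp_left x).continuousAt

namespace PhaseKernel

variable {μ : Measure K} [SFinite μ] (P : PhaseKernel K X μ)

theorem strongCont_op : StrongCont fun z => P.op (phaseExp z) := by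
  refine fun ρ => continuous_iff_continuousAt.2 fun z => ?_
  refine tendsto_sub_nhds_zero_iff.1 ?_
  have h := P.tendsto_op_zero (l := 𝓝 z) (g := fun s => phaseExp s - phaseExp z) (M := 2)
    (Eventually.of_forall fun s x => ?_) (fun x => ?_) ρ
  · refine h.congr fun s => ?_
    rw [map_sub, sub_apply]
  · refine (norm_sub_le _ _).trans_eq ?_
    rw [norm_phaseExp_apply, norm_phaseExp_apply]
    norm_num
  · exact tendsto_sub_nhds_zero_iff.2 ((continuous_phaseExp_left x).tendsto z)

theorem strongDeriv_op : StrongDeriv (fun z => P.op (phaseInt z)) fun z => P.op (phaseExp z) := by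
  intro ρ z
  rw [hasDerivAt_iff_tendsto_slope]
  refine tendsto_sub_nhds_zero_iff.1 ?_
  have h := P.tendsto_op_zero (l := 𝓝[≠] z)
    (g := fun s => (((s - z)⁻¹ : ℝ) : ℂ) • (phaseInt s - phaseInt z) - phaseExp z) (M := 2)
    (eventually_mem_nhdsWithin.mono fun s hs x => ?_) (fun x => ?_) ρ
  · refine h.congr fun s => ?_
    rw [map_sub, map_smul, map_sub, sub_apply, smul_apply, sub_apply, slope, vsub_eq_sub,
      real_smul_eq]
  · have hs' : 0 < |s - z| := abs_pos.2 (sub_ne_zero.2 hs)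
    refine (norm_sub_le _ _).trans ?_
    have h1 : ‖((((s - z)⁻¹ : ℝ) : ℂ) • (phaseInt s - phaseInt z)) x‖ ≤ 1 := by
      rw [BoundedContinuousFunction.smul_apply, norm_smul, Complex.norm_real, norm_inv,
        Real.norm_eq_abs]
      refine (mul_le_mul_of_nonneg_left (norm_phaseInt_sub_le z s x) (by positivity)).trans_eq ?_
      exact inv_mul_cancel₀ hs'.ne'
    rw [norm_phaseExp_apply]
    linarith
  · refine tendsto_sub_nhds_zero_iff.2 ((hasDerivAt_iff_tendsto_slope.1
      (hasDerivAt_phaseInt x z)).congr fun s => ?_)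
    rw [slope, vsub_eq_sub]
    rfl

end PhaseKernel

end PhaseKernels

/-! ### Polar coordinates and spherical means -/

section SphericalMeans

open Metric

variable {E : Type*} [NormedAddCommGroup E] [InnerProductSpace ℝ E] [FiniteDimensional ℝ E]
  [MeasurableSpace E] [BorelSpace E]

variable (E) in
/-- The surface measure of the unit sphere. -/
def sphereMeasure : Measure (sphere (0 : E) 1) := (volume : Measure E).toSphere

instance : IsFiniteMeasure (sphereMeasure E) := by
  unfold sphereMeasure; infer_instance

theorem measurePreserving_polar [Nontrivial E] :
    MeasurePreserving (fun p : sphere (0 : E) 1 × Set.Ioi (0 : ℝ) => (p.2 : ℝ) • (p.1 : E))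
      ((sphereMeasure E).prod (Measure.volumeIoiPow (Module.finrank ℝ E - 1))) volume := by
  have h1 := ((volume : Measure E).measurePreserving_homeomorphUnitSphereProd)
  have h2 := h1.symm (homeomorphUnitSphereProd E).toMeasurableEquiv
  have h3 := measurePreserving_subtype_coe (μa := (volume : Measure E))
    (measurableSet_singleton (0 : E)).compl
  rw [restrict_compl_singleton] at h3
  exact h3.comp h2

/-- Integration in polar coordinates. -/
theorem lintegral_polar [Nontrivial E] {F : E → ℝ≥0∞} (hF : Measurable F) :
    ∫⁻ x, F x = ∫⁻ ω : sphere (0 : E) 1, (∫⁻ ρ in Set.Ioi (0 : ℝ),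
      ENNReal.ofReal (ρ ^ (Module.finrank ℝ E - 1)) * F (ρ • (ω : E))) ∂(sphereMeasure E) := by
  have h := measurePreserving_polar (E := E)
  rw [← h.lintegral_comp hF]
  refine (lintegral_prod _ (hF.comp h.measurable).aemeasurable).trans
    (lintegral_congr fun ω => ?_)
  have hm : Measurable fun ρ : ℝ => F (ρ • (ω : E)) := hF.comp (by fun_prop)
  refine (lintegral_withDensity_eq_lintegral_mul _ (by fun_prop)
    (hm.comp measurable_subtype_coe)).trans ?_
  exact lintegral_subtype_comap measurableSet_Ioi
    (fun ρ : ℝ => ENNReal.ofReal (ρ ^ (Module.finrank ℝ E - 1)) * F (ρ • (ω : E)))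

/-- Integrals against a radial weight are monotone in the spherical means. -/
theorem lintegral_radial_mul_le [Nontrivial E] {S F G : E → ℝ≥0∞} (hS : AEMeasurable S)
    (hrad : ∀ x y, ‖x‖ = ‖y‖ → S x = S y) (hF : Measurable F) (hG : Measurable G)
    (h : ∀ ρ : ℝ, 0 < ρ → ∫⁻ ω : sphere (0 : E) 1, F (ρ • (ω : E)) ∂(sphereMeasure E) ≤
      ∫⁻ ω : sphere (0 : E) 1, G (ρ • (ω : E)) ∂(sphereMeasure E)) :
    ∫⁻ x, S x * F x ≤ ∫⁻ x, S x * G x := by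
  have hp := measurePreserving_polar (E := E)
  have key : ∀ {F : E → ℝ≥0∞}, Measurable F → ∫⁻ x, S x * F x =
      ∫⁻ ρ : Set.Ioi (0 : ℝ), ∫⁻ ω : sphere (0 : E) 1, S ((ρ : ℝ) • (ω : E)) * F ((ρ : ℝ) • (ω : E))
        ∂(sphereMeasure E) ∂(Measure.volumeIoiPow (Module.finrank ℝ E - 1)) := by
    intro F hF
    have hSF : AEMeasurable (fun x => S x * F x) := hS.mul hF.aemeasurable
    conv_lhs => rw [← hp.map_eq]
    rw [lintegral_map' (by rwa [hp.map_eq]) hp.aemeasurable]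
    exact lintegral_prod_symm _
      (hSF.comp_quasiMeasurePreserving hp.quasiMeasurePreserving)
  rw [key hF, key hG]
  refine lintegral_mono fun ρ => ?_
  rcases isEmpty_or_nonempty (sphere (0 : E) 1) with h0 | ⟨⟨ω₀⟩⟩
  · simp
  have hc : ∀ ω : sphere (0 : E) 1, S ((ρ : ℝ) • (ω : E)) = S ((ρ : ℝ) • (ω₀ : E)) := fun ω =>
    hrad _ _ (by rw [norm_smul, norm_smul, norm_eq_of_mem_sphere, norm_eq_of_mem_sphere])
  have hm : ∀ {F : E → ℝ≥0∞}, Measurable F →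
      Measurable fun ω : sphere (0 : E) 1 => F ((ρ : ℝ) • (ω : E)) := fun hF =>
    hF.comp (by fun_prop)
  simp only [hc]
  rw [lintegral_const_mul _ (hm hF), lintegral_const_mul _ (hm hG)]
  exact mul_le_mul_right (h ρ ρ.2) _

/-- The spherical mean of a function that increases towards the origin is at most its mean over the
unit ball. -/
theorem lintegral_sphere_le [Nontrivial E] {h : E → ℝ≥0∞} (hm : Measurable h)
    (hh : ∀ ρ : ℝ, 0 < ρ → ρ ≤ 1 → ∀ x, h x ≤ h (ρ • x)) :
    ∫⁻ ω : sphere (0 : E) 1, h ω ∂(sphereMeasure E) ≤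
      Module.finrank ℝ E * ∫⁻ x in ball (0 : E) 1, h x := by
  have hn : 0 < Module.finrank ℝ E := Module.finrank_pos
  rw [← lintegral_indicator measurableSet_ball, lintegral_polar (hm.indicator measurableSet_ball),
    ← lintegral_const_mul' _ _ (ENNReal.natCast_ne_top _)]
  refine lintegral_mono fun ω => ?_
  have h1 : ∫⁻ ρ in Set.Ioo (0 : ℝ) 1, ENNReal.ofReal (ρ ^ (Module.finrank ℝ E - 1)) * h ω ≤
      ∫⁻ ρ in Set.Ioi (0 : ℝ), ENNReal.ofReal (ρ ^ (Module.finrank ℝ E - 1)) *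
        (ball (0 : E) 1).indicator h (ρ • (ω : E)) := by
    refine le_trans ?_ (lintegral_mono_set (s := Set.Ioo (0 : ℝ) 1) fun ρ hρ => hρ.1)
    refine setLIntegral_mono' measurableSet_Ioo fun ρ hρ => ?_
    rw [Set.indicator_of_mem]
    · exact mul_le_mul_right (hh ρ hρ.1 hρ.2.le _) _
    · rw [mem_ball_zero_iff, norm_smul, norm_eq_of_mem_sphere, Real.norm_of_nonneg hρ.1.le, mul_one]
      exact hρ.2
  have h2 : ∫⁻ ρ in Set.Ioo (0 : ℝ) 1, ENNReal.ofReal (ρ ^ (Module.finrank ℝ E - 1)) =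
      ENNReal.ofReal ((Module.finrank ℝ E : ℝ)⁻¹) := by
    rw [← ofReal_integral_eq_lintegral_ofReal, ← integral_Ioc_eq_integral_Ioo,
      ← intervalIntegral.integral_of_le zero_le_one, integral_pow]
    · rw [Nat.sub_add_cancel hn]
      congr 1
      have : ((Module.finrank ℝ E - 1 : ℕ) : ℝ) + 1 = Module.finrank ℝ E := by
        exact_mod_cast Nat.sub_add_cancel hn
      rw [this, one_pow, zero_pow hn.ne', sub_zero, one_div]
    · exact ((continuous_pow _).integrableOn_Icc (a := 0) (b := 1)).mono_set Set.Ioo_subset_Icc_self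
    · exact (ae_restrict_iff' measurableSet_Ioo).2
        (Eventually.of_forall fun ρ hρ => pow_nonneg hρ.1.le _)
  rw [lintegral_mul_const _ (by fun_prop), h2] at h1
  refine le_trans (le_of_eq ?_) (mul_le_mul_right h1 _)
  rw [← mul_assoc, ← ENNReal.ofReal_natCast, ← ENNReal.ofReal_mul (by positivity),
    mul_inv_cancel₀ (by positivity), ENNReal.ofReal_one, one_mul]

/-- The integral of a function of one coordinate over the unit ball. -/
theorem lintegral_ball_inner_le {e : E} (he : ‖e‖ = 1) {h : ℝ → ℝ≥0∞} (hm : Measurable h) :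
    ∫⁻ x in ball (0 : E) 1, h (inner ℝ e x) ≤
      2 ^ (Module.finrank ℝ E - 1) * ∫⁻ t in Set.Icc (-1 : ℝ) 1, h t := by
  classical
  have hn : 0 < Module.finrank ℝ E := by
    have : Nontrivial E := ⟨⟨e, 0, by rintro rfl; simp at he⟩⟩
    exact Module.finrank_pos
  set n := Module.finrank ℝ E with hnd
  let i₀ : Fin n := ⟨0, hn⟩
  -- extend `e` to an orthonormal basis, and enclose the ball in a cube
  obtain ⟨b, hb⟩ := Orthonormal.exists_orthonormalBasis_extension_of_card_eq (𝕜 := ℝ) (E := E)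
    (ι := Fin n) (by simp [hnd]) (v := fun _ => e) (s := {i₀}) (by
      rw [orthonormal_iff_ite]
      rintro ⟨i, rfl⟩ ⟨j, rfl⟩
      simp [he])
  have hb0 : b i₀ = e := hb i₀ rfl
  have hmp : MeasurePreserving (fun x : E => WithLp.ofLp (b.repr x)) volume
      (volume : Measure (Fin n → ℝ)) := (PiLp.volume_preserving_ofLp (Fin n)).comp
        b.measurePreserving_repr
  have h1 : ∀ x : E, inner ℝ e x = (WithLp.ofLp (b.repr x)) i₀ := fun x => by
    rw [b.repr_apply_apply, hb0]
  set Q : Set (Fin n → ℝ) := Set.univ.pi fun _ => Set.Icc (-1 : ℝ) 1 with hQ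
  have hQm : MeasurableSet Q := MeasurableSet.univ_pi fun _ => measurableSet_Icc
  have h2 : ∫⁻ x in ball (0 : E) 1, h (inner ℝ e x) ≤ ∫⁻ y in Q, h (y i₀) := by
    rw [← lintegral_indicator measurableSet_ball, ← lintegral_indicator hQm,
      ← hmp.lintegral_comp ((show Measurable fun y : Fin n → ℝ => h (y i₀) from
        hm.comp (measurable_pi_apply i₀)).indicator hQm)]
    refine lintegral_mono fun x => ?_
    by_cases hx : x ∈ ball (0 : E) 1
    · have hxQ : WithLp.ofLp (b.repr x) ∈ Q := by
        refine Set.mem_univ_pi.2 fun i => abs_le.1 ?_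
        have h3 := PiLp.norm_apply_le (b.repr x) i
        rw [LinearIsometryEquiv.norm_map] at h3
        exact h3.trans (mem_ball_zero_iff.1 hx).le
      rw [Set.indicator_of_mem hx, Set.indicator_of_mem hxQ, h1]
    · rw [Set.indicator_of_notMem hx]
      exact zero_le
  refine h2.trans_eq ?_
  rw [hQ, volume_pi, Measure.restrict_pi_pi, ← lintegral_map hm (measurable_pi_apply i₀)]
  have h3 := Measure.pi_map_eval (μ := fun _ : Fin n => (volume : Measure ℝ).restrict
    (Set.Icc (-1 : ℝ) 1)) i₀
  change Measure.map (fun y : Fin n → ℝ => y i₀) _ = _ at h3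
  rw [h3, lintegral_smul_measure]
  congr 1
  have h4 : (2 : ℝ≥0∞) = ENNReal.ofReal (1 - -1) := by norm_num
  simp [Finset.prod_const, Finset.card_erase_of_mem, h4]

end SphericalMeans

/-! ### One-dimensional integrals -/

section OneDimensionalIntegrals

/-- The regularized inverse `1 / max(κ, x)`, as an extended nonnegative real number. -/
def regInv (κ x : ℝ) : ℝ≥0∞ := ENNReal.ofReal (1 / max κ x)

theorem measurable_regInv (κ : ℝ) : Measurable (regInv κ) := by
  unfold regInv
  fun_prop

theorem regInv_anti_right {κ : ℝ} (hκ : 0 < κ) {x y : ℝ} (h : x ≤ y) : regInv κ y ≤ regInv κ x := by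
  have : 0 < max κ x := lt_max_of_lt_left hκ
  unfold regInv
  gcongr

theorem regInv_le {κ x b : ℝ} (hb : 0 < b) (h : b ≤ max κ x) :
    regInv κ x ≤ ENNReal.ofReal (1 / b) := by
  unfold regInv
  gcongr

theorem lintegral_Icc_zero_regInv_le {m b : ℝ} (hm : 0 < m) (hmb : m ≤ b) :
    ∫⁻ t in Set.Icc 0 b, regInv m t ≤ ENNReal.ofReal (1 + Real.log (b / m)) := by
  have hb : 0 < b := hm.trans_le hmb
  have h1 : ∫⁻ t in Set.Icc 0 m, regInv m t ≤ ENNReal.ofReal 1 := by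
    refine (setLIntegral_mono' measurableSet_Icc (g := fun _ => ENNReal.ofReal (1 / m))
      fun t _ => regInv_le hm (le_max_left _ _)).trans_eq ?_
    rw [setLIntegral_const, Real.volume_Icc, ← ENNReal.ofReal_mul (by positivity), sub_zero,
      one_div, inv_mul_cancel₀ hm.ne']
  have h2 : ∫⁻ t in Set.Icc m b, regInv m t ≤ ENNReal.ofReal (Real.log (b / m)) := by
    refine (setLIntegral_mono' measurableSet_Icc (g := fun t => ENNReal.ofReal (1 / t))
      fun t ht => regInv_le (hm.trans_le ht.1) (le_max_right _ _)).trans_eq ?_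
    have hi : IntegrableOn (fun t : ℝ => 1 / t) (Set.Icc m b) :=
      ContinuousOn.integrableOn_Icc (continuousOn_const.div continuousOn_id
        fun t ht => (hm.trans_le ht.1).ne')
    rw [← ofReal_integral_eq_lintegral_ofReal hi, integral_Icc_eq_integral_Ioc,
      ← intervalIntegral.integral_of_le hmb, integral_one_div_of_pos hm hb]
    exact (ae_restrict_iff' measurableSet_Icc).2 (Eventually.of_forall fun t ht =>
      one_div_nonneg.2 (hm.le.trans ht.1))
  rw [← Set.Icc_union_Icc_eq_Icc hm.le hmb,
    ENNReal.ofReal_add zero_le_one (Real.log_nonneg ((one_le_div hm).2 hmb))]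
  exact (lintegral_union_le _ _ _).trans (add_le_add h1 h2)

theorem lintegral_Icc_regInv_abs_le {m b : ℝ} (hm : 0 < m) (hmb : m ≤ b) :
    ∫⁻ t in Set.Icc (-b) b, regInv m |t| ≤ 2 * ENNReal.ofReal (1 + Real.log (b / m)) := by
  have hb : 0 < b := hm.trans_le hmb
  have h1 : ∫⁻ t in Set.Icc 0 b, regInv m |t| ≤ ENNReal.ofReal (1 + Real.log (b / m)) := by
    refine le_trans (le_of_eq (setLIntegral_congr_fun measurableSet_Icc fun t ht => ?_))
      (lintegral_Icc_zero_regInv_le hm hmb)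
    simp only [abs_of_nonneg ht.1]
  have h2 : ∫⁻ t in Set.Icc (-b) 0, regInv m |t| = ∫⁻ t in Set.Icc 0 b, regInv m |t| := by
    have := (Measure.measurePreserving_neg (volume : Measure ℝ)).setLIntegral_comp_preimage
      (measurableSet_Icc (a := 0) (b := b)) (f := fun t => regInv m |t|)
      ((measurable_regInv m).comp measurable_abs)
    rw [← this]
    simp
  rw [← Set.Icc_union_Icc_eq_Icc (neg_nonpos.2 hb.le) hb.le, two_mul]
  exact (lintegral_union_le _ _ _).trans (add_le_add (h2.trans_le h1) h1)

theorem lintegral_Ioi_regInv_sq_le {κ : ℝ} (hκ : 0 < κ) :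
    ∫⁻ t in Set.Ioi (0 : ℝ), regInv κ (t ^ 2) ≤ ENNReal.ofReal (2 / √κ) := by
  have hs : 0 < √κ := Real.sqrt_pos.2 hκ
  have h1 : ∫⁻ t in Set.Ioc 0 (√κ), regInv κ (t ^ 2) ≤ ENNReal.ofReal (1 / √κ) := by
    refine (setLIntegral_mono' measurableSet_Ioc (g := fun _ => ENNReal.ofReal (1 / κ))
      fun t _ => regInv_le hκ (le_max_left _ _)).trans_eq ?_
    rw [setLIntegral_const, Real.volume_Ioc, ← ENNReal.ofReal_mul (by positivity), sub_zero]
    congr 1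
    nth_rewrite 1 [← Real.sq_sqrt hκ.le]
    field_simp
  have h2 : ∫⁻ t in Set.Ioi (√κ), regInv κ (t ^ 2) ≤ ENNReal.ofReal (1 / √κ) := by
    refine (setLIntegral_mono' measurableSet_Ioi (g := fun t => ENNReal.ofReal (t ^ (-2 : ℝ)))
      fun t ht => ?_).trans_eq ?_
    · have ht0 : 0 < t := hs.trans ht
      refine (regInv_le (by positivity : 0 < t ^ 2) (le_max_right _ _)).trans_eq ?_
      rw [Real.rpow_neg ht0.le, one_div]
      norm_num
    · rw [← ofReal_integral_eq_lintegral_ofReal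
        (integrableOn_Ioi_rpow_of_lt (by norm_num) hs), integral_Ioi_rpow_of_lt (by norm_num) hs]
      · norm_num [Real.rpow_neg_one]
      · exact (ae_restrict_iff' measurableSet_Ioi).2 (Eventually.of_forall fun t ht =>
          Real.rpow_nonneg (hs.le.trans (le_of_lt ht)) _)
  rw [← Set.Ioc_union_Ioi_eq_Ioi hs.le]
  refine (lintegral_union_le _ _ _).trans ((add_le_add h1 h2).trans_eq ?_)
  rw [← ENNReal.ofReal_add (by positivity) (by positivity)]
  congr 1
  ring

theorem one_le_log_inv {κ : ℝ} (hκ : 0 < κ) (hκ' : κ ≤ Real.exp (-1)) : 1 ≤ Real.log κ⁻¹ := by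
  rw [Real.log_inv]
  have := (Real.log_le_iff_le_exp hκ).2 hκ'
  linarith

/-- The one-dimensional integral behind the bounds with bilinear phase in dimension at least two. -/
theorem lintegral_Icc_regInv_mul_abs_le {κ t : ℝ} (hκ : 0 < κ) (hκ' : κ ≤ Real.exp (-1))
    (ht : 0 < t) :
    ∫⁻ u in Set.Icc (-1 : ℝ) 1, regInv κ (t * |u|) ≤
      4 * ENNReal.ofReal (Real.log κ⁻¹) * (1 + ENNReal.ofReal (1 / t)) := by
  have hL := one_le_log_inv hκ hκ'
  have hL1 : (1 : ℝ≥0∞) ≤ ENNReal.ofReal (Real.log κ⁻¹) := by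
    rwa [← ENNReal.ofReal_one, ENNReal.ofReal_le_ofReal_iff (by linarith)]
  rcases le_total t κ with h | h
  · calc _ ≤ ∫⁻ u in Set.Icc (-1 : ℝ) 1, ENNReal.ofReal (1 / t) :=
          lintegral_mono fun u => regInv_le ht (h.trans (le_max_left _ _))
      _ = 2 * 1 * (ENNReal.ofReal (1 / t)) := by
          rw [setLIntegral_const, Real.volume_Icc]
          norm_num [mul_comm]
      _ ≤ _ := by
          gcongr
          · norm_num
          · exact le_add_self
  · have h1 : ∀ u, regInv κ (t * |u|) = ENNReal.ofReal (1 / t) * regInv (κ / t) |u| := fun u => by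
      rw [regInv, regInv, ← ENNReal.ofReal_mul (by positivity)]
      have : max κ (t * |u|) = t * max (κ / t) |u| := by
        rw [mul_max_of_nonneg _ _ ht.le, mul_div_cancel₀ _ ht.ne']
      rw [this, one_div_mul_one_div]
    simp only [h1]
    rw [lintegral_const_mul' _ _ ENNReal.ofReal_ne_top]
    refine (mul_le_mul_right (lintegral_Icc_regInv_abs_le (by positivity)
      ((div_le_one ht).2 h)) _).trans ?_
    have h2 : (1 / t) * (1 + Real.log (1 / (κ / t))) ≤ 2 * Real.log κ⁻¹ * (1 + 1 / t) := by
      have h3 : Real.log (1 / (κ / t)) = Real.log t + Real.log κ⁻¹ := by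
        rw [one_div_div, div_eq_mul_inv, Real.log_mul ht.ne' (by positivity)]
      have h4 := Real.log_le_sub_one_of_pos ht
      have h5 : (1 / t) * Real.log t ≤ 1 := by
        rw [one_div_mul_eq_div, div_le_one ht]
        linarith
      have h6 : 0 < 1 / t := by positivity
      rw [h3]
      nlinarith
    calc _ = 2 * ENNReal.ofReal ((1 / t) * (1 + Real.log (1 / (κ / t)))) := by
          rw [ENNReal.ofReal_mul (by positivity)]
          ring
      _ ≤ 2 * ENNReal.ofReal (2 * Real.log κ⁻¹ * (1 + 1 / t)) := by gcongr
      _ = _ := by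
          rw [ENNReal.ofReal_mul (by positivity), ENNReal.ofReal_mul (by norm_num),
            ENNReal.ofReal_add (by norm_num) (by positivity)]
          norm_num
          ring

/-- The radial integral behind the bounds with quadratic phase, for the part of the phase below `1`.
The bound is uniform in the position `a` of the zero of the phase. -/
theorem lintegral_Ioi_quadratic_le {κ : ℝ} (hκ : 0 < κ) (hκ' : κ ≤ Real.exp (-1)) (a : ℝ) :
    ∫⁻ ρ in Set.Ioi (0 : ℝ), ENNReal.ofReal ρ *
      (if ρ * |ρ - a| < 1 then regInv κ (ρ * |ρ - a|) else 0) ≤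
      20 * ENNReal.ofReal (Real.log κ⁻¹) := by
  have hL := one_le_log_inv hκ hκ'
  have hκ1 : κ ≤ 1 := hκ'.trans (Real.exp_le_one_iff.2 (by norm_num))
  have hs : 0 < √κ := Real.sqrt_pos.2 hκ
  have hs1 : √κ ≤ 1 := Real.sqrt_le_one.2 hκ1
  -- far from `a` the integrand is at most `2ρ / max(κ, ρ²)`
  have h1 : ∀ ρ : ℝ, 0 < ρ → ρ / 2 ≤ |ρ - a| → ρ * |ρ - a| < 1 →
      ENNReal.ofReal ρ * regInv κ (ρ * |ρ - a|) ≤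
        (Set.Icc 0 2).indicator (fun ρ => 2 * regInv √κ ρ) ρ := by
    intro ρ hρ h h'
    have hρ2 : ρ ≤ 2 := by nlinarith
    rw [Set.indicator_of_mem (show ρ ∈ Set.Icc (0 : ℝ) 2 from ⟨hρ.le, hρ2⟩), regInv, regInv,
      ← ENNReal.ofReal_mul hρ.le, ← ENNReal.ofReal_ofNat, ← ENNReal.ofReal_mul (by norm_num)]
    refine ENNReal.ofReal_le_ofReal ?_
    have hm : 0 < max κ (ρ * |ρ - a|) := lt_max_of_lt_left hκ
    have hm' : 0 < max √κ ρ := lt_max_of_lt_left hs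
    rw [mul_one_div, mul_one_div, div_le_div_iff₀ hm hm']
    rcases le_total √κ ρ with h2 | h2
    · rw [max_eq_right h2]
      have := le_max_right κ (ρ * |ρ - a|)
      nlinarith
    · rw [max_eq_left h2]
      have h3 := le_max_left κ (ρ * |ρ - a|)
      have h4 := Real.sq_sqrt hκ.le
      nlinarith
  -- near `a` it is at most `1 / max(κ / (2a), |ρ - a|)`
  have h2 : ∀ ρ : ℝ, 0 < ρ → |ρ - a| < ρ / 2 → ρ * |ρ - a| < 1 →
      ENNReal.ofReal ρ * regInv κ (ρ * |ρ - a|) ≤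
        (Set.Icc (-(2 / a)) (2 / a)).indicator (fun u => regInv (κ / (2 * a)) |u|) (ρ - a) := by
    intro ρ hρ h h'
    obtain ⟨h3, h4⟩ := abs_lt.1 h
    have ha : 0 < a := by linarith
    have h5 : |ρ - a| ≤ 2 / a := by
      rw [le_div_iff₀ ha]
      nlinarith [abs_nonneg (ρ - a)]
    rw [Set.indicator_of_mem (show ρ - a ∈ Set.Icc (-(2 / a)) (2 / a) from abs_le.1 h5), regInv,
      regInv, ← ENNReal.ofReal_mul hρ.le]
    refine ENNReal.ofReal_le_ofReal ?_
    have hm : 0 < max κ (ρ * |ρ - a|) := lt_max_of_lt_left hκ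
    have hm' : 0 < max (κ / (2 * a)) |ρ - a| := lt_max_of_lt_left (by positivity)
    rw [mul_one_div, div_le_div_iff₀ hm hm', one_mul, mul_max_of_nonneg _ _ hρ.le]
    refine max_le_max ?_ le_rfl
    rw [← mul_div_assoc, div_le_iff₀ (by positivity)]
    nlinarith
  have h3 : ∀ ρ ∈ Set.Ioi (0 : ℝ), ENNReal.ofReal ρ *
      (if ρ * |ρ - a| < 1 then regInv κ (ρ * |ρ - a|) else 0) ≤
      (Set.Icc 0 2).indicator (fun ρ => 2 * regInv √κ ρ) ρ +
        (Set.Icc (-(2 / a)) (2 / a)).indicator (fun u => regInv (κ / (2 * a)) |u|) (ρ - a) := by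
    intro ρ hρ
    split_ifs with h
    · rcases le_or_gt (ρ / 2) |ρ - a| with h' | h'
      · exact (h1 ρ hρ h' h).trans le_self_add
      · exact (h2 ρ hρ h' h).trans le_add_self
    · simp
  have hmeas1 : Measurable ((Set.Icc (0 : ℝ) 2).indicator (fun ρ => 2 * regInv √κ ρ)) :=
    ((measurable_regInv _).const_mul _).indicator measurableSet_Icc
  have hmeas2 : Measurable ((Set.Icc (-(2 / a)) (2 / a)).indicator
      (fun u => regInv (κ / (2 * a)) |u|)) :=
    ((measurable_regInv _).comp measurable_abs).indicator measurableSet_Icc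
  have h4 : ∫⁻ ρ, (Set.Icc (0 : ℝ) 2).indicator (fun ρ => 2 * regInv √κ ρ) ρ ≤
      8 * ENNReal.ofReal (Real.log κ⁻¹) := by
    rw [lintegral_indicator measurableSet_Icc, lintegral_const_mul _ (measurable_regInv _)]
    refine (mul_le_mul_right (lintegral_Icc_zero_regInv_le hs (hs1.trans one_le_two)) _).trans ?_
    have h5 : 1 + Real.log (2 / √κ) ≤ 4 * Real.log κ⁻¹ := by
      rw [Real.log_div two_ne_zero hs.ne', Real.log_sqrt hκ.le]
      have := Real.log_two_lt_d9
      rw [Real.log_inv] at hL ⊢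
      linarith
    calc _ ≤ 2 * ENNReal.ofReal (4 * Real.log κ⁻¹) := by gcongr
      _ = _ := by
        rw [ENNReal.ofReal_mul (by norm_num), ← mul_assoc]
        norm_num
  have h5 : ∫⁻ ρ, (Set.Icc (-(2 / a)) (2 / a)).indicator (fun u => regInv (κ / (2 * a)) |u|)
      (ρ - a) ≤ 12 * ENNReal.ofReal (Real.log κ⁻¹) := by
    rw [lintegral_sub_right_eq_self (fun u => (Set.Icc (-(2 / a)) (2 / a)).indicator
      (fun u => regInv (κ / (2 * a)) |u|) u) a]
    rcases le_or_gt a 0 with ha | ha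
    · rcases ha.lt_or_eq with ha | rfl
      · rw [Set.Icc_eq_empty]
        · simp
        · have : 2 / a < 0 := div_neg_of_pos_of_neg two_pos ha
          linarith
      · rw [lintegral_indicator measurableSet_Icc]
        simp
    rw [lintegral_indicator measurableSet_Icc]
    refine (lintegral_Icc_regInv_abs_le (by positivity) ?_).trans ?_
    · rw [div_le_div_iff₀ (by positivity) ha]
      nlinarith
    have h6 : 1 + Real.log (2 / a / (κ / (2 * a))) ≤ 6 * Real.log κ⁻¹ := by
      have h7 : 2 / a / (κ / (2 * a)) = 2 * 2 * κ⁻¹ := by field_simp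
      rw [h7, Real.log_mul (by norm_num) (by positivity), Real.log_mul two_ne_zero two_ne_zero]
      have := Real.log_two_lt_d9
      linarith
    calc _ ≤ 2 * ENNReal.ofReal (6 * Real.log κ⁻¹) := by gcongr
      _ = _ := by
        rw [ENNReal.ofReal_mul (by norm_num), ← mul_assoc]
        norm_num
  refine (setLIntegral_mono' measurableSet_Ioi h3).trans ((setLIntegral_le_lintegral _ _).trans ?_)
  rw [lintegral_add_left hmeas1]
  refine (add_le_add h4 h5).trans_eq ?_
  rw [← add_mul]
  norm_num

end OneDimensionalIntegrals

/-! ### Integrals with bilinear phase in dimension at least two -/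

section OscillatoryIntegrals

open Metric

variable {E : Type*} [NormedAddCommGroup E] [InnerProductSpace ℝ E] [FiniteDimensional ℝ E]
  [MeasurableSpace E] [BorelSpace E]

theorem sphereMeasure_univ_ne_zero [Nontrivial E] : sphereMeasure E Set.univ ≠ 0 := by
  rw [Measure.measure_univ_ne_zero]
  exact Measure.toSphere_ne_zero _

theorem lintegral_ball_inv_norm_le (hn : 2 ≤ Module.finrank ℝ E) :
    ∫⁻ x in ball (0 : E) 1, ENNReal.ofReal (1 / ‖x‖) ≤ sphereMeasure E Set.univ := by
  have : Nontrivial E := Module.nontrivial_of_finrank_pos (R := ℝ) (by omega)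
  have hm : Measurable fun x : E => ENNReal.ofReal (1 / ‖x‖) := by fun_prop
  rw [← lintegral_indicator measurableSet_ball, lintegral_polar (hm.indicator measurableSet_ball),
    ← lintegral_one]
  refine lintegral_mono fun ω => ?_
  have h1 : ∀ ρ ∈ Set.Ioi (0 : ℝ), ENNReal.ofReal (ρ ^ (Module.finrank ℝ E - 1)) *
      (ball (0 : E) 1).indicator (fun x => ENNReal.ofReal (1 / ‖x‖)) (ρ • (ω : E)) ≤
      (Set.Ioc (0 : ℝ) 1).indicator (fun _ => 1) ρ := by
    intro ρ hρ
    have hρ : 0 < ρ := hρ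
    have hn' : ‖ρ • (ω : E)‖ = ρ := by
      rw [norm_smul, norm_eq_of_mem_sphere, Real.norm_of_nonneg hρ.le, mul_one]
    by_cases h : ρ < 1
    · rw [Set.indicator_of_mem (by rwa [mem_ball_zero_iff, hn']),
        Set.indicator_of_mem (show ρ ∈ Set.Ioc (0 : ℝ) 1 from ⟨hρ, h.le⟩), hn',
        ← ENNReal.ofReal_mul (by positivity), ENNReal.ofReal_le_one, mul_one_div, div_le_one hρ]
      exact pow_le_of_le_one hρ.le h.le (by omega)
    · rw [Set.indicator_of_notMem (by rwa [mem_ball_zero_iff, hn'])]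
      simp
  refine (setLIntegral_mono' measurableSet_Ioi h1).trans ((setLIntegral_le_lintegral _ _).trans ?_)
  rw [lintegral_indicator measurableSet_Ioc]
  simp

/-- Convolution of a bounded integrable function with the singularity `1 / ‖x‖`. -/
theorem lintegral_mul_inv_norm_add_le (hn : 2 ≤ Module.finrank ℝ E) {f : E → ℝ≥0∞}
    (hf : AEMeasurable f) {M : ℝ≥0∞} (hM : ∀ᵐ x, f x ≤ M) (y : E) :
    ∫⁻ x, f x * ENNReal.ofReal (1 / ‖x + y‖) ≤ (∫⁻ x, f x) + M * sphereMeasure E Set.univ := by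
  have hm : Measurable fun x : E => ENNReal.ofReal (1 / ‖x‖) := by fun_prop
  have hm' := hm.indicator (measurableSet_ball (x := (0 : E)) (ε := 1))
  have h1 : ∀ᵐ x, f x * ENNReal.ofReal (1 / ‖x + y‖) ≤
      f x + M * (ball (0 : E) 1).indicator (fun x => ENNReal.ofReal (1 / ‖x‖)) (x + y) := by
    filter_upwards [hM] with x hx
    by_cases h : x + y ∈ ball (0 : E) 1
    · rw [Set.indicator_of_mem h]
      exact (mul_le_mul_left hx _).trans le_add_self
    · refine le_trans (mul_le_of_le_one_right' ?_) le_self_add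
      rw [mem_ball_zero_iff, not_lt] at h
      rw [ENNReal.ofReal_le_one, div_le_one (by linarith)]
      exact h
  refine (lintegral_mono_ae h1).trans ?_
  rw [lintegral_add_left' hf, lintegral_const_mul _
      (show Measurable fun x =>
          (ball (0 : E) 1).indicator (fun x => ENNReal.ofReal (1 / ‖x‖)) (x + y)
        from hm'.comp (measurable_add_const y)),
    lintegral_add_right_eq_self (fun x => (ball (0 : E) 1).indicator
      (fun x => ENNReal.ofReal (1 / ‖x‖)) x) y, lintegral_indicator measurableSet_ball]
  gcongr
  exact lintegral_ball_inv_norm_le hn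

/-- In dimension at least two, the integral of `1 / max(κ, |k·x|)` against a radial weight diverges
only logarithmically as `κ → 0`. A radial weight sees only the spherical means in `k`, which are at
most means over the unit ball, where the coordinate along `x` can be integrated. -/
theorem lintegral_radial_mul_regInv_inner_le (hn : 2 ≤ Module.finrank ℝ E) {S : E → ℝ≥0∞}
    (hS : AEMeasurable S) (hrad : ∀ x y, ‖x‖ = ‖y‖ → S x = S y) {κ : ℝ} (hκ : 0 < κ)
    (hκ' : κ ≤ Real.exp (-1)) {x : E} (hx : x ≠ 0) :
    ∫⁻ k, S k * regInv κ |inner ℝ k x| ≤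
      (Module.finrank ℝ E * 2 ^ (Module.finrank ℝ E - 1) * 4 / sphereMeasure E Set.univ) *
        ENNReal.ofReal (Real.log κ⁻¹) *
        ∫⁻ k, S k * (1 + ENNReal.ofReal (1 / ‖x‖) * ENNReal.ofReal (1 / ‖k‖)) := by
  have : Nontrivial E := Module.nontrivial_of_finrank_pos (R := ℝ) (by omega)
  have hσ0 : sphereMeasure E Set.univ ≠ 0 := sphereMeasure_univ_ne_zero
  set σ := sphereMeasure E Set.univ with hσ
  set C : ℝ≥0∞ := (Module.finrank ℝ E * 2 ^ (Module.finrank ℝ E - 1) * 4 / σ) with hC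
  have hCt : C ≠ ∞ := ENNReal.div_ne_top (by finiteness) hσ0
  rw [← lintegral_const_mul' _ _ (by finiteness)]
  have hF : Measurable fun k : E => regInv κ |inner ℝ k x| :=
    (measurable_regInv κ).comp (by fun_prop)
  have hG : Measurable fun k : E => C * ENNReal.ofReal (Real.log κ⁻¹) *
      (1 + ENNReal.ofReal (1 / ‖x‖) * ENNReal.ofReal (1 / ‖k‖)) := by fun_prop
  refine (lintegral_radial_mul_le hS hrad hF hG fun ρ hρ => ?_).trans_eq
    (lintegral_congr fun k => by ring)
  have hx0 : 0 < ‖x‖ := norm_pos_iff.2 hx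
  have ht : 0 < ρ * ‖x‖ := by positivity
  have he : ‖(‖x‖⁻¹ • x)‖ = 1 := by
    rw [norm_smul, norm_inv, norm_norm, inv_mul_cancel₀ hx0.ne']
  have hin : ∀ u : E, |inner ℝ (ρ • u) x| = ρ * ‖x‖ * |inner ℝ (‖x‖⁻¹ • x) u| := fun u => by
    rw [real_inner_smul_left, real_inner_smul_left, abs_mul, abs_mul, abs_of_pos hρ, abs_inv,
      abs_norm, real_inner_comm]
    field_simp
  have h1 : Measurable fun t : ℝ => regInv κ (ρ * ‖x‖ * |t|) :=
    (measurable_regInv κ).comp (by fun_prop)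
  calc ∫⁻ ω : sphere (0 : E) 1, regInv κ |inner ℝ (ρ • (ω : E)) x| ∂(sphereMeasure E)
      = ∫⁻ ω : sphere (0 : E) 1, regInv κ (ρ * ‖x‖ * |inner ℝ (‖x‖⁻¹ • x) (ω : E)|)
          ∂(sphereMeasure E) := by simp only [hin]
    _ ≤ Module.finrank ℝ E * ∫⁻ u in ball (0 : E) 1,
          regInv κ (ρ * ‖x‖ * |inner ℝ (‖x‖⁻¹ • x) u|) := by
        refine lintegral_sphere_le (h1.comp (by fun_prop)) fun s hs hs' u => ?_
        refine regInv_anti_right hκ ?_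
        rw [real_inner_smul_right, abs_mul, abs_of_pos hs]
        gcongr
        exact mul_le_of_le_one_left (abs_nonneg _) hs'
    _ ≤ Module.finrank ℝ E * (2 ^ (Module.finrank ℝ E - 1) *
          (4 * ENNReal.ofReal (Real.log κ⁻¹) * (1 + ENNReal.ofReal (1 / (ρ * ‖x‖))))) := by
        gcongr
        exact (lintegral_ball_inner_le he h1).trans
          (mul_le_mul_right (lintegral_Icc_regInv_mul_abs_le hκ hκ' ht) _)
    _ = (C * σ) * ENNReal.ofReal (Real.log κ⁻¹) *
          (1 + ENNReal.ofReal (1 / ‖x‖) * ENNReal.ofReal (1 / ρ)) := by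
        rw [hC, ENNReal.div_mul_cancel hσ0 (measure_ne_top _ _),
          ← ENNReal.ofReal_mul (by positivity), one_div_mul_one_div, mul_comm ‖x‖]
        ring
    _ = ∫⁻ ω : sphere (0 : E) 1, C * ENNReal.ofReal (Real.log κ⁻¹) *
          (1 + ENNReal.ofReal (1 / ‖x‖) * ENNReal.ofReal (1 / ‖ρ • (ω : E)‖))
            ∂(sphereMeasure E) := by
        have h2 : ∀ ω : sphere (0 : E) 1, ‖ρ • (ω : E)‖ = ρ := fun ω => by
          rw [norm_smul, norm_eq_of_mem_sphere, Real.norm_of_nonneg hρ.le, mul_one]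
        simp only [h2]
        rw [lintegral_const, ← hσ]
        ring

/-- The double integral with bilinear phase in dimension at least two: the inner integral is at most
logarithmic, with a factor `1 + 1 / ‖k + y‖` that the outer integral absorbs. -/
theorem lintegral_lintegral_regInv_le (hn : 2 ≤ Module.finrank ℝ E) :
    ∃ C : ℝ≥0∞, C ≠ ∞ ∧ ∀ {r S : E → ℝ≥0∞}, AEMeasurable r → AEMeasurable S →
      (∀ x y, ‖x‖ = ‖y‖ → S x = S y) → ∀ {Mr MS : ℝ≥0∞}, (∀ᵐ x, r x ≤ Mr) → (∀ᵐ x, S x ≤ MS) →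
      ∀ {κ : ℝ}, 0 < κ → κ ≤ Real.exp (-1) → ∀ y : E,
      ∫⁻ k, r k * ∫⁻ k', S k' * regInv κ |inner ℝ k' (k + y)| ≤
        C * ENNReal.ofReal (Real.log κ⁻¹) * (((∫⁻ k, S k) + MS) * ((∫⁻ k, r k) + Mr)) := by
  have : Nontrivial E := Module.nontrivial_of_finrank_pos (R := ℝ) (by omega)
  have hσ0 : sphereMeasure E Set.univ ≠ 0 := sphereMeasure_univ_ne_zero
  have hσt : sphereMeasure E Set.univ ≠ ∞ := measure_ne_top _ _
  set σ := sphereMeasure E Set.univ with hσ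
  set C : ℝ≥0∞ := (Module.finrank ℝ E * 2 ^ (Module.finrank ℝ E - 1) * 4 / σ) with hC
  have hCt : C ≠ ∞ := ENNReal.div_ne_top (by finiteness) hσ0
  refine ⟨C * (1 + σ) * (2 + σ), by finiteness, ?_⟩
  intro r S hr hS hrad Mr MS hMr hMS κ hκ hκ' y
  set Λ := ENNReal.ofReal (Real.log κ⁻¹) with hΛ
  set NS := (∫⁻ k, S k) + MS with hNS
  have h1 : ∀ x : E, x ≠ 0 → ∫⁻ k', S k' * regInv κ |inner ℝ k' x| ≤
      C * Λ * ((1 + σ) * NS) * (1 + ENNReal.ofReal (1 / ‖x‖)) := by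
    intro x hx
    refine (lintegral_radial_mul_regInv_inner_le hn hS hrad hκ hκ' hx).trans ?_
    rw [mul_assoc (C * Λ)]
    refine mul_le_mul_right ?_ _
    have h2 : ∫⁻ k, S k * ENNReal.ofReal (1 / ‖k‖) ≤ (1 + σ) * NS := by
      have := lintegral_mul_inv_norm_add_le hn hS hMS 0
      simp only [add_zero] at this
      refine this.trans ?_
      rw [add_mul, one_mul, mul_comm σ, hNS]
      gcongr
      · exact le_self_add
      · exact le_add_self
    have h3 : ∫⁻ k, S k ≤ (1 + σ) * NS := by
      rw [add_mul, one_mul, hNS]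
      exact le_self_add.trans le_self_add
    calc _ = ∫⁻ k, (S k + ENNReal.ofReal (1 / ‖x‖) * (S k * ENNReal.ofReal (1 / ‖k‖))) :=
          lintegral_congr fun k => by ring
      _ = (∫⁻ k, S k) + ENNReal.ofReal (1 / ‖x‖) * ∫⁻ k, S k * ENNReal.ofReal (1 / ‖k‖) := by
          rw [lintegral_add_left' hS, lintegral_const_mul' _ _ ENNReal.ofReal_ne_top]
      _ ≤ (1 + σ) * NS + ENNReal.ofReal (1 / ‖x‖) * ((1 + σ) * NS) := by gcongr
      _ = _ := by ring
  have h2 : ∀ᵐ k : E, r k * ∫⁻ k', S k' * regInv κ |inner ℝ k' (k + y)| ≤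
      C * Λ * ((1 + σ) * NS) * (r k * (1 + ENNReal.ofReal (1 / ‖k + y‖))) := by
    have : ∀ᵐ k : E, k ≠ -y := by simp [ae_iff, measure_singleton]
    filter_upwards [this] with k hk
    refine (mul_le_mul_right (h1 _ fun h => hk (eq_neg_of_add_eq_zero_left h)) _).trans_eq ?_
    ring
  refine (lintegral_mono_ae h2).trans ?_
  have hm : AEMeasurable fun k : E => r k * (1 + ENNReal.ofReal (1 / ‖k + y‖)) := by fun_prop
  rw [lintegral_const_mul'' _ hm]
  have h3 : ∫⁻ k, r k * (1 + ENNReal.ofReal (1 / ‖k + y‖)) ≤ (2 + σ) * ((∫⁻ k, r k) + Mr) := by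
    calc _ = ∫⁻ k, (r k + r k * ENNReal.ofReal (1 / ‖k + y‖)) := lintegral_congr fun k => by ring
      _ ≤ (∫⁻ k, r k) + ((∫⁻ k, r k) + Mr * σ) := by
          rw [lintegral_add_left' hr]
          gcongr
          exact lintegral_mul_inv_norm_add_le hn hr hMr y
      _ ≤ (∫⁻ k, r k) + ((∫⁻ k, r k) + Mr * σ) + (2 * Mr + (∫⁻ k, r k) * σ) := le_self_add
      _ = _ := by ring
  refine (mul_le_mul_right h3 _).trans_eq ?_
  ring

end OscillatoryIntegrals

/-! ### Integrals in dimension one, and integrals with quadratic phase -/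

section QuadraticPhase

open Metric

variable {E : Type*} [NormedAddCommGroup E] [InnerProductSpace ℝ E] [FiniteDimensional ℝ E]
  [MeasurableSpace E] [BorelSpace E]

theorem lintegral_fun_norm_of_finrank_eq_one (hn : Module.finrank ℝ E = 1) {F : ℝ → ℝ≥0∞}
    (hF : Measurable F) :
    ∫⁻ x : E, F ‖x‖ = sphereMeasure E Set.univ * ∫⁻ ρ in Set.Ioi (0 : ℝ), F ρ := by
  have : Nontrivial E := Module.nontrivial_of_finrank_pos (R := ℝ) (by omega)
  rw [lintegral_polar (F := fun x : E => F ‖x‖) (hF.comp measurable_norm)]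
  have h1 : ∀ ω : sphere (0 : E) 1, ∫⁻ ρ in Set.Ioi (0 : ℝ),
      ENNReal.ofReal (ρ ^ (Module.finrank ℝ E - 1)) * F ‖ρ • (ω : E)‖ =
      ∫⁻ ρ in Set.Ioi (0 : ℝ), F ρ := by
    intro ω
    refine setLIntegral_congr_fun measurableSet_Ioi fun ρ hρ => ?_
    have hρ : 0 < ρ := hρ
    simp only [hn, norm_smul, norm_eq_of_mem_sphere, Real.norm_of_nonneg hρ.le]
    simp
  simp only [h1]
  rw [lintegral_const, mul_comm]

theorem abs_inner_of_finrank_eq_one {V : Type*} [NormedAddCommGroup V] [InnerProductSpace ℝ V]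
    (hn : Module.finrank ℝ V = 1) (x y : V) :
    |inner ℝ x y| = ‖x‖ * ‖y‖ := by
  obtain ⟨v, -, hv⟩ := finrank_eq_one_iff'.1 hn
  obtain ⟨a, rfl⟩ := hv x
  obtain ⟨b, rfl⟩ := hv y
  rw [real_inner_smul_left, real_inner_smul_right, norm_smul, norm_smul, abs_mul, abs_mul,
    Real.norm_eq_abs, Real.norm_eq_abs, real_inner_self_eq_norm_sq, abs_of_nonneg (sq_nonneg ‖v‖)]
  ring

/-- In dimension one, where `|k'·x| = |k'| |x|`, this separates the variables. -/
theorem regInv_mul_le {κ a b : ℝ} (hκ : 0 < κ) (hκ1 : κ ≤ 1) (ha : 0 ≤ a) (hb : 0 ≤ b) :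
    regInv κ (a * b) ≤ regInv κ (min a 1) * regInv κ (min b 1) := by
  have h1 : 0 < max κ (min a 1) := lt_max_of_lt_left hκ
  have h2 : 0 < max κ (min b 1) := lt_max_of_lt_left hκ
  rw [regInv, regInv, regInv, ← ENNReal.ofReal_mul (by positivity), one_div_mul_one_div]
  refine ENNReal.ofReal_le_ofReal (one_div_le_one_div_of_le (by positivity) ?_)
  have h3 : max κ (min a 1) ≤ 1 := max_le hκ1 (min_le_right _ _)
  have h4 : max κ (min b 1) ≤ 1 := max_le hκ1 (min_le_right _ _)
  rcases le_total (min a 1) κ with h | h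
  · rw [max_eq_left h] at h3 ⊢
    exact (mul_le_of_le_one_right hκ.le h4).trans (le_max_left _ _)
  rcases le_total (min b 1) κ with h' | h'
  · rw [max_eq_left h'] at h4 ⊢
    exact (mul_le_of_le_one_left hκ.le h3).trans (le_max_left _ _)
  rw [max_eq_right h, max_eq_right h']
  exact (mul_le_mul (min_le_left _ _) (min_le_left _ _) (le_min hb zero_le_one) ha).trans
    (le_max_right _ _)

theorem ofReal_one_le_log_inv {κ : ℝ} (hκ : 0 < κ) (hκ' : κ ≤ Real.exp (-1)) :
    (1 : ℝ≥0∞) ≤ ENNReal.ofReal (Real.log κ⁻¹) :=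
  ENNReal.one_le_ofReal.2 (one_le_log_inv hκ hκ')

theorem lintegral_mul_regInv_min_le (hn : Module.finrank ℝ E = 1) {f : E → ℝ≥0∞}
    (hf : AEMeasurable f) {M : ℝ≥0∞} (hM : ∀ᵐ x, f x ≤ M) {κ : ℝ} (hκ : 0 < κ)
    (hκ' : κ ≤ Real.exp (-1)) (y : E) :
    ∫⁻ x, f x * regInv κ (min ‖x + y‖ 1) ≤
      (1 + 2 * sphereMeasure E Set.univ) * ENNReal.ofReal (Real.log κ⁻¹) *
        ((∫⁻ x, f x) + M) := by
  set σ := sphereMeasure E Set.univ with hσ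
  have hL1 := ofReal_one_le_log_inv hκ hκ'
  set Λ := ENNReal.ofReal (Real.log κ⁻¹) with hΛ
  have hκ1 : κ ≤ 1 := hκ'.trans (Real.exp_le_one_iff.2 (by norm_num))
  set F : ℝ → ℝ≥0∞ := (Set.Icc (0 : ℝ) 1).indicator (regInv κ) with hF
  have hFm : Measurable F := (measurable_regInv κ).indicator measurableSet_Icc
  have h1 : ∀ᵐ x, f x * regInv κ (min ‖x + y‖ 1) ≤ f x + M * F ‖x + y‖ := by
    filter_upwards [hM] with x hx
    rcases le_total ‖x + y‖ 1 with h | h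
    · rw [min_eq_left h, hF, Set.indicator_of_mem (show ‖x + y‖ ∈ Set.Icc (0 : ℝ) 1 from
        ⟨norm_nonneg _, h⟩)]
      exact (mul_le_mul_left hx _).trans le_add_self
    · refine le_trans (mul_le_of_le_one_right' ?_) le_self_add
      refine (regInv_le one_pos ?_).trans ?_
      · rw [min_eq_right h]; exact le_max_right _ _
      · simp
  have h2 : ∫⁻ x : E, F ‖x‖ ≤ 2 * σ * Λ := by
    rw [lintegral_fun_norm_of_finrank_eq_one hn hFm]
    have h3 : ∫⁻ ρ in Set.Ioi (0 : ℝ), F ρ ≤ 2 * Λ := by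
      refine (setLIntegral_le_lintegral _ _).trans ?_
      rw [hF, lintegral_indicator measurableSet_Icc]
      refine (lintegral_Icc_zero_regInv_le hκ hκ1).trans ?_
      rw [one_div, ENNReal.ofReal_add zero_le_one (zero_le_one.trans (one_le_log_inv hκ hκ')),
        ENNReal.ofReal_one, two_mul]
      gcongr
    calc _ ≤ σ * (2 * Λ) := by gcongr
      _ = _ := by ring
  refine (lintegral_mono_ae h1).trans ?_
  rw [lintegral_add_left' hf, lintegral_const_mul _
    (show Measurable fun x : E => F ‖x + y‖ from hFm.comp (by fun_prop)),
    lintegral_add_right_eq_self (fun x : E => F ‖x‖) y]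
  calc _ ≤ (∫⁻ x, f x) * Λ + M * (2 * σ * Λ) := by
        gcongr
        exact le_mul_of_one_le_right' hL1
    _ ≤ (∫⁻ x, f x) * Λ + M * (2 * σ * Λ) + (M * Λ + 2 * σ * Λ * ∫⁻ x, f x) := le_self_add
    _ = _ := by ring

/-- The double integral with bilinear phase in dimension one: each of the two variables contributes
a logarithm. -/
theorem lintegral_lintegral_regInv_le_of_finrank_eq_one (hn : Module.finrank ℝ E = 1) :
    ∃ C : ℝ≥0∞, C ≠ ∞ ∧ ∀ {r S : E → ℝ≥0∞}, AEMeasurable r → AEMeasurable S →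
      ∀ {Mr MS : ℝ≥0∞}, (∀ᵐ x, r x ≤ Mr) → (∀ᵐ x, S x ≤ MS) →
      ∀ {κ : ℝ}, 0 < κ → κ ≤ Real.exp (-1) → ∀ y : E,
      ∫⁻ k, r k * ∫⁻ k', S k' * regInv κ |inner ℝ k' (k + y)| ≤
        C * ENNReal.ofReal (Real.log κ⁻¹) ^ 2 * (((∫⁻ k, S k) + MS) * ((∫⁻ k, r k) + Mr)) := by
  have hσt : sphereMeasure E Set.univ ≠ ∞ := measure_ne_top _ _
  refine ⟨(1 + 2 * sphereMeasure E Set.univ) ^ 2, by finiteness, ?_⟩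
  intro r S hr hS Mr MS hMr hMS κ hκ hκ' y
  have hκ1 : κ ≤ 1 := hκ'.trans (Real.exp_le_one_iff.2 (by norm_num))
  set σ := sphereMeasure E Set.univ with hσ
  set Λ := ENNReal.ofReal (Real.log κ⁻¹) with hΛ
  have h1 : ∀ k, ∫⁻ k', S k' * regInv κ |inner ℝ k' (k + y)| ≤
      (1 + 2 * σ) * Λ * ((∫⁻ k, S k) + MS) * regInv κ (min ‖k + y‖ 1) := by
    intro k
    have h2 := lintegral_mul_regInv_min_le hn hS hMS hκ hκ' 0
    simp only [add_zero] at h2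
    calc _ ≤ ∫⁻ k', S k' * regInv κ (min ‖k'‖ 1) * regInv κ (min ‖k + y‖ 1) := by
          refine lintegral_mono fun k' => ?_
          rw [abs_inner_of_finrank_eq_one hn, mul_assoc]
          exact mul_le_mul_right (regInv_mul_le hκ hκ1 (norm_nonneg _) (norm_nonneg _)) _
      _ = (∫⁻ k', S k' * regInv κ (min ‖k'‖ 1)) * regInv κ (min ‖k + y‖ 1) :=
          lintegral_mul_const' _ _ ENNReal.ofReal_ne_top
      _ ≤ _ := by gcongr
  calc _ ≤ ∫⁻ k, (1 + 2 * σ) * Λ * ((∫⁻ k, S k) + MS) * (r k * regInv κ (min ‖k + y‖ 1)) := by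
        refine lintegral_mono fun k => (mul_le_mul_right (h1 k) _).trans_eq ?_
        ring
    _ = (1 + 2 * σ) * Λ * ((∫⁻ k, S k) + MS) * ∫⁻ k, r k * regInv κ (min ‖k + y‖ 1) := by
        refine lintegral_const_mul'' _ (hr.mul ?_)
        exact ((measurable_regInv κ).comp (by fun_prop)).aemeasurable
    _ ≤ (1 + 2 * σ) * Λ * ((∫⁻ k, S k) + MS) * ((1 + 2 * σ) * Λ * ((∫⁻ k, r k) + Mr)) := by
        gcongr
        exact lintegral_mul_regInv_min_le hn hr hMr hκ hκ' y
    _ = _ := by ring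

/-- The integral with quadratic phase in dimension one, where `|k·(k + y)|` is at least the smaller
one of `|k|²` and `|k + y|²`. -/
theorem lintegral_regInv_inner_add_le_of_finrank_eq_one (hn : Module.finrank ℝ E = 1)
    {r : E → ℝ≥0∞} {M : ℝ≥0∞} (hM : ∀ᵐ x, r x ≤ M) {κ : ℝ} (hκ : 0 < κ) (y : E) :
    ∫⁻ k, r k * regInv κ |inner ℝ k (k + y)| ≤
      2 * sphereMeasure E Set.univ * M * ENNReal.ofReal (2 / √κ) := by
  have hm : Measurable fun t : ℝ => regInv κ (t ^ 2) := (measurable_regInv κ).comp (by fun_prop)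
  have h1 : ∀ᵐ k : E, r k * regInv κ |inner ℝ k (k + y)| ≤
      M * (regInv κ (‖k‖ ^ 2) + regInv κ (‖k + y‖ ^ 2)) := by
    filter_upwards [hM] with k hk
    refine mul_le_mul' hk ?_
    rw [abs_inner_of_finrank_eq_one hn]
    rcases le_total ‖k‖ ‖k + y‖ with h | h
    · refine (regInv_anti_right hκ ?_).trans le_self_add
      rw [sq]
      gcongr
    · refine (regInv_anti_right hκ ?_).trans le_add_self
      rw [sq]
      gcongr
  have hm1 : Measurable fun k : E => regInv κ (‖k‖ ^ 2) := hm.comp measurable_norm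
  have hm2 : Measurable fun k : E => regInv κ (‖k + y‖ ^ 2) :=
    hm1.comp (measurable_add_const y)
  refine (lintegral_mono_ae h1).trans ?_
  rw [lintegral_const_mul _ (show Measurable fun k : E => regInv κ (‖k‖ ^ 2) +
    regInv κ (‖k + y‖ ^ 2) from hm1.add hm2), lintegral_add_left hm1,
    lintegral_add_right_eq_self (fun x : E => regInv κ (‖x‖ ^ 2)) y,
    lintegral_fun_norm_of_finrank_eq_one hn hm]
  have h2 := lintegral_Ioi_regInv_sq_le hκ
  calc _ ≤ M * (sphereMeasure E Set.univ * ENNReal.ofReal (2 / √κ) +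
        sphereMeasure E Set.univ * ENNReal.ofReal (2 / √κ)) := by gcongr
    _ = _ := by ring

/-- The integral with quadratic phase in dimension at least two. In polar coordinates `k = ρ ω` the
phase is `ρ (ρ - a)`, and the weight `‖k‖^(d - 2)` leaves a factor `ρ` of the Jacobian. -/
theorem lintegral_regInv_inner_add_le (hn : 2 ≤ Module.finrank ℝ E) {r : E → ℝ≥0∞}
    (hr : AEMeasurable r) {M : ℝ≥0∞}
    (hM : ∀ᵐ x, ENNReal.ofReal (‖x‖ ^ (Module.finrank ℝ E - 2)) * r x ≤ M) {κ : ℝ} (hκ : 0 < κ)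
    (hκ' : κ ≤ Real.exp (-1)) (y : E) :
    ∫⁻ k, r k * regInv κ |inner ℝ k (k + y)| ≤
      (∫⁻ k, r k) + 20 * sphereMeasure E Set.univ * ENNReal.ofReal (Real.log κ⁻¹) * M := by
  have : Nontrivial E := Module.nontrivial_of_finrank_pos (R := ℝ) (by omega)
  set n := Module.finrank ℝ E with hnd
  set H : ℝ → ℝ≥0∞ := fun t => if t < 1 then regInv κ t else 0 with hH
  have hHm : Measurable H :=
    Measurable.ite (measurableSet_Iio) (measurable_regInv κ) measurable_const
  set G : E → ℝ≥0∞ := fun k => ENNReal.ofReal (1 / ‖k‖ ^ (n - 2)) * H |inner ℝ k (k + y)| with hG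
  have hGm : Measurable G := by
    refine Measurable.mul (by fun_prop) (hHm.comp ?_)
    have : Continuous fun k : E => |inner ℝ k (k + y)| := by fun_prop
    exact this.measurable
  have h1 : ∀ᵐ k : E, r k * regInv κ |inner ℝ k (k + y)| ≤ r k + M * G k := by
    have h0 : ∀ᵐ k : E, k ≠ 0 := by simp [ae_iff, measure_singleton]
    filter_upwards [hM, h0] with k hk hk0
    rcases lt_or_ge |inner ℝ k (k + y)| 1 with h | h
    · have hp : 0 < ‖k‖ ^ (n - 2) := pow_pos (norm_pos_iff.2 hk0) _
      have h2 : r k ≤ M * ENNReal.ofReal (1 / ‖k‖ ^ (n - 2)) := by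
        calc r k = ENNReal.ofReal (‖k‖ ^ (n - 2)) * r k * ENNReal.ofReal (1 / ‖k‖ ^ (n - 2)) := by
              rw [mul_right_comm, ← ENNReal.ofReal_mul hp.le, mul_one_div_cancel hp.ne',
                ENNReal.ofReal_one, one_mul]
          _ ≤ _ := by gcongr
      simp only [hG, hH, if_pos h]
      rw [← mul_assoc]
      exact (mul_le_mul_left h2 _).trans le_add_self
    · refine le_trans (mul_le_of_le_one_right' ?_) le_self_add
      refine (regInv_le one_pos (h.trans (le_max_right _ _))).trans ?_
      simp
  refine (lintegral_mono_ae h1).trans ?_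
  rw [lintegral_add_left' hr, lintegral_const_mul _ hGm]
  have h2 : ∫⁻ k, G k ≤ sphereMeasure E Set.univ * (20 * ENNReal.ofReal (Real.log κ⁻¹)) := by
    rw [lintegral_polar hGm, mul_comm, ← lintegral_const]
    refine lintegral_mono fun ω => ?_
    refine le_trans (setLIntegral_mono' measurableSet_Ioi fun ρ hρ => ?_)
      (lintegral_Ioi_quadratic_le hκ hκ' (-inner ℝ (ω : E) y))
    have hρ : 0 < ρ := hρ
    have h3 : |inner ℝ (ρ • (ω : E)) (ρ • (ω : E) + y)| = ρ * |ρ - -inner ℝ (ω : E) y| := by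
      rw [inner_add_right, real_inner_smul_left, real_inner_smul_left, real_inner_smul_right,
        real_inner_self_eq_norm_sq, norm_eq_of_mem_sphere, ← mul_add, abs_mul, abs_of_pos hρ]
      ring_nf
    have h4 : ‖ρ • (ω : E)‖ = ρ := by
      rw [norm_smul, norm_eq_of_mem_sphere, Real.norm_of_nonneg hρ.le, mul_one]
    simp only [hG, hH, h3, h4]
    rw [← mul_assoc, ← ENNReal.ofReal_mul (by positivity)]
    refine mul_le_mul_left (ENNReal.ofReal_le_ofReal (le_of_eq ?_)) _
    have h5 : n - 1 = (n - 2) + 1 := by omega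
    rw [← hnd, h5, pow_succ]
    field_simp
  refine add_le_add le_rfl ?_
  calc _ ≤ M * (sphereMeasure E Set.univ * (20 * ENNReal.ofReal (Real.log κ⁻¹))) := by gcongr
    _ = _ := by ring

end QuadraticPhase

/-! ### The power spectrum -/

section PowerSpectrum

open scoped FourierTransform

variable {d : ℕ} {R S : Lateral d → ℝ}

theorem fourier_ofReal_apply (R : Lateral d → ℝ) (w : Lateral d) :
    𝓕 (fun x => (R x : ℂ)) w =
      ∫ x, Complex.exp (-Complex.I * (inner ℝ ((2 * Real.pi) • w) x : ℝ)) * (R x : ℂ) := by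
  rw [Real.fourier_eq']
  refine integral_congr_ae (Eventually.of_forall fun x => ?_)
  simp only [smul_eq_mul, real_inner_smul_left, real_inner_comm x w]
  congr 2
  push_cast
  ring

theorem powerSpectrum_eq_re_fourier (R : Lateral d → ℝ) (w : Lateral d) :
    powerSpectrum R ((2 * Real.pi) • w) = (𝓕 (fun x => (R x : ℂ)) w).re := by
  rw [fourier_ofReal_apply, powerSpectrum]

theorem continuous_powerSpectrum (hR : Integrable R) : Continuous (powerSpectrum R) := by
  have h1 : Continuous (𝓕 (fun x => (R x : ℂ))) :=
    VectorFourier.fourierIntegral_continuous Real.continuous_fourierChar continuous_inner hR.ofReal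
  have h2 : powerSpectrum R = fun ξ => (𝓕 (fun x => (R x : ℂ)) ((2 * Real.pi)⁻¹ • ξ)).re := by
    funext ξ
    rw [← powerSpectrum_eq_re_fourier, smul_inv_smul₀ (by positivity)]
  rw [h2]
  fun_prop

theorem powerSpectrum_le_integral_norm (R : Lateral d → ℝ) (ξ : Lateral d) :
    powerSpectrum R ξ ≤ ∫ x, ‖R x‖ := by
  refine (Complex.re_le_norm _).trans ((norm_integral_le_integral_norm _).trans_eq ?_)
  refine integral_congr_ae (Eventually.of_forall fun x => ?_)
  simp only [norm_mul, Complex.norm_real]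
  rw [neg_mul, ← mul_neg, ← Complex.ofReal_neg, mul_comm Complex.I, Complex.norm_exp_ofReal_mul_I,
    one_mul]

theorem fourier_eq_powerSpectrum (he : ∀ x, R (-x) = R x) (w : Lateral d) :
    𝓕 (fun x => (R x : ℂ)) w = (powerSpectrum R ((2 * Real.pi) • w) : ℂ) := by
  rw [powerSpectrum_eq_re_fourier, eq_comm, ← Complex.conj_eq_iff_re]
  rw [Real.fourier_eq', ← integral_conj, ← integral_neg_eq_self]
  refine integral_congr_ae (Eventually.of_forall fun x => ?_)
  simp only [smul_eq_mul, map_mul, Complex.conj_ofReal, ← Complex.exp_conj, Complex.conj_I,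
    inner_neg_left, he]
  congr 2
  push_cast
  ring

namespace IsAdmissibleCovariance

theorem continuous_powerSpectrum (h : IsAdmissibleCovariance R S) : Continuous (powerSpectrum R) :=
  ItoSchrodinger.continuous_powerSpectrum h.integrable

theorem integrable_powerSpectrum (h : IsAdmissibleCovariance R S) : Integrable (powerSpectrum R) :=
  h.majorant_integrable.mono' h.continuous_powerSpectrum.aestronglyMeasurable <| by
    filter_upwards [h.powerSpectrum_le_majorant] with ξ hξ
    rwa [Real.norm_of_nonneg (h.powerSpectrum_nonneg ξ)]

/-- Fourier inversion at the origin, where `R` is continuous. -/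
theorem integral_powerSpectrum (h : IsAdmissibleCovariance R S) :
    ∫ ξ, powerSpectrum R ξ = (2 * Real.pi) ^ d * R 0 := by
  have h2 : (0 : ℝ) < 2 * Real.pi := by positivity
  have h0 : 𝓕 (fun x => (R x : ℂ)) = fun w => (powerSpectrum R ((2 * Real.pi) • w) : ℂ) :=
    funext (fourier_eq_powerSpectrum h.even)
  have h1 : Integrable (𝓕 (fun x => (R x : ℂ))) := by
    rw [h0]
    exact ((integrable_comp_smul_iff volume _ h2.ne').2 h.integrable_powerSpectrum).ofReal
  have h3 := h.integrable.ofReal.fourierInv_fourier_eq h1 (v := (0 : Lateral d))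
    (Complex.continuous_ofReal.continuousAt.comp h.continuousAt_zero)
  rw [Real.fourierInv_eq', h0] at h3
  simp only [inner_zero_right, mul_zero, Complex.ofReal_zero, zero_mul, Complex.exp_zero,
    one_smul] at h3
  rw [integral_complex_ofReal] at h3
  have h4 : ∫ w, powerSpectrum R ((2 * Real.pi) • w) = R 0 := by exact_mod_cast h3
  rw [Measure.integral_comp_smul, finrank_euclideanSpace_fin, abs_of_pos (by positivity),
    smul_eq_mul, inv_mul_eq_iff_eq_mul₀ (by positivity)] at h4
  exact h4

theorem apply_zero_nonneg (h : IsAdmissibleCovariance R S) : 0 ≤ R 0 := by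
  have h1 : 0 ≤ ∫ ξ, powerSpectrum R ξ := integral_nonneg h.powerSpectrum_nonneg
  rw [h.integral_powerSpectrum] at h1
  exact nonneg_of_mul_nonneg_right h1 (by positivity)

/-- A radial majorant of the power spectrum may be truncated at `∫ |R|`, which bounds the power
spectrum; the truncated majorant is bounded. -/
theorem truncate_majorant (h : IsAdmissibleCovariance R S) :
    IsAdmissibleCovariance R fun ξ => min (S ξ) (∫ x, ‖R x‖) where
  even := h.even
  integrable := h.integrable
  bounded := h.bounded
  continuousAt_zero := h.continuousAt_zero
  powerSpectrum_nonneg := h.powerSpectrum_nonneg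
  majorant_radial ξ ξ' hξ := by rw [h.majorant_radial ξ ξ' hξ]
  majorant_integrable := by
    refine h.majorant_integrable.mono (h.majorant_integrable.1.inf aestronglyMeasurable_const) ?_
    filter_upwards [h.powerSpectrum_le_majorant] with ξ hξ
    have h0 : 0 ≤ S ξ := (h.powerSpectrum_nonneg ξ).trans hξ
    have h1 : 0 ≤ ∫ x, ‖R x‖ := integral_nonneg fun _ => norm_nonneg _
    rw [Real.norm_of_nonneg (le_min h0 h1), Real.norm_of_nonneg h0]
    exact min_le_left _ _
  powerSpectrum_le_majorant := by
    filter_upwards [h.powerSpectrum_le_majorant] with ξ hξ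
    exact le_min hξ (powerSpectrum_le_integral_norm R ξ)
  weighted_bounded := h.weighted_bounded

theorem memLp_truncate_majorant (h : IsAdmissibleCovariance R S) :
    MemLp (fun ξ => min (S ξ) (∫ x, ‖R x‖)) ∞ := by
  refine memLp_top_of_bound h.truncate_majorant.majorant_integrable.1 (∫ x, ‖R x‖) ?_
  filter_upwards [h.powerSpectrum_le_majorant] with ξ hξ
  have h0 : 0 ≤ S ξ := (h.powerSpectrum_nonneg ξ).trans hξ
  have h1 : 0 ≤ ∫ x, ‖R x‖ := integral_nonneg fun _ => norm_nonneg _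
  rw [Real.norm_of_nonneg (le_min h0 h1)]
  exact min_le_right _ _

end IsAdmissibleCovariance

end PowerSpectrum

/-! ### The transfer operators as phase kernels -/

section TransferKernels

variable {d p q : ℕ} {R S : Lateral d → ℝ}

theorem thetaForm_blockShift (lam : Fin p ⊕ Fin q → ℝ) (k : Lateral d) (v : DualVar d p q) :
    thetaForm (blockShift lam k) v = inner ℝ k
      (∑ j, lam (Sum.inl j) • v (Sum.inl j) - ∑ l, lam (Sum.inr l) • v (Sum.inr l)) := by
  simp only [thetaForm, blockShift, inner_sub_right, inner_sum, real_inner_smul_left,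
    real_inner_smul_right]

theorem thetaForm_blockShift_colA (γ : Fin p × Fin q) (k : Lateral d) (v : DualVar d p q) :
    thetaForm (blockShift (colA γ) k) v =
      inner ℝ k (v (Sum.inl γ.1) - v (Sum.inr γ.2)) := by
  rw [thetaForm_blockShift]
  simp [colA, Pi.single_apply, ite_smul]

theorem thetaForm_blockShift_colB_inl (j j' : Fin p) (k : Lateral d) (v : DualVar d p q) :
    thetaForm (blockShift (colB (Sum.inl j) (Sum.inl j')) k) v =
      inner ℝ k (v (Sum.inl j) - v (Sum.inl j')) := by
  rw [thetaForm_blockShift]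
  simp [colB, Pi.single_apply, ite_smul, sub_smul]

theorem thetaForm_blockShift_colB_inr (l l' : Fin q) (k : Lateral d) (v : DualVar d p q) :
    thetaForm (blockShift (colB (Sum.inr l) (Sum.inr l')) k) v =
      -inner ℝ k (v (Sum.inr l) - v (Sum.inr l')) := by
  rw [thetaForm_blockShift]
  rw [← inner_neg_right]
  simp [colB, Pi.single_apply, ite_smul, sub_smul]

/-- The phase kernel of the operators `transferOp`; the phase is the coefficient of `z` in the
exponent. -/
def transferKernel (h : IsAdmissibleCovariance R S) (k₀ ε η : ℝ) (lam : Fin p ⊕ Fin q → ℝ) :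
    PhaseKernel (Lateral d) (DualVar d p q) volume where
  weight := powerSpectrum R
  shift kv := kv.2 + blockShift lam kv.1
  phase kv := η / (2 * k₀ * ε) *
    (2 * thetaForm (blockShift lam kv.1) (kv.2 + blockShift lam kv.1)
      - thetaForm (blockShift lam kv.1) (blockShift lam kv.1))
  integrable_weight := h.integrable_powerSpectrum
  measurable_weight := h.continuous_powerSpectrum.measurable
  measurable_shift := by
    unfold blockShift
    fun_prop
  measurable_phase := by
    unfold blockShift thetaForm
    fun_prop

/-- The prefactor `k₀² / (4 η²) / (2π)^d` of the operators `transferOp`. -/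
def prefactor (d : ℕ) (k₀ η : ℝ) : ℝ := k₀ ^ 2 / (4 * η ^ 2) / (2 * Real.pi) ^ d

theorem prefactor_nonneg (d : ℕ) (k₀ η : ℝ) : 0 ≤ prefactor d k₀ η := by
  unfold prefactor; positivity

theorem transferOp_eq (h : IsAdmissibleCovariance R S) (k₀ ε η : ℝ) (lam : Fin p ⊕ Fin q → ℝ)
    (z : ℝ) (ρ : Meas d p q) :
    transferOp k₀ R ε η lam z ρ =
      ((prefactor d k₀ η : ℂ) • (transferKernel h k₀ ε η lam).op (phaseExp z)) ρ := by
  rw [smul_apply, ← real_smul_eq, PhaseKernel.op_apply]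
  unfold transferOp prefactor
  congr 2
  refine congrArg (fun g => VectorMeasure.withDensity _ g _) (funext fun kv => ?_)
  rw [phaseExp_apply]
  congr 3
  simp only [transferKernel]
  ring

/-- The phase of a jump of the pair `γ` is linear in the jump, as `Aᵗ Θ A = 0`. -/
theorem transferKernel_phase_colA (h : IsAdmissibleCovariance R S) (k₀ ε η : ℝ)
    (γ : Fin p × Fin q) (k : Lateral d) (w : DualVar d p q) :
    (transferKernel h k₀ ε η (colA γ)).phase (k, w) =
      inner ℝ k (w (Sum.inl γ.1) - w (Sum.inr γ.2)) / (k₀ * ε / η) := by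
  simp only [transferKernel, thetaForm_blockShift_colA]
  have h1 : blockShift (colA γ) k (Sum.inl γ.1) = k := by simp [blockShift, colA]
  have h2 : blockShift (colA γ) k (Sum.inr γ.2) = k := by simp [blockShift, colA]
  rw [Pi.add_apply, Pi.add_apply, h1, h2, sub_self, inner_zero_right, add_sub_add_right_eq_sub,
    sub_zero, div_div_eq_mul_div, mul_assoc 2 k₀, mul_comm 2 (k₀ * ε), ← div_div]
  ring

theorem transferKernel_phase_colB_inl (h : IsAdmissibleCovariance R S) (k₀ ε η : ℝ)
    {j j' : Fin p} (hj : j ≠ j') (k : Lateral d) (w : DualVar d p q) :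
    (transferKernel h k₀ ε η (colB (Sum.inl j) (Sum.inl j'))).phase (k, w) =
      inner ℝ k (k + (w (Sum.inl j) - w (Sum.inl j'))) / (k₀ * ε / η) := by
  simp only [transferKernel, thetaForm_blockShift_colB_inl]
  have h1 : blockShift (colB (q := q) (Sum.inl j) (Sum.inl j')) k (Sum.inl j) = k := by
    simp [blockShift, colB, hj]
  have h2 : blockShift (colB (q := q) (Sum.inl j) (Sum.inl j')) k (Sum.inl j') = -k := by
    simp [blockShift, colB, hj.symm]
  rw [Pi.add_apply, Pi.add_apply, h1, h2]
  simp only [inner_add_right, inner_sub_right, inner_neg_right]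
  rw [div_div_eq_mul_div, mul_assoc 2 k₀, mul_comm 2 (k₀ * ε), ← div_div]
  ring

theorem transferKernel_phase_colB_inr (h : IsAdmissibleCovariance R S) (k₀ ε η : ℝ)
    {l l' : Fin q} (hl : l ≠ l') (k : Lateral d) (w : DualVar d p q) :
    (transferKernel h k₀ ε η (colB (Sum.inr l) (Sum.inr l'))).phase (k, w) =
      -inner ℝ k (k + (w (Sum.inr l) - w (Sum.inr l'))) / (k₀ * ε / η) := by
  simp only [transferKernel, thetaForm_blockShift_colB_inr]
  have h1 : blockShift (colB (p := p) (Sum.inr l) (Sum.inr l')) k (Sum.inr l) = k := by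
    simp [blockShift, colB, hl]
  have h2 : blockShift (colB (p := p) (Sum.inr l) (Sum.inr l')) k (Sum.inr l') = -k := by
    simp [blockShift, colB, hl.symm]
  rw [Pi.add_apply, Pi.add_apply, h1, h2]
  simp only [inner_add_right, inner_sub_right, inner_neg_right]
  rw [div_div_eq_mul_div, mul_assoc 2 k₀, mul_comm 2 (k₀ * ε), ← div_div]
  ring

/-- The jumps of pairs that differ in both components act on disjoint blocks of variables. -/
theorem commute_transferKernel (h : IsAdmissibleCovariance R S) (k₀ ε η : ℝ)
    {γ γ' : Fin p × Fin q} (h1 : γ.1 ≠ γ'.1) (h2 : γ.2 ≠ γ'.2)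
    (g g' : BoundedContinuousFunction ℝ ℂ) :
    Commute ((transferKernel h k₀ ε η (colA γ)).op g)
      ((transferKernel h k₀ ε η (colA γ')).op g') := by
  have key : ∀ {γ γ' : Fin p × Fin q}, γ.1 ≠ γ'.1 → γ.2 ≠ γ'.2 → ∀ (k k' : Lateral d)
      (w : DualVar d p q), (transferKernel h k₀ ε η (colA γ)).phase
        (k, w + blockShift (colA γ') k') = (transferKernel h k₀ ε η (colA γ)).phase (k, w) := by
    intro γ γ' h1 h2 k k' w
    rw [transferKernel_phase_colA, transferKernel_phase_colA]
    simp [blockShift, colA, h1, h2]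
  refine PhaseKernel.commute_op _ _ (fun k k' w => ?_) (fun k k' w => key h1 h2 k k' w)
    (fun k k' w => key h1.symm h2.symm k' k w) g g'
  exact add_right_comm _ _ _

end TransferKernels

/-! ### The generators -/

section Generators

variable {d p q : ℕ} {R S : Lateral d → ℝ}

/-- The operator `transferOp` as a bounded operator. -/
def transferCLM (h : IsAdmissibleCovariance R S) (k₀ ε η : ℝ) (lam : Fin p ⊕ Fin q → ℝ) (z : ℝ) :
    Meas d p q →L[ℂ] Meas d p q :=
  (prefactor d k₀ η : ℂ) • (transferKernel h k₀ ε η lam).op (phaseExp z)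

/-- The strong antiderivative of `transferCLM` that vanishes at `z = 0`. -/
def transferInt (h : IsAdmissibleCovariance R S) (k₀ ε η : ℝ) (lam : Fin p ⊕ Fin q → ℝ) (z : ℝ) :
    Meas d p q →L[ℂ] Meas d p q :=
  (prefactor d k₀ η : ℂ) • (transferKernel h k₀ ε η lam).op (phaseInt z)

variable (h : IsAdmissibleCovariance R S) (k₀ ε η : ℝ)

theorem strongCont_transferCLM (lam : Fin p ⊕ Fin q → ℝ) :
    StrongCont (transferCLM h k₀ ε η lam) :=
  fun ρ => ((transferKernel h k₀ ε η lam).strongCont_op ρ).const_smul (prefactor d k₀ η : ℂ)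

theorem strongDeriv_transferInt (lam : Fin p ⊕ Fin q → ℝ) :
    StrongDeriv (transferInt h k₀ ε η lam) (transferCLM h k₀ ε η lam) :=
  fun ρ z => ((transferKernel h k₀ ε η lam).strongDeriv_op ρ z).const_smul (prefactor d k₀ η : ℂ)

/-- The mass of the power spectrum is `(2π)^d R(0)`, which makes `C₀ / η²` the bound of each
generator. -/
theorem norm_transferCLM_le (lam : Fin p ⊕ Fin q → ℝ) (z : ℝ) :
    ‖transferCLM h k₀ ε η lam z‖ ≤ dampC k₀ R / η ^ 2 := by
  have h1 : ‖(transferKernel h k₀ ε η lam).op (phaseExp z)‖ ≤ (2 * Real.pi) ^ d * R 0 := by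
    have h2 : ‖phaseExp z‖ ≤ 1 :=
      (BoundedContinuousFunction.norm_le zero_le_one).2 fun x => (norm_phaseExp_apply z x).le
    have h3 : ∫ k, ‖(transferKernel h k₀ ε η lam).weight k‖ = (2 * Real.pi) ^ d * R 0 := by
      rw [← h.integral_powerSpectrum]
      exact integral_congr_ae (Eventually.of_forall fun k =>
        Real.norm_of_nonneg (h.powerSpectrum_nonneg k))
    refine ((transferKernel h k₀ ε η lam).norm_op_le _).trans ?_
    rw [h3]
    exact mul_le_of_le_one_left (mul_nonneg (by positivity) h.apply_zero_nonneg) h2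
  rw [transferCLM, norm_smul, Complex.norm_real, Real.norm_of_nonneg (prefactor_nonneg _ _ _)]
  refine (mul_le_mul_of_nonneg_left h1 (prefactor_nonneg _ _ _)).trans_eq ?_
  rw [prefactor, dampC, ← mul_assoc, div_mul_cancel₀ _ (by positivity)]
  ring

theorem dampC_div_nonneg (h : IsAdmissibleCovariance R S) : 0 ≤ dampC k₀ R / η ^ 2 :=
  div_nonneg (mul_nonneg (by positivity) h.apply_zero_nonneg) (sq_nonneg _)

theorem exists_pairSolution (γ : Fin p × Fin q) :
    ∃ U : ℝ → Meas d p q →L[ℂ] Meas d p q, U 0 = 1 ∧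
      StrongDeriv U fun z => transferCLM h k₀ ε η (colA γ) z * U z := by
  obtain ⟨U, h1, h2, -⟩ := exists_solutionOperator (strongCont_transferCLM h k₀ ε η (colA γ))
    (norm_transferCLM_le h k₀ ε η (colA γ))
  exact ⟨U, h1, h2⟩

/-- The generators `L¹_γ` and their solution operators, for all pairs `γ`. -/
def pairSystem : PairSystem p q ℂ (Meas d p q) where
  L γ := transferCLM h k₀ ε η (colA γ)
  V γ := (exists_pairSolution h k₀ ε η γ).choose
  κ := dampC k₀ R / η ^ 2
  norm_L γ := norm_transferCLM_le h k₀ ε η (colA γ)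
  strongCont_L γ := strongCont_transferCLM h k₀ ε η (colA γ)
  commute_L _ _ h1 h2 _ _ :=
    ((commute_transferKernel h k₀ ε η h1 h2 _ _).smul_left _).smul_right _
  V_zero γ := (exists_pairSolution h k₀ ε η γ).choose_spec.1
  deriv_V γ := (exists_pairSolution h k₀ ε η γ).choose_spec.2

/-- The pairs of different indices of the same kind, in increasing order. -/
def samePairs (n : ℕ) : Finset (Fin n × Fin n) := Finset.univ.filter fun jj => jj.1 < jj.2

/-- For a family of operators indexed by the columns `lam`, minus the sum over the columns of the
matrices `B`. -/
def negSumB (T : (Fin p ⊕ Fin q → ℝ) → ℝ → Meas d p q →L[ℂ] Meas d p q) (z : ℝ) :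
    Meas d p q →L[ℂ] Meas d p q :=
  -(∑ jj ∈ samePairs p, T (colB (Sum.inl jj.1) (Sum.inl jj.2)) z +
    ∑ ll ∈ samePairs q, T (colB (Sum.inr ll.1) (Sum.inr ll.2)) z)

theorem strongCont_sum {ι : Type*} (s : Finset ι) {A : ι → ℝ → Meas d p q →L[ℂ] Meas d p q}
    (hA : ∀ i ∈ s, StrongCont (A i)) : StrongCont fun z => ∑ i ∈ s, A i z := fun ρ => by
  simp only [sum_apply]
  exact continuous_finsetSum s fun i hi => hA i hi ρ

theorem strongCont_negSumB {T : (Fin p ⊕ Fin q → ℝ) → ℝ → Meas d p q →L[ℂ] Meas d p q}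
    (hT : ∀ lam, StrongCont (T lam)) : StrongCont (negSumB T) := fun ρ =>
  (((strongCont_sum _ fun _ _ => hT _).add (strongCont_sum _ fun _ _ => hT _)) ρ).neg

theorem strongDeriv_negSumB {T T' : (Fin p ⊕ Fin q → ℝ) → ℝ → Meas d p q →L[ℂ] Meas d p q}
    (hT : ∀ lam, StrongDeriv (T lam) (T' lam)) : StrongDeriv (negSumB T) (negSumB T') :=
  fun ρ z => (((StrongDeriv.sum fun _ _ => hT _).add (StrongDeriv.sum fun _ _ => hT _)) ρ z).neg

theorem two_mul_card_samePairs (n : ℕ) : 2 * (samePairs n).card + n = n * n := by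
  have h1 : (samePairs n).card = ∑ j : Fin n, (j : ℕ) := by
    have : samePairs n = ((Finset.univ : Finset (Fin n)).sigma fun j => Finset.Iio j).map
        ⟨fun x => (x.2, x.1), fun x y h => by
          obtain ⟨x1, x2⟩ := x
          obtain ⟨y1, y2⟩ := y
          simp only [Prod.mk.injEq] at h
          rw [h.1, h.2]⟩ := by
      ext ⟨a, b⟩
      simp only [samePairs, Finset.mem_filter_univ, Finset.mem_map, Finset.mem_sigma,
        Finset.mem_univ, Finset.mem_Iio, true_and]
      constructor
      · exact fun hab => ⟨⟨b, a⟩, hab, rfl⟩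
      · rintro ⟨⟨b', a'⟩, hab, he⟩
        obtain ⟨rfl, rfl⟩ := Prod.mk.inj he
        exact hab
    rw [this, Finset.card_map, Finset.card_sigma]
    simp
  rw [h1, Fin.sum_univ_eq_sum_range (fun i => i) n, mul_comm 2, Finset.sum_range_id_mul_two]
  cases n with
  | zero => rfl
  | succ n => rw [Nat.add_sub_cancel]; ring

theorem norm_negSumB_le {T : (Fin p ⊕ Fin q → ℝ) → ℝ → Meas d p q →L[ℂ] Meas d p q} {z b : ℝ}
    (h1 : ∀ j j' : Fin p, j < j' → ‖T (colB (Sum.inl j) (Sum.inl j')) z‖ ≤ b)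
    (h2 : ∀ l l' : Fin q, l < l' → ‖T (colB (Sum.inr l) (Sum.inr l')) z‖ ≤ b) :
    ‖negSumB T z‖ ≤ ((samePairs p).card + (samePairs q).card) * b := by
  rw [negSumB, norm_neg, add_mul]
  refine (norm_add_le _ _).trans (add_le_add ?_ ?_)
  · refine (norm_sum_le_of_le _ (n := fun _ => b) fun jj hj =>
      h1 _ _ (Finset.mem_filter.1 hj).2).trans_eq ?_
    rw [Finset.sum_const, nsmul_eq_mul]
    rfl
  · refine (norm_sum_le_of_le _ (n := fun _ => b) fun jj hj =>
      h2 _ _ (Finset.mem_filter.1 hj).2).trans_eq ?_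
    rw [Finset.sum_const, nsmul_eq_mul]
    rfl

/-- The generator `L²` as a bounded operator. -/
def kindCLM (z : ℝ) : Meas d p q →L[ℂ] Meas d p q := negSumB (transferCLM h k₀ ε η) z

/-- The generator `L^ε_{p,q}` as a bounded operator. -/
def genCLM (z : ℝ) : Meas d p q →L[ℂ] Meas d p q :=
  (pairSystem h k₀ ε η).fullGen (kindCLM h k₀ ε η) z

theorem opL1_eq (γ : Fin p × Fin q) (z : ℝ) (ρ : Meas d p q) :
    opL1 k₀ R ε η γ z ρ = (pairSystem h k₀ ε η).L γ z ρ :=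
  transferOp_eq h k₀ ε η (colA γ) z ρ

theorem opL2Sum_eq (z : ℝ) (ρ : Meas d p q) :
    opL2Sum k₀ R ε η z ρ = kindCLM h k₀ ε η z ρ := by
  simp only [opL2Sum, opL2, kindCLM, negSumB, neg_apply, add_apply, sum_apply,
    transferOp_eq h, Finset.sum_neg_distrib, neg_add]
  rfl

theorem generator_eq (z : ℝ) (ρ : Meas d p q) :
    generator k₀ R ε η z ρ = genCLM h k₀ ε η z ρ := by
  simp only [generator, genCLM, PairSystem.fullGen, add_apply, sum_apply,
    opL2Sum_eq h, opL1_eq h, smul_apply]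
  congr 3
  rw [mul_neg]
  rfl

theorem norm_genCLM_le (z : ℝ) :
    ‖(genCLM h k₀ ε η z : Meas d p q →L[ℂ] Meas d p q)‖ ≤
      ((p + q : ℕ) : ℝ) ^ 2 / 2 * (dampC k₀ R / η ^ 2) := by
  have hκ := dampC_div_nonneg k₀ η h
  set κ := dampC k₀ R / η ^ 2 with hκd
  have h1 : ‖-(((p + q : ℕ) : ℝ) / 2 * κ) • (1 : Meas d p q →L[ℂ] Meas d p q)‖ ≤
      ((p + q : ℕ) : ℝ) / 2 * κ := by
    rw [norm_smul, norm_neg, Real.norm_of_nonneg (by positivity)]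
    exact mul_le_of_le_one_right (by positivity) ContinuousLinearMap.norm_id_le
  have h2 : ‖∑ γ : Fin p × Fin q, transferCLM (d := d) h k₀ ε η (colA γ) z‖ ≤ p * q * κ := by
    refine (norm_sum_le_of_le _ (n := fun _ => κ) fun γ _ =>
      norm_transferCLM_le h k₀ ε η (colA γ) z).trans_eq ?_
    simp
  have h3 : ‖(kindCLM h k₀ ε η z : Meas d p q →L[ℂ] Meas d p q)‖ ≤
      ((samePairs p).card + (samePairs q).card) * κ :=
    norm_negSumB_le (fun _ _ _ => norm_transferCLM_le h k₀ ε η _ z)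
      fun _ _ _ => norm_transferCLM_le h k₀ ε η _ z
  have h4 : ‖(genCLM h k₀ ε η z : Meas d p q →L[ℂ] Meas d p q)‖ ≤
      ((p + q : ℕ) : ℝ) / 2 * κ + p * q * κ + ((samePairs p).card + (samePairs q).card) * κ :=
    (norm_add_le _ _).trans (add_le_add ((norm_add_le _ _).trans (add_le_add h1 h2)) h3)
  refine h4.trans_eq ?_
  -- the coefficients sum up to `(p + q) / 2 + p q + p (p - 1) / 2 + q (q - 1) / 2 = (p + q)² / 2`
  have h5 : 2 * ((samePairs p).card : ℝ) + p = p * p := by exact_mod_cast two_mul_card_samePairs p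
  have h6 : 2 * ((samePairs q).card : ℝ) + q = q * q := by exact_mod_cast two_mul_card_samePairs q
  have h7 : ((samePairs p).card : ℝ) = (p * p - p) / 2 := by linarith
  have h8 : ((samePairs q).card : ℝ) = (q * q - q) / 2 := by linarith
  rw [h7, h8]
  push_cast
  ring

theorem strongCont_genCLM : StrongCont (genCLM (p := p) (q := q) h k₀ ε η) :=
  ((strongCont_const _).add (strongCont_sum _ fun γ _ =>
    strongCont_transferCLM h k₀ ε η (colA γ))).add (strongCont_negSumB fun lam =>
      strongCont_transferCLM h k₀ ε η lam)

/-! ### Oscillatory integrals of the generators -/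

theorem enorm_phaseInt_sub_le {a b x T δ : ℝ} (hT : 0 < T) (hδ : 0 < δ) (hab : |b - a| ≤ T) :
    ‖(phaseInt b - phaseInt a) (x / δ)‖ₑ ≤ ENNReal.ofReal (2 * δ) * regInv (δ / T) |x| := by
  rw [← ofReal_norm, regInv, ← ENNReal.ofReal_mul (by positivity), mul_one_div]
  exact ENNReal.ofReal_le_ofReal (norm_phaseInt_sub_le_div_max hT hδ hab)

/-- If `γ` and `γ'` share exactly one component, then the phase of the jump `k'` of `γ'` after the
jump `k` of `γ` is, up to sign and scaling, `k'·(k + y)`. -/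
theorem exists_transferKernel_phase_shift {γ γ' : Fin p × Fin q} (hne : γ' ≠ γ)
    (hs : γ'.1 = γ.1 ∨ γ'.2 = γ.2) (w : DualVar d p q) :
    ∃ y : Lateral d, ∀ k k', ∃ x : ℝ, |x| = |inner ℝ k' (k + y)| ∧
      (transferKernel h k₀ ε η (colA γ')).phase
        (k', (transferKernel h k₀ ε η (colA γ)).shift (k, w)) = x / (k₀ * ε / η) := by
  have key : ∀ k k', (transferKernel h k₀ ε η (colA γ')).phase
      (k', (transferKernel h k₀ ε η (colA γ)).shift (k, w)) =
      inner ℝ k' ((w + blockShift (colA γ) k) (Sum.inl γ'.1) -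
        (w + blockShift (colA γ) k) (Sum.inr γ'.2)) / (k₀ * ε / η) :=
    fun k k' => transferKernel_phase_colA h k₀ ε η γ' k' _
  rcases hs with hs | hs
  · have h2 : γ.2 ≠ γ'.2 := fun h2 => hne (Prod.ext hs h2.symm)
    refine ⟨w (Sum.inl γ'.1) - w (Sum.inr γ'.2), fun k k' => ⟨_, ?_, key k k'⟩⟩
    have h3 : (w + blockShift (colA γ) k) (Sum.inl γ'.1) = w (Sum.inl γ'.1) + k := by
      simp [blockShift, colA, hs]
    have h4 : (w + blockShift (colA γ) k) (Sum.inr γ'.2) = w (Sum.inr γ'.2) := by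
      simp [blockShift, colA, h2]
    rw [h3, h4]
    congr 2
    abel
  · have h2 : γ.1 ≠ γ'.1 := fun h2 => hne (Prod.ext h2.symm hs)
    refine ⟨w (Sum.inr γ'.2) - w (Sum.inl γ'.1), fun k k' => ⟨_, ?_, key k k'⟩⟩
    have h3 : (w + blockShift (colA γ) k) (Sum.inl γ'.1) = w (Sum.inl γ'.1) := by
      simp [blockShift, colA, h2]
    have h4 : (w + blockShift (colA γ) k) (Sum.inr γ'.2) = w (Sum.inr γ'.2) + k := by
      simp [blockShift, colA, hs]
    rw [h3, h4, ← abs_neg, ← inner_neg_right]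
    congr 2
    abel

/-- The integral over an interval of the generator of `γ'`, applied after the generator of a pair
`γ` sharing one component with `γ'`, is small: the phase of the second jump depends on the first
one. -/
theorem norm_transferInt_sub_mul_le {k₀ ε η : ℝ} (hδ : 0 < k₀ * ε / η) {γ γ' : Fin p × Fin q}
    (hne : γ' ≠ γ) (hs : γ'.1 = γ.1 ∨ γ'.2 = γ.2) {T D : ℝ} (hT : 0 < T) (hD : 0 ≤ D)
    (hb : ∀ y : Lateral d, ∫⁻ k, ‖powerSpectrum R k‖ₑ * ∫⁻ k', ‖powerSpectrum R k'‖ₑ *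
      regInv (k₀ * ε / η / T) |inner ℝ k' (k + y)| ≤ ENNReal.ofReal D) {a b : ℝ}
    (hab : |b - a| ≤ T) :
    ‖(transferInt h k₀ ε η (colA γ') b - transferInt h k₀ ε η (colA γ') a) *
      transferCLM h k₀ ε η (colA γ) a‖ ≤
        prefactor d k₀ η ^ 2 * (2 * (k₀ * ε / η) * D) := by
  set δ := k₀ * ε / η with hδd
  have h1 : (transferInt h k₀ ε η (colA γ') b - transferInt h k₀ ε η (colA γ') a) *
      transferCLM h k₀ ε η (colA γ) a = ((prefactor d k₀ η : ℂ) * (prefactor d k₀ η : ℂ)) •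
        ((transferKernel h k₀ ε η (colA γ')).op (phaseInt b - phaseInt a) *
          (transferKernel h k₀ ε η (colA γ)).op (phaseExp a)) := by
    have h2 : transferInt h k₀ ε η (colA γ') b - transferInt h k₀ ε η (colA γ') a =
        (prefactor d k₀ η : ℂ) •
          (transferKernel h k₀ ε η (colA γ')).op (phaseInt b - phaseInt a) := by
      rw [map_sub]
      exact (smul_sub _ _ _).symm
    rw [h2, transferCLM, smul_mul_smul_comm]
  rw [h1, norm_smul, norm_mul, Complex.norm_real, Real.norm_of_nonneg (prefactor_nonneg _ _ _),
    ← sq]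
  refine mul_le_mul_of_nonneg_left ?_ (sq_nonneg _)
  refine PhaseKernel.norm_op_mul_op_le _ _ _ _ (fun x => (norm_phaseExp_apply a x).le)
    (by positivity) fun w => ?_
  obtain ⟨y, hy⟩ := exists_transferKernel_phase_shift h k₀ ε η hne hs w
  calc _ ≤ ∫⁻ k, ‖powerSpectrum R k‖ₑ * ∫⁻ k', ENNReal.ofReal (2 * δ) * (‖powerSpectrum R k'‖ₑ *
        regInv (δ / T) |inner ℝ k' (k + y)|) := by
        refine lintegral_mono fun k => mul_le_mul_right (lintegral_mono fun k' => ?_) _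
        obtain ⟨x, hx, he⟩ := hy k k'
        simp only [he]
        rw [mul_left_comm, ← hx]
        exact mul_le_mul_right (enorm_phaseInt_sub_le hT hδ hab) _
    _ = ENNReal.ofReal (2 * δ) * ∫⁻ k, ‖powerSpectrum R k‖ₑ * ∫⁻ k', ‖powerSpectrum R k'‖ₑ *
        regInv (δ / T) |inner ℝ k' (k + y)| := by
        rw [← lintegral_const_mul' _ _ ENNReal.ofReal_ne_top]
        refine lintegral_congr fun k => ?_
        rw [lintegral_const_mul' _ _ ENNReal.ofReal_ne_top, mul_left_comm]
    _ ≤ ENNReal.ofReal (2 * δ) * ENNReal.ofReal D := by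
        gcongr
        exact hb y
    _ = _ := (ENNReal.ofReal_mul (by positivity)).symm

/-- If the phase of a single jump `k` is, up to sign and scaling, the quadratic `k·(k + y)`, then
the integral of the generator over an interval is small. -/
theorem norm_transferInt_le {k₀ ε η : ℝ} (hδ : 0 < k₀ * ε / η) {lam : Fin p ⊕ Fin q → ℝ}
    (hlam : ∀ w : DualVar d p q, ∃ y : Lateral d, ∀ k, ∃ x : ℝ, |x| = |inner ℝ k (k + y)| ∧
      (transferKernel h k₀ ε η lam).phase (k, w) = x / (k₀ * ε / η)) {T D : ℝ} (hT : 0 < T)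
    (hD : 0 ≤ D)
    (hb : ∀ y : Lateral d, ∫⁻ k, ‖powerSpectrum R k‖ₑ *
      regInv (k₀ * ε / η / T) |inner ℝ k (k + y)| ≤ ENNReal.ofReal D) {z : ℝ} (hz : |z| ≤ T) :
    ‖transferInt h k₀ ε η lam z‖ ≤ prefactor d k₀ η * (2 * (k₀ * ε / η) * D) := by
  set δ := k₀ * ε / η with hδd
  rw [transferInt, norm_smul, Complex.norm_real, Real.norm_of_nonneg (prefactor_nonneg _ _ _)]
  refine mul_le_mul_of_nonneg_left ?_ (prefactor_nonneg _ _ _)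
  have h0 : phaseInt z = phaseInt z - phaseInt 0 := by rw [phaseInt_zero, sub_zero]
  rw [h0]
  refine PhaseKernel.norm_op_le_of_lintegral_le _ _ (by positivity) fun w => ?_
  obtain ⟨y, hy⟩ := hlam w
  calc _ ≤ ∫⁻ k, ENNReal.ofReal (2 * δ) * (‖powerSpectrum R k‖ₑ *
        regInv (δ / T) |inner ℝ k (k + y)|) := by
        refine lintegral_mono fun k => ?_
        obtain ⟨x, hx, he⟩ := hy k
        simp only [he]
        rw [mul_left_comm, ← hx]
        exact mul_le_mul_right (enorm_phaseInt_sub_le hT hδ (by rwa [sub_zero])) _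
    _ = ENNReal.ofReal (2 * δ) * ∫⁻ k, ‖powerSpectrum R k‖ₑ *
        regInv (δ / T) |inner ℝ k (k + y)| := lintegral_const_mul' _ _ ENNReal.ofReal_ne_top
    _ ≤ ENNReal.ofReal (2 * δ) * ENNReal.ofReal D := by
        gcongr
        exact hb y
    _ = _ := (ENNReal.ofReal_mul (by positivity)).symm

theorem norm_negSumB_transferInt_le {k₀ ε η : ℝ} (hδ : 0 < k₀ * ε / η) {T D : ℝ} (hT : 0 < T)
    (hD : 0 ≤ D)
    (hb : ∀ y : Lateral d, ∫⁻ k, ‖powerSpectrum R k‖ₑ *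
      regInv (k₀ * ε / η / T) |inner ℝ k (k + y)| ≤ ENNReal.ofReal D) {z : ℝ} (hz : |z| ≤ T) :
    ‖(negSumB (transferInt h k₀ ε η) z : Meas d p q →L[ℂ] Meas d p q)‖ ≤
      ((p + q : ℕ) : ℝ) ^ 2 * (prefactor d k₀ η * (2 * (k₀ * ε / η) * D)) := by
  have h0 : 0 ≤ prefactor d k₀ η * (2 * (k₀ * ε / η) * D) :=
    mul_nonneg (prefactor_nonneg _ _ _) (by positivity)
  refine (norm_negSumB_le (b := prefactor d k₀ η * (2 * (k₀ * ε / η) * D))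
    (fun j j' hj => norm_transferInt_le h hδ (fun w => ⟨w (Sum.inl j) - w (Sum.inl j'), fun k =>
      ⟨_, rfl, transferKernel_phase_colB_inl h k₀ ε η hj.ne k w⟩⟩) hT hD hb hz)
    (fun l l' hl => norm_transferInt_le h hδ (fun w => ⟨w (Sum.inr l) - w (Sum.inr l'), fun k =>
      ⟨_, abs_neg _, transferKernel_phase_colB_inr h k₀ ε η hl.ne k w⟩⟩) hT hD hb hz)).trans ?_
  refine mul_le_mul_of_nonneg_right ?_ h0
  have h5 := two_mul_card_samePairs p
  have h6 := two_mul_card_samePairs q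
  have h7 : (samePairs p).card + (samePairs q).card ≤ (p + q) ^ 2 := by nlinarith
  exact_mod_cast h7

end Generators

/-! ### The explicit error bound -/

section ErrorBound

variable {d p q : ℕ}

theorem nonneg_lpNorm' (f : Lateral d → ℝ) (r : ℝ≥0∞) : 0 ≤ lpNorm' f r := ENNReal.toReal_nonneg

theorem lintegral_enorm_eq_ofReal_lpNorm' {f : Lateral d → ℝ} (hf : Integrable f) :
    ∫⁻ x, ‖f x‖ₑ = ENNReal.ofReal (lpNorm' f 1) := by
  rw [lpNorm', ENNReal.ofReal_toReal (memLp_one_iff_integrable.2 hf).eLpNorm_ne_top,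
    eLpNorm_one_eq_lintegral_enorm]

theorem ae_enorm_le_ofReal_lpNorm' {f : Lateral d → ℝ} (hf : MemLp f ∞) :
    ∀ᵐ x, ‖f x‖ₑ ≤ ENNReal.ofReal (lpNorm' f ∞) := by
  rw [lpNorm', ENNReal.ofReal_toReal hf.eLpNorm_ne_top, eLpNorm_exponent_top]
  exact enorm_ae_le_eLpNormEssSup f volume

theorem IsAdmissibleCovariance.memLp_powerSpectrum {R S : Lateral d → ℝ}
    (h : IsAdmissibleCovariance R S) : MemLp (powerSpectrum R) ∞ := by
  refine memLp_top_of_bound h.continuous_powerSpectrum.aestronglyMeasurable (∫ x, ‖R x‖)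
    (Eventually.of_forall fun ξ => ?_)
  rw [Real.norm_of_nonneg (h.powerSpectrum_nonneg ξ)]
  exact powerSpectrum_le_integral_norm R ξ

theorem IsAdmissibleCovariance.memLp_weighted {R S : Lateral d → ℝ}
    (h : IsAdmissibleCovariance R S) (hd : 2 ≤ d) :
    MemLp (fun ξ => bracket ξ ^ (d - 2) * powerSpectrum R ξ) ∞ := by
  rcases hd.eq_or_lt with rfl | hd
  · simpa using h.memLp_powerSpectrum
  · exact h.weighted_bounded hd

/-- The power of the logarithm in the bound with bilinear phase. -/
def logPower (d : ℕ) : ℕ := if d = 1 then 2 else 1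

/-- The bound with bilinear phase, for two successive jumps that share one component. -/
theorem exists_double_integral_bound (hd : 1 ≤ d) :
    ∃ C : ℝ, 0 ≤ C ∧ ∀ {R S : Lateral d → ℝ}, IsAdmissibleCovariance R S → MemLp S ∞ →
      ∀ {κ : ℝ}, 0 < κ → κ ≤ Real.exp (-1) → ∀ y : Lateral d,
      ∫⁻ k, ‖powerSpectrum R k‖ₑ * ∫⁻ k', ‖powerSpectrum R k'‖ₑ *
        regInv κ |inner ℝ k' (k + y)| ≤
      ENNReal.ofReal (C * Real.log κ⁻¹ ^ logPower d * ((lpNorm' S 1 + lpNorm' S ∞) *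
        (lpNorm' (powerSpectrum R) 1 + lpNorm' (powerSpectrum R) ∞))) := by
  have key : ∃ C : ℝ≥0∞, C ≠ ∞ ∧ ∀ {r S : Lateral d → ℝ≥0∞}, AEMeasurable r → AEMeasurable S →
      (∀ x y, ‖x‖ = ‖y‖ → S x = S y) → ∀ {Mr MS : ℝ≥0∞}, (∀ᵐ x, r x ≤ Mr) → (∀ᵐ x, S x ≤ MS) →
      ∀ {κ : ℝ}, 0 < κ → κ ≤ Real.exp (-1) → ∀ y : Lateral d,
      ∫⁻ k, r k * ∫⁻ k', S k' * regInv κ |inner ℝ k' (k + y)| ≤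
        C * ENNReal.ofReal (Real.log κ⁻¹) ^ logPower d *
          (((∫⁻ k, S k) + MS) * ((∫⁻ k, r k) + Mr)) := by
    rcases hd.eq_or_lt with hd | hd
    · obtain ⟨C, hC, hb⟩ := lintegral_lintegral_regInv_le_of_finrank_eq_one (E := Lateral d)
        (by rw [finrank_euclideanSpace_fin, hd])
      refine ⟨C, hC, fun hr hS _ _ _ hMr hMS _ hκ hκ' y => ?_⟩
      rw [logPower, if_pos hd.symm]
      exact hb hr hS hMr hMS hκ hκ' y
    · obtain ⟨C, hC, hb⟩ := lintegral_lintegral_regInv_le (E := Lateral d)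
        (by rw [finrank_euclideanSpace_fin]; exact hd)
      refine ⟨C, hC, fun hr hS hrad _ _ hMr hMS _ hκ hκ' y => ?_⟩
      rw [logPower, if_neg hd.ne', pow_one]
      exact hb hr hS hrad hMr hMS hκ hκ' y
  obtain ⟨C, hC, hb⟩ := key
  refine ⟨C.toReal, ENNReal.toReal_nonneg, fun {R S} h hS {κ} hκ hκ' y => ?_⟩
  have hL := one_le_log_inv hκ hκ'
  have h1 := hb (r := fun k => ‖powerSpectrum R k‖ₑ) (S := fun k => ‖S k‖ₑ)
    h.continuous_powerSpectrum.measurable.enorm.aemeasurable h.majorant_integrable.1.enorm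
    (fun x y hxy => by rw [h.majorant_radial x y hxy])
    (ae_enorm_le_ofReal_lpNorm' h.memLp_powerSpectrum) (ae_enorm_le_ofReal_lpNorm' hS) hκ hκ' y
  have hle : ∀ᵐ k, ‖powerSpectrum R k‖ₑ ≤ ‖S k‖ₑ := by
    filter_upwards [h.powerSpectrum_le_majorant] with k hk
    rw [Real.enorm_of_nonneg (h.powerSpectrum_nonneg k),
      Real.enorm_of_nonneg ((h.powerSpectrum_nonneg k).trans hk)]
    exact ENNReal.ofReal_le_ofReal hk
  refine (lintegral_mono fun k => mul_le_mul_right (lintegral_mono_ae ?_) _).trans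
    (h1.trans_eq ?_)
  · filter_upwards [hle] with k' hk'
    exact mul_le_mul_left hk' _
  · have hn := nonneg_lpNorm' (d := d)
    rw [lintegral_enorm_eq_ofReal_lpNorm' h.majorant_integrable,
      lintegral_enorm_eq_ofReal_lpNorm' h.integrable_powerSpectrum,
      ← ENNReal.ofReal_add (hn _ _) (hn _ _), ← ENNReal.ofReal_add (hn _ _) (hn _ _),
      ENNReal.ofReal_mul (by positivity), ENNReal.ofReal_mul ENNReal.toReal_nonneg,
      ENNReal.ofReal_toReal hC, ENNReal.ofReal_pow (by linarith),
      ENNReal.ofReal_mul (add_nonneg (hn _ _) (hn _ _))]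

/-- The bound with quadratic phase, for jumps between two components of the same kind. -/
theorem exists_single_integral_bound (hd : 1 ≤ d) :
    ∃ C : ℝ, 0 ≤ C ∧ ∀ {R S : Lateral d → ℝ}, IsAdmissibleCovariance R S →
      ∀ {κ : ℝ}, 0 < κ → κ ≤ Real.exp (-1) → ∀ y : Lateral d,
      ∫⁻ k, ‖powerSpectrum R k‖ₑ * regInv κ |inner ℝ k (k + y)| ≤
      ENNReal.ofReal (if d = 1 then C * lpNorm' (powerSpectrum R) ∞ * (1 / √κ) else
        lpNorm' (powerSpectrum R) 1 + C * Real.log κ⁻¹ *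
          lpNorm' (fun ξ => bracket ξ ^ (d - 2) * powerSpectrum R ξ) ∞) := by
  set σ := (sphereMeasure (Lateral d) Set.univ).toReal with hσ
  have hσ' : sphereMeasure (Lateral d) Set.univ = ENNReal.ofReal σ :=
    (ENNReal.ofReal_toReal (measure_ne_top _ _)).symm
  have hσ0 : 0 ≤ σ := ENNReal.toReal_nonneg
  refine ⟨20 * σ, by positivity, fun {R S} h {κ} hκ hκ' y => ?_⟩
  have hL := one_le_log_inv hκ hκ'
  have hn := nonneg_lpNorm' (d := d)
  rcases hd.eq_or_lt with hd | hd
  · rw [if_pos hd.symm]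
    refine (lintegral_regInv_inner_add_le_of_finrank_eq_one (E := Lateral d)
      (by rw [finrank_euclideanSpace_fin, hd])
      (ae_enorm_le_ofReal_lpNorm' h.memLp_powerSpectrum) hκ y).trans ?_
    have h0 := hn (powerSpectrum R) ∞
    rw [hσ', ← ENNReal.ofReal_ofNat, ← ENNReal.ofReal_mul (by norm_num),
      ← ENNReal.ofReal_mul (by positivity), ← ENNReal.ofReal_mul (by positivity)]
    refine ENNReal.ofReal_le_ofReal ?_
    have h1 : 0 ≤ σ * lpNorm' (powerSpectrum R) ∞ * (1 / √κ) := by positivity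
    calc _ = 4 * (σ * lpNorm' (powerSpectrum R) ∞ * (1 / √κ)) := by ring
      _ ≤ 20 * (σ * lpNorm' (powerSpectrum R) ∞ * (1 / √κ)) := by linarith
      _ = _ := by ring
  · have hd2 : 2 ≤ d := hd
    rw [if_neg hd.ne']
    set W : Lateral d → ℝ := fun ξ => bracket ξ ^ (d - 2) * powerSpectrum R ξ with hW
    have hM : ∀ᵐ x : Lateral d, ENNReal.ofReal (‖x‖ ^ (Module.finrank ℝ (Lateral d) - 2)) *
        ‖powerSpectrum R x‖ₑ ≤ ENNReal.ofReal (lpNorm' W ∞) := by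
      filter_upwards [ae_enorm_le_ofReal_lpNorm' (h.memLp_weighted hd2)] with x hx
      refine le_trans ?_ hx
      have h0 := h.powerSpectrum_nonneg x
      have hb : ‖x‖ ≤ bracket x := Real.le_sqrt_of_sq_le (by linarith)
      have hb0 : 0 ≤ bracket x := Real.sqrt_nonneg _
      rw [Real.enorm_of_nonneg h0, Real.enorm_of_nonneg (mul_nonneg (pow_nonneg hb0 _) h0),
        ← ENNReal.ofReal_mul (by positivity), finrank_euclideanSpace_fin]
      exact ENNReal.ofReal_le_ofReal (mul_le_mul_of_nonneg_right
        (pow_le_pow_left₀ (norm_nonneg _) hb _) h0)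
    refine (lintegral_regInv_inner_add_le (E := Lateral d)
      (by rw [finrank_euclideanSpace_fin]; exact hd2)
      h.continuous_powerSpectrum.measurable.enorm.aemeasurable hM hκ hκ' y).trans_eq ?_
    have h1 : 0 ≤ Real.log κ⁻¹ := by linarith
    rw [lintegral_enorm_eq_ofReal_lpNorm' h.integrable_powerSpectrum, hσ',
      ENNReal.ofReal_add (hn _ _) (mul_nonneg (by positivity) (hn _ _)),
      ENNReal.ofReal_mul (by positivity), ENNReal.ofReal_mul (by positivity),
      ENNReal.ofReal_mul (by norm_num)]
    norm_num

theorem one_le_bracket (z : ℝ) : 1 ≤ bracket z :=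
  Real.one_le_sqrt.2 (by nlinarith [norm_nonneg z])

theorem le_bracket (z : ℝ) : z ≤ bracket z :=
  (le_abs_self z).trans (Real.le_sqrt_of_sq_le (by rw [← Real.norm_eq_abs]; linarith))

theorem frakC1_nonneg {δ : ℝ} (hδ : 0 ≤ δ) (f g : Lateral d → ℝ) : 0 ≤ frakC1 δ f g := by
  have hn := nonneg_lpNorm' (d := d)
  have h1 := add_nonneg (hn f 1) (hn f ∞)
  have h2 := add_nonneg (hn g 1) (hn g ∞)
  unfold frakC1
  split_ifs <;> positivity

theorem frakC2_nonneg {δ : ℝ} (hδ : 0 ≤ δ) (hδ1 : δ ≤ 1) (f : Lateral d → ℝ) :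
    0 ≤ frakC2 δ f := by
  have hn := nonneg_lpNorm' (d := d)
  have h1 := hn f ∞
  have h2 := hn f 1
  have h3 := hn (fun ξ => bracket ξ ^ (d - 2) * f ξ) ∞
  have h4 : 0 ≤ Real.log δ⁻¹ := by
    rw [Real.log_inv]
    linarith [Real.log_nonpos hδ hδ1]
  unfold frakC2
  split_ifs <;> positivity

theorem log_div_bracket_inv_le {δ T : ℝ} (hδ : 0 < δ) (hT : 1 ≤ T) (hδT : δ * T ≤ 1) :
    Real.log (δ / T)⁻¹ ≤ 2 * Real.log δ⁻¹ := by
  have hT0 : 0 < T := by linarith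
  rw [Real.log_inv, Real.log_inv, Real.log_div hδ.ne' hT0.ne']
  have := Real.log_nonpos (by positivity) hδT
  rw [Real.log_mul hδ.ne' hT0.ne'] at this
  linarith

/-- The bound with bilinear phase in terms of `frakC1`. -/
theorem mul_log_pow_le_frakC1 {δ T C : ℝ} (hC : 0 ≤ C) (hδ : 0 < δ) (hδ1 : δ ≤ 1)
    (hT : 1 ≤ T) (hδT : δ * T ≤ 1) (f g : Lateral d → ℝ) :
    δ * (C * Real.log (δ / T)⁻¹ ^ logPower d * ((lpNorm' f 1 + lpNorm' f ∞) *
      (lpNorm' g 1 + lpNorm' g ∞))) ≤ 4 * C * frakC1 δ f g := by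
  have hn := nonneg_lpNorm' (d := d)
  have h1 := add_nonneg (hn f 1) (hn f ∞)
  have h2 := add_nonneg (hn g 1) (hn g ∞)
  have hlog : |Real.log δ| = Real.log δ⁻¹ := by
    rw [Real.log_inv, abs_of_nonpos (Real.log_nonpos hδ.le hδ1)]
  have h3 := log_div_bracket_inv_le hδ hT hδT
  have hδT' : δ / T ≤ 1 := (div_le_one (by linarith)).2 (hδ1.trans hT)
  have h4 : 0 ≤ Real.log (δ / T)⁻¹ := Real.log_nonneg ((one_le_inv₀ (by positivity)).2 hδT')
  have h6 : 0 ≤ Real.log δ⁻¹ := by linarith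
  have h5 : Real.log (δ / T)⁻¹ ^ logPower d ≤
      4 * (if d = 1 then |Real.log δ| ^ 2 else |Real.log δ|) := by
    rw [hlog, logPower]
    split_ifs
    · nlinarith
    · linarith
  calc _ = (δ * C * ((lpNorm' f 1 + lpNorm' f ∞) * (lpNorm' g 1 + lpNorm' g ∞))) *
        Real.log (δ / T)⁻¹ ^ logPower d := by ring
    _ ≤ (δ * C * ((lpNorm' f 1 + lpNorm' f ∞) * (lpNorm' g 1 + lpNorm' g ∞))) *
        (4 * (if d = 1 then |Real.log δ| ^ 2 else |Real.log δ|)) :=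
        mul_le_mul_of_nonneg_left h5 (by positivity)
    _ = _ := by rw [frakC1]; ring

/-- The bound with quadratic phase in terms of `frakC2`. -/
theorem mul_single_bound_le_frakC2 {δ T C : ℝ} (hC : 0 ≤ C) (hδ : 0 < δ) (hδ1 : δ ≤ 1)
    (hT : 1 ≤ T) (hδT : δ * T ≤ 1) (f : Lateral d → ℝ) :
    δ * (if d = 1 then C * lpNorm' f ∞ * (1 / √(δ / T)) else
        lpNorm' f 1 + C * Real.log (δ / T)⁻¹ *
          lpNorm' (fun ξ => bracket ξ ^ (d - 2) * f ξ) ∞) ≤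
      T * ((2 * C + 1) * frakC2 δ f) := by
  have hn := nonneg_lpNorm' (d := d)
  have hT0 : 0 < T := by linarith
  rw [frakC2]
  split_ifs with hd
  · have h0 := hn f ∞
    have hs : 0 < √δ := Real.sqrt_pos.2 hδ
    have h1 : √T ≤ T := Real.sqrt_le_iff.2 ⟨hT0.le, by nlinarith⟩
    have h2 : δ * (1 / √(δ / T)) = √δ * √T := by
      rw [Real.sqrt_div hδ.le, one_div_div]
      nth_rewrite 1 [← Real.sq_sqrt hδ.le]
      field_simp
    have h3 := Real.two_le_pi
    calc _ = C * lpNorm' f ∞ * (δ * (1 / √(δ / T))) := by ring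
      _ ≤ C * lpNorm' f ∞ * (√δ * T) := by
          rw [h2]
          gcongr
      _ = T * (C * (1 * lpNorm' f ∞ * √δ)) := by ring
      _ ≤ T * ((2 * C + 1) * (2 * Real.pi * lpNorm' f ∞ * √δ)) := by
          gcongr <;> linarith
  · set W := lpNorm' (fun ξ => bracket ξ ^ (d - 2) * f ξ) ∞ with hW
    have h0 : 0 ≤ W := hn _ _
    have h1 := hn f 1
    have h3 := log_div_bracket_inv_le hδ hT hδT
    have h4 : 0 ≤ Real.log δ⁻¹ := Real.log_nonneg ((one_le_inv₀ hδ).2 hδ1)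
    calc _ = C * W * δ * Real.log (δ / T)⁻¹ + lpNorm' f 1 * δ := by ring
      _ ≤ C * W * δ * (2 * Real.log δ⁻¹) + lpNorm' f 1 * δ := by gcongr
      _ ≤ C * W * δ * (2 * Real.log δ⁻¹) + lpNorm' f 1 * δ +
          (W * δ * Real.log δ⁻¹ + 2 * C * (lpNorm' f 1 * δ)) :=
          le_add_of_nonneg_right (by positivity)
      _ = 1 * ((2 * C + 1) * (W * δ * Real.log δ⁻¹ + lpNorm' f 1 * δ)) := by ring
      _ ≤ _ := by gcongr

theorem errConst_nonneg (p q : ℕ) : 0 ≤ PairSystem.errConst p q := by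
  unfold PairSystem.errConst; positivity

/-- The two oscillatory bounds combined, with the prefactors `P H = k₀² / (4 η² (2π)^d)` of the
generators and `T = ⟨z⟩`. -/
theorem combine_oscillatory_bounds {z T P H A B n x₁ x₂ F₁ F₂ : ℝ} (hz : z ≤ T) (hT : 0 ≤ T)
    (hP : 0 ≤ P) (hH : 1 ≤ H) (hA : 0 ≤ A) (hB : 0 ≤ B) (hx₁ : 0 ≤ x₁) (hF₁ : 0 ≤ F₁)
    (hF₂ : 0 ≤ F₂) (h₁ : x₁ ≤ 4 * A * F₁) (h₂ : x₂ ≤ T * ((2 * B + 1) * F₂)) :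
    z * (2 * (P * H) ^ 2 * x₁) + 2 * n ^ 2 * (P * H) * x₂ ≤
      T * (H ^ 2 * ((8 * P ^ 2 * A + 2 * n ^ 2 * P * (2 * B + 1)) * (F₁ + F₂))) := by
  have hH0 : 0 ≤ H := zero_le_one.trans hH
  calc z * (2 * (P * H) ^ 2 * x₁) + 2 * n ^ 2 * (P * H) * x₂
      ≤ T * (2 * (P * H) ^ 2 * (4 * A * F₁)) +
        2 * n ^ 2 * (P * (H * H)) * (T * ((2 * B + 1) * F₂)) := by
        have h3 : H ≤ H * H := le_mul_of_one_le_left hH0 hH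
        have h4 : 0 ≤ T * ((2 * B + 1) * F₂) := by positivity
        refine add_le_add ?_ ?_
        · gcongr
        · exact (mul_le_mul_of_nonneg_left h₂ (by positivity)).trans
            (mul_le_mul_of_nonneg_right (by gcongr) h4)
    _ = T * (H ^ 2 * (8 * P ^ 2 * A * F₁ + 2 * n ^ 2 * P * (2 * B + 1) * F₂)) := by ring
    _ ≤ T * (H ^ 2 * (8 * P ^ 2 * A * F₁ + 2 * n ^ 2 * P * (2 * B + 1) * F₂ +
        (8 * P ^ 2 * A * F₂ + 2 * n ^ 2 * P * (2 * B + 1) * F₁))) := by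
        refine mul_le_mul_of_nonneg_left (mul_le_mul_of_nonneg_left
          (le_add_of_nonneg_right (by positivity)) (by positivity)) hT
    _ = _ := by ring

theorem combine_damping {C C' H T z : ℝ} (hC : 0 ≤ C) (hC' : C ≤ C') (hH : 1 ≤ H) (hT : 1 ≤ T)
    (hz : 0 ≤ z) (hzT : z ≤ T) : 1 + C * H * z ≤ T * (H * (1 + C')) := by
  have h1 : 1 * 1 ≤ T * H := mul_le_mul hT hH zero_le_one (by linarith)
  have h0 : 0 ≤ C' * H := mul_nonneg (hC.trans hC') (by linarith)
  have h2 : C * H * z ≤ C' * H * T :=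
    mul_le_mul (mul_le_mul_of_nonneg_right hC' (by linarith)) hzT hz h0
  calc 1 + C * H * z ≤ T * H + C' * H * T := by linarith
    _ = _ := by ring

/-- The error estimate for the solution operators of the full equation, with a constant that depends
on `R` only through `R 0`. The factor `2` on the left prepares for `opNormLE_of_norm_le`. -/
theorem exists_errorBound (d : ℕ) (hd : 1 ≤ d) (p q : ℕ) (k₀ : ℝ) (hk₀ : 0 < k₀) (R₀ : ℝ) :
    ∃ c : ℝ, 0 < c ∧ ∀ {R S : Lateral d → ℝ} (h : IsAdmissibleCovariance R S), R 0 = R₀ →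
      MemLp S ∞ → ∀ {ε η z : ℝ}, 0 < ε → 0 < η → η ≤ 1 → k₀ * ε / η ≤ Real.exp (-1) →
      k₀ * ε / η * bracket z ≤ 1 → ∀ U : ℝ → Meas d p q →L[ℂ] Meas d p q, U 0 = 1 →
      StrongDeriv U (fun z => genCLM h k₀ ε η z * U z) → ∀ z' ∈ Set.Icc 0 z,
      2 * ‖U z' - (pairSystem h k₀ ε η).approx z'‖ ≤ errorBound p q k₀ R S c k₀ ε η z := by
  obtain ⟨A, hA, hb1⟩ := exists_double_integral_bound hd
  obtain ⟨B, hB, hb2⟩ := exists_single_integral_bound hd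
  set n : ℝ := ((p + q : ℕ) : ℝ) with hn
  set P : ℝ := k₀ ^ 2 / 4 / (2 * Real.pi) ^ d with hP
  have hP0 : 0 ≤ P := by positivity
  have he := errConst_nonneg p q
  set K : ℝ := 8 * P ^ 2 * A + 2 * n ^ 2 * P * (2 * B + 1) with hK
  have hK0 : 0 ≤ K := by positivity
  -- the summand `1` only makes the constant positive
  refine ⟨2 * PairSystem.errConst p q * (1 + k₀ ^ 2 / 4 * |R₀|) * K + 1, by positivity, ?_⟩
  intro R S h hR hS ε η z hε hη hη1 hδe hδT U hU0 hU z' hz'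
  have hz0 : 0 ≤ z := hz'.1.trans hz'.2
  set δ := k₀ * ε / η with hδd
  have hδ : 0 < δ := by positivity
  have hδ1 : δ ≤ 1 := hδe.trans (Real.exp_le_one_iff.2 (by norm_num))
  set T := bracket z with hT
  have hT1 : 1 ≤ T := one_le_bracket z
  have hzT : z ≤ T := le_bracket z
  have hT0 : 0 < T := by linarith
  have hκ : 0 < δ / T := by positivity
  have hκ' : δ / T ≤ Real.exp (-1) := (div_le_self hδ.le hT1).trans hδe
  have hpf : prefactor d k₀ η = P * (η ^ 2)⁻¹ := by
    rw [prefactor, hP]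
    field_simp
  set f := powerSpectrum R with hf
  set D₁ := A * Real.log (δ / T)⁻¹ ^ logPower d * ((lpNorm' S 1 + lpNorm' S ∞) *
    (lpNorm' f 1 + lpNorm' f ∞)) with hD₁
  set D₂ := (if d = 1 then B * lpNorm' f ∞ * (1 / √(δ / T)) else
    lpNorm' f 1 + B * Real.log (δ / T)⁻¹ *
      lpNorm' (fun ξ => bracket ξ ^ (d - 2) * f ξ) ∞) with hD₂
  have hnn := nonneg_lpNorm' (d := d)
  have hlog : 0 ≤ Real.log (δ / T)⁻¹ := zero_le_one.trans (one_le_log_inv hκ hκ')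
  have hD₁0 : 0 ≤ D₁ := by
    have h1 := add_nonneg (hnn S 1) (hnn S ∞)
    have h2 := add_nonneg (hnn f 1) (hnn f ∞)
    positivity
  have hD₂0 : 0 ≤ D₂ := by
    have h1 := hnn f ∞
    have h2 := hnn f 1
    have h3 := hnn (fun ξ => bracket ξ ^ (d - 2) * f ξ) ∞
    rw [hD₂]
    split_ifs <;> positivity
  have hC0 : 0 ≤ dampC k₀ R := mul_nonneg (by positivity) h.apply_zero_nonneg
  have hC0' : dampC k₀ R ≤ k₀ ^ 2 / 4 * |R₀| := by
    rw [dampC, hR]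
    exact mul_le_mul_of_nonneg_left (le_abs_self _) (by positivity)
  have hpf0 := prefactor_nonneg d k₀ η
  -- the abstract error estimate, with the oscillatory bounds at frequency scale `δ / T`
  have hmain := (pairSystem h k₀ ε η).norm_sub_approx_le (Z := z)
    (σ₁ := prefactor d k₀ η ^ 2 * (2 * δ * D₁))
    (σ₂ := n ^ 2 * (prefactor d k₀ η * (2 * δ * D₂)))
    (dampC_div_nonneg k₀ η h) (fun γ => strongDeriv_transferInt h k₀ ε η (colA γ))
    (strongDeriv_negSumB fun lam => strongDeriv_transferInt h k₀ ε η lam)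
    (norm_genCLM_le h k₀ ε η) hU0 hU (by positivity) (by positivity)
    (fun γ γ' hne hs a ha b hb => norm_transferInt_sub_mul_le h hδ hne hs hT0 hD₁0
      (hb1 h hS hκ hκ') ((abs_le.2 ⟨by linarith [ha.1, ha.2, hb.1, hb.2],
        by linarith [ha.1, ha.2, hb.1, hb.2]⟩ : |b - a| ≤ z).trans hzT))
    (fun s hs => norm_negSumB_transferInt_le h hδ hT0 hD₂0 (hb2 h hκ hκ')
      (by rw [abs_of_nonneg hs.1]; exact hs.2.trans hzT)) hz'
  set F := frakC1 δ S f + frakC2 δ f with hF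
  have hF1 := frakC1_nonneg hδ.le S f
  have hF2 := frakC2_nonneg hδ.le hδ1 f
  have hη2 : 1 ≤ (η ^ 2)⁻¹ := (one_le_inv₀ (by positivity)).2 (pow_le_one₀ hη.le hη1)
  set H := (η ^ 2)⁻¹ with hH
  have hH0 : 0 < H := by positivity
  have hσ : z * (prefactor d k₀ η ^ 2 * (2 * δ * D₁)) +
      n ^ 2 * (prefactor d k₀ η * (2 * δ * D₂)) ≤ T * (H ^ 2 * (K * F)) := by
    have h1 := mul_log_pow_le_frakC1 hA hδ hδ1 hT1 hδT S f
    have h2 := mul_single_bound_le_frakC2 hB hδ hδ1 hT1 hδT f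
    rw [← hD₁] at h1
    rw [← hD₂] at h2
    rw [hpf]
    refine le_trans (le_of_eq ?_) (combine_oscillatory_bounds hzT hT0.le hP0 hη2 hA hB
      (by positivity) hF1 hF2 h1 h2)
    ring
  have hfac : 1 + dampC k₀ R / η ^ 2 * z ≤ T * (H * (1 + k₀ ^ 2 / 4 * |R₀|)) := by
    rw [div_eq_mul_inv, ← hH]
    exact combine_damping hC0 hC0' hη2 hT1 hz0 hzT
  have hexp : n ^ 2 / 2 * (dampC k₀ R / η ^ 2) * z = n ^ 2 * dampC k₀ R * z / (2 * η ^ 2) := by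
    field_simp
  have hHη : (η ^ 6)⁻¹ = H ^ 3 := by
    rw [hH, inv_pow, ← pow_mul]
  have hX : (pairSystem (p := p) (q := q) h k₀ ε η).κ = dampC k₀ R / η ^ 2 := rfl
  rw [hX, ← hn, hexp] at hmain
  rw [errorBound, ← hδd, ← hT, ← hn, ← hf, ← hF, hHη]
  set X := Real.exp (n ^ 2 * dampC k₀ R * z / (2 * η ^ 2)) with hXd
  have hX0 : 0 < X := Real.exp_pos _
  calc 2 * ‖U z' - (pairSystem h k₀ ε η).approx z'‖
      ≤ 2 * (PairSystem.errConst p q * (T * (H * (1 + k₀ ^ 2 / 4 * |R₀|))) *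
          (T * (H ^ 2 * (K * F))) * X) := by
        refine mul_le_mul_of_nonneg_left (hmain.trans ?_) (by norm_num)
        have h1 : 0 ≤ dampC k₀ R / η ^ 2 := by positivity
        gcongr
    _ = (2 * PairSystem.errConst p q * (1 + k₀ ^ 2 / 4 * |R₀|) * K) * T ^ 2 * H ^ 3 * F * X := by
        ring
    _ ≤ _ := by
        have : 0 ≤ F := add_nonneg hF1 hF2
        gcongr
        linarith

end ErrorBound

/-! ### The error bound in the two scalings -/

section Asymptotics

variable {d p q : ℕ}

/-- In both scalings, powers of `1/η` and exponentials of its square are negligible with respect to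
powers of `ε`. -/
theorem eventually_scaling {η : ℝ → ℝ} (hη : η = etaKinetic ∨ η = etaDiffusive) (a B : ℝ) :
    ∀ᶠ ε in 𝓝[>] (0 : ℝ), 0 < η ε ∧ η ε ≤ 1 ∧ (η ε)⁻¹ ^ 7 ≤ Real.log ε⁻¹ ∧
      a * (η ε)⁻¹ ^ 2 ≤ Real.log ε⁻¹ / 12 ∧
      B * (Real.log ε⁻¹ * Real.exp (-(Real.log ε⁻¹ / 12))) ≤ 1 := by
  have hx : Tendsto (fun ε : ℝ => Real.log ε⁻¹) (𝓝[>] 0) atTop :=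
    Real.tendsto_log_atTop.comp tendsto_inv_nhdsGT_zero
  have hB : ∀ᶠ x : ℝ in atTop, B * (x * Real.exp (-(x / 12))) ≤ 1 := by
    have h1 : Tendsto (fun x : ℝ => x / 12) atTop atTop := tendsto_id.atTop_div_const (by norm_num)
    have h2 := ((Real.tendsto_pow_mul_exp_neg_atTop_nhds_zero 1).comp h1).const_mul (B * 12)
    rw [mul_zero] at h2
    filter_upwards [h2.eventually_le_const one_pos] with x hx
    refine le_trans (le_of_eq ?_) hx
    simp only [Function.comp_apply, pow_one]
    ring
  rcases hη with rfl | rfl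
  · have h1 : ∀ᶠ x : ℝ in atTop, 1 ≤ x ∧ a ≤ x / 12 := by
      filter_upwards [eventually_ge_atTop 1, eventually_ge_atTop (12 * a)] with x h h'
      exact ⟨h, by linarith⟩
    filter_upwards [hx.eventually hB, hx.eventually h1] with ε h2 h3
    simp only [etaKinetic]
    exact ⟨one_pos, le_rfl, by rw [inv_one, one_pow]; exact h3.1,
      by rw [inv_one, one_pow, mul_one]; exact h3.2, h2⟩
  · have h1 : ∀ᶠ x : ℝ in atTop, 1 ≤ Real.log x ∧ Real.log x ^ 7 ≤ x ∧
        a * Real.log x ^ 2 ≤ x / 12 := by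
      have h7 := (Real.isLittleO_pow_log_id_atTop (n := 7)).bound one_pos
      have h2 := (Real.isLittleO_pow_log_id_atTop (n := 2)).bound
        (c := (12 * (|a| + 1))⁻¹) (by positivity)
      filter_upwards [h7, h2, Real.tendsto_log_atTop.eventually_ge_atTop 1,
        eventually_ge_atTop 1] with x h7 h2 hl hx1
      simp only [id, Real.norm_eq_abs, abs_of_nonneg (zero_le_one.trans hx1), one_mul] at h7 h2
      refine ⟨hl, (le_abs_self _).trans h7, ?_⟩
      have h3 : Real.log x ^ 2 ≤ (12 * (|a| + 1))⁻¹ * x := (le_abs_self _).trans h2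
      calc a * Real.log x ^ 2 ≤ (|a| + 1) * Real.log x ^ 2 := by
            gcongr
            linarith [le_abs_self a]
        _ ≤ (|a| + 1) * ((12 * (|a| + 1))⁻¹ * x) := by gcongr
        _ = x / 12 := by field_simp
    filter_upwards [hx.eventually hB, hx.eventually h1, hx.eventually_ge_atTop 0] with ε h2 h3 h0
    have h4 : |Real.log ε| = Real.log ε⁻¹ := by
      rw [← abs_neg, ← Real.log_inv, abs_of_nonneg h0]
    simp only [etaDiffusive, h4, inv_inv]
    have : 0 < Real.log (Real.log ε⁻¹) := by linarith [h3.1]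
    exact ⟨by positivity, inv_le_one_of_one_le₀ h3.1, h3.2.1, h3.2.2, h2⟩

/-- Both oscillatory bounds are of order `√δ`. -/
theorem exists_frakC_le (f g : Lateral d → ℝ) :
    ∃ M : ℝ, 0 ≤ M ∧ ∀ δ : ℝ, 0 < δ → δ ≤ 1 → frakC1 δ f g + frakC2 δ g ≤ M * √δ := by
  have hn := nonneg_lpNorm' (d := d)
  have h1 := add_nonneg (hn f 1) (hn f ∞)
  have h2 := add_nonneg (hn g 1) (hn g ∞)
  set N := (lpNorm' f 1 + lpNorm' f ∞) * (lpNorm' g 1 + lpNorm' g ∞) with hN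
  have hN0 : 0 ≤ N := mul_nonneg h1 h2
  set W := lpNorm' (fun ξ => bracket ξ ^ (d - 2) * g ξ) ∞ with hW
  have hW0 : 0 ≤ W := hn _ _
  have hg1 := hn g 1
  have hgi := hn g ∞
  refine ⟨16 * N + (2 * Real.pi * lpNorm' g ∞ + (2 * W + lpNorm' g 1)), by positivity,
    fun δ hδ hδ1 => ?_⟩
  have hs : 0 < √δ := Real.sqrt_pos.2 hδ
  have hs1 : √δ ≤ 1 := Real.sqrt_le_one.2 hδ1
  have hsq : √δ * √δ = δ := Real.mul_self_sqrt hδ.le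
  have hδs : δ ≤ √δ := by nlinarith
  have hlog0 : 0 ≤ Real.log δ⁻¹ := Real.log_nonneg ((one_le_inv₀ hδ).2 hδ1)
  have hlog : |Real.log δ| = Real.log δ⁻¹ := by
    rw [Real.log_inv, abs_of_nonpos (Real.log_nonpos hδ.le hδ1)]
  -- `log x ≤ 2 √x` and `log x ≤ 4 x^{1/4}`, for `x = 1/δ`
  have hl1 : δ * Real.log δ⁻¹ ≤ 2 * √δ := by
    have h3 : Real.log δ⁻¹ ≤ 2 * (√δ)⁻¹ := by
      have h4 := Real.log_le_sub_one_of_pos (inv_pos.2 hs)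
      have h5 : Real.log δ⁻¹ = 2 * Real.log (√δ)⁻¹ := by
        rw [Real.log_inv, Real.log_inv, Real.log_sqrt hδ.le]
        ring
      linarith
    calc δ * Real.log δ⁻¹ ≤ δ * (2 * (√δ)⁻¹) := by gcongr
      _ = 2 * √δ := by
        nth_rewrite 1 [← hsq]
        field_simp
  have hl2 : δ * Real.log δ⁻¹ ^ 2 ≤ 16 * √δ := by
    set t := √(√δ) with ht
    have ht0 : 0 < t := Real.sqrt_pos.2 hs
    have htt : t * t = √δ := Real.mul_self_sqrt hs.le
    have h3 : Real.log δ⁻¹ ≤ 4 * t⁻¹ := by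
      have h4 := Real.log_le_sub_one_of_pos (inv_pos.2 ht0)
      have h5 : Real.log δ⁻¹ = 4 * Real.log t⁻¹ := by
        rw [Real.log_inv, Real.log_inv, ht, Real.log_sqrt hs.le, Real.log_sqrt hδ.le]
        ring
      linarith
    calc δ * Real.log δ⁻¹ ^ 2 ≤ δ * (4 * t⁻¹) ^ 2 := by gcongr
      _ = 16 * √δ := by
        nth_rewrite 1 [← hsq]
        rw [← htt]
        field_simp
        ring
  have hC1 : frakC1 δ f g ≤ 16 * N * √δ := by
    rw [frakC1, hlog, ← hN]
    split_ifs
    · calc N * δ * Real.log δ⁻¹ ^ 2 = N * (δ * Real.log δ⁻¹ ^ 2) := by ring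
        _ ≤ N * (16 * √δ) := by gcongr
        _ = _ := by ring
    · calc N * δ * Real.log δ⁻¹ = N * (δ * Real.log δ⁻¹) := by ring
        _ ≤ N * (16 * √δ) := mul_le_mul_of_nonneg_left (by linarith) hN0
        _ = _ := by ring
  have hC2 : frakC2 δ g ≤ (2 * Real.pi * lpNorm' g ∞ + (2 * W + lpNorm' g 1)) * √δ := by
    rw [frakC2, add_mul]
    split_ifs
    · exact le_add_of_nonneg_right (by positivity)
    · refine le_trans ?_ (le_add_of_nonneg_left (by positivity))
      calc _ = W * (δ * Real.log δ⁻¹) + lpNorm' g 1 * δ := by rw [← hW]; ring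
        _ ≤ W * (2 * √δ) + lpNorm' g 1 * √δ := by gcongr
        _ = _ := by ring
  linarith

theorem bracket_le_bracket {z Z : ℝ} (hz : 0 ≤ z) (h : z ≤ Z) : bracket z ≤ bracket Z := by
  unfold bracket
  rw [Real.norm_of_nonneg hz, Real.norm_of_nonneg (hz.trans h)]
  gcongr

/-- In both scalings the error bound is eventually smaller than `ε^{1/3}`, and the scale `k₀ ε / η`
is eventually as small as the error estimate requires. The bound is of order `√ε` up to powers of
`log (1/ε)` and a factor `ε^{-1/12}`. -/
theorem exists_errorBound_le (p q : ℕ) {k₀ c : ℝ} (hk₀ : 0 < k₀) (hc : 0 < c)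
    {R : Lateral d → ℝ} (hR : 0 ≤ R 0) (S : Lateral d → ℝ) {η : ℝ → ℝ}
    (hη : η = etaKinetic ∨ η = etaDiffusive) (Z : ℝ) :
    ∃ ε₀ : ℝ, 0 < ε₀ ∧ ∀ z ε : ℝ, 0 ≤ z → z ≤ Z → 0 < ε → ε ≤ ε₀ → 0 < η ε ∧ η ε ≤ 1 ∧
      k₀ * ε / η ε ≤ Real.exp (-1) ∧ k₀ * ε / η ε * bracket z ≤ 1 ∧
      errorBound p q k₀ R S c k₀ ε (η ε) z ≤ ε ^ (1 / 3 : ℝ) := by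
  obtain ⟨M, hM, hF⟩ := exists_frakC_le S (powerSpectrum R)
  have hC0 : 0 ≤ dampC k₀ R := mul_nonneg (by positivity) hR
  set T := bracket Z with hT
  have hT1 : 1 ≤ T := one_le_bracket Z
  set n : ℝ := ((p + q : ℕ) : ℝ) with hn
  set a : ℝ := n ^ 2 * dampC k₀ R * Z / 2 with ha
  have hev := eventually_scaling hη a (c * T ^ 2 * M * √k₀ + k₀ * T * Real.exp 1)
  obtain ⟨ε₀, hε₀, hsub⟩ := mem_nhdsGT_iff_exists_Ioc_subset.1 hev
  refine ⟨ε₀, hε₀, fun z ε hz hzZ hε hεε => ?_⟩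
  obtain ⟨hη0, hη1, h7, h2, hB⟩ := hsub ⟨hε, hεε⟩
  have hh1 : 1 ≤ (η ε)⁻¹ := (one_le_inv₀ hη0).2 hη1
  have hηh : ∀ x, x / η ε = x * (η ε)⁻¹ := fun x => div_eq_mul_inv _ _
  have hη6 : (η ε ^ 6)⁻¹ = (η ε)⁻¹ ^ 6 := (inv_pow _ _).symm
  have hηe : n ^ 2 * dampC k₀ R * z / (2 * η ε ^ 2) ≤ a * (η ε)⁻¹ ^ 2 := by
    have : n ^ 2 * dampC k₀ R * z / (2 * η ε ^ 2) =
        n ^ 2 * dampC k₀ R * z / 2 * (η ε)⁻¹ ^ 2 := by field_simp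
    rw [this, ha]
    gcongr
  set h := (η ε)⁻¹ with hh
  have hh0 : 0 < h := by linarith
  set x := Real.log ε⁻¹ with hx
  have hhx : h ≤ x := (le_self_pow₀ hh1 (by norm_num)).trans h7
  have hx0 : 0 < x := hh0.trans_le hhx
  -- everything is expressed by `x = log (1/ε)`; powers of `1/η` are at most `x`
  have hεx : ε = Real.exp (-x) := by rw [hx, Real.log_inv, neg_neg, Real.exp_log hε]
  have hδT : k₀ * ε * h * T ≤ Real.exp (-1) := by
    have h3 : k₀ * T * Real.exp 1 * (x * Real.exp (-(x / 12))) ≤ 1 := by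
      refine le_trans ?_ hB
      gcongr
      exact le_add_of_nonneg_left (by positivity)
    calc k₀ * ε * h * T ≤ k₀ * Real.exp (-(x / 12)) * x * T := by
          rw [hεx]
          gcongr
          linarith
      _ = k₀ * T * Real.exp 1 * (x * Real.exp (-(x / 12))) * Real.exp (-1) := by
          have : Real.exp 1 * Real.exp (-1) = 1 := by rw [← Real.exp_add]; simp
          linear_combination (-(k₀ * Real.exp (-(x / 12)) * x * T)) * this
      _ ≤ 1 * Real.exp (-1) := by gcongr
      _ = _ := one_mul _
  have hδ0 : 0 < k₀ * ε * h := by positivity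
  have hδe : k₀ * ε * h ≤ Real.exp (-1) := (le_mul_of_one_le_right hδ0.le hT1).trans hδT
  have he1 : Real.exp (-1) ≤ 1 := Real.exp_le_one_iff.2 (by norm_num)
  have hzT := bracket_le_bracket hz hzZ
  have hz1 := one_le_bracket z
  refine ⟨hη0, hη1, by rwa [hηh], ?_, ?_⟩
  · rw [hηh]
    refine le_trans ?_ (hδT.trans he1)
    gcongr
  · rw [errorBound, hηh, hη6, ← hn]
    have hsqrt : √(k₀ * ε * h) ≤ √k₀ * √ε * h := by
      rw [Real.sqrt_mul (by positivity), Real.sqrt_mul hk₀.le]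
      gcongr
      exact Real.sqrt_le_iff.2 ⟨hh0.le, by nlinarith⟩
    have hsε : √ε = Real.exp (-(x / 2)) := by
      rw [hεx, Real.sqrt_eq_rpow, ← Real.exp_mul]
      ring_nf
    have hε3 : ε ^ (1 / 3 : ℝ) = Real.exp (-(x / 3)) := by
      rw [hεx, ← Real.exp_mul]
      ring_nf
    have hexp : Real.exp (x / 12) * Real.exp (-(x / 2)) =
        Real.exp (-(x / 12)) * Real.exp (-(x / 3)) := by
      rw [← Real.exp_add, ← Real.exp_add]
      ring_nf
    have hF' := hF _ hδ0 (hδe.trans he1)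
    have hF0 := add_nonneg (frakC1_nonneg hδ0.le S (powerSpectrum R))
      (frakC2_nonneg hδ0.le (hδe.trans he1) (powerSpectrum R))
    have hX := Real.exp_le_exp.2 (hηe.trans h2)
    have hF2 := hF'.trans (mul_le_mul_of_nonneg_left hsqrt hM)
    have hz2 : c * bracket z ^ 2 * h ^ 6 ≤ c * T ^ 2 * h ^ 6 := by gcongr
    calc _ ≤ c * T ^ 2 * h ^ 6 * (M * (√k₀ * √ε * h)) * Real.exp (x / 12) :=
          mul_le_mul (mul_le_mul hz2 hF2 hF0 (by positivity)) hX (Real.exp_pos _).le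
            (by positivity)
      _ = c * T ^ 2 * M * √k₀ * h ^ 7 * (Real.exp (x / 12) * Real.exp (-(x / 2))) := by
          rw [hsε]
          ring
      _ ≤ c * T ^ 2 * M * √k₀ * x * (Real.exp (x / 12) * Real.exp (-(x / 2))) := by gcongr
      _ = c * T ^ 2 * M * √k₀ * (x * Real.exp (-(x / 12))) * Real.exp (-(x / 3)) := by
          rw [hexp]
          ring
      _ ≤ 1 * Real.exp (-(x / 3)) := by
          gcongr
          refine le_trans ?_ hB
          gcongr
          exact le_add_of_nonneg_right (by positivity)
      _ = _ := by rw [one_mul, hε3]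

end Asymptotics

/-! ### Solution operators and the error operator -/

section SolutionOperators

variable {d p q : ℕ}

theorem isSolutionOperator_toLinearMap {L : ℝ → Meas d p q → Meas d p q}
    {A U : ℝ → Meas d p q →L[ℂ] Meas d p q} (hL : ∀ z ρ, L z ρ = A z ρ) (h0 : U 0 = 1)
    (hU : StrongDeriv U fun z => A z * U z) :
    IsSolutionOperator L fun z => (U z : Module.End ℂ (Meas d p q)) := by
  refine ⟨by simp only [h0]; rfl, fun ρ => hasTVDeriv_iff.2 fun z _ => ?_⟩
  rw [hL]
  exact (hU ρ z).hasDerivWithinAt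

/-- Solution operators with a bounded generator are unique. -/
theorem IsSolutionOperator.eq_of_strongDeriv {L : ℝ → Meas d p q → Meas d p q}
    {A V : ℝ → Meas d p q →L[ℂ] Meas d p q} (hL : ∀ z ρ, L z ρ = A z ρ) {M : ℝ}
    (hM : ∀ z, ‖A z‖ ≤ M) (h0 : V 0 = 1) (hV : StrongDeriv V fun z => A z * V z)
    {U : ℝ → Module.End ℂ (Meas d p q)} (hU : IsSolutionOperator L U) {z : ℝ} (hz : 0 ≤ z) :
    U z = V z := by
  refine LinearMap.ext fun ρ => eq_of_linear_ode hM (ψ := fun z => U z ρ) (χ := fun z => V z ρ)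
    (fun s hs => ?_) (fun s _ => (hV ρ s).hasDerivWithinAt) ?_ hz
  · rw [← hL]
    exact hasTVDeriv_iff.1 (hU.2 ρ) s hs
  · simp only [hU.1, h0]
    rfl

theorem isWellPosed_of_bounded {L : ℝ → Meas d p q → Meas d p q}
    {A : ℝ → Meas d p q →L[ℂ] Meas d p q} (hL : ∀ z ρ, L z ρ = A z ρ) {M : ℝ}
    (hA : StrongCont A) (hM : ∀ z, ‖A z‖ ≤ M) : IsWellPosed L := by
  obtain ⟨U, h0, hU, -⟩ := exists_solutionOperator hA hM
  refine ⟨fun z => (U z : Module.End ℂ (Meas d p q)), isSolutionOperator_toLinearMap hL h0 hU,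
    fun z _ => ⟨2 * ‖U z‖, opNormLE_of_norm_le (norm_nonneg _) (U z).le_opNorm⟩,
    fun ψ hψ z hz => ?_⟩
  refine eq_of_linear_ode hM (ψ := ψ) (χ := fun z => U z (ψ 0)) (fun s hs => ?_)
    (fun s _ => (hU (ψ 0) s).hasDerivWithinAt) (by simp [h0]) hz
  rw [← hL]
  exact hasTVDeriv_iff.1 hψ s hs

end SolutionOperators

section Error

variable {d p q : ℕ} {R S : Lateral d → ℝ}

theorem isWellPosed_generator (h : IsAdmissibleCovariance R S) (k₀ ε η : ℝ) :
    IsWellPosed (generator (d := d) (p := p) (q := q) k₀ R ε η) :=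
  isWellPosed_of_bounded (generator_eq h k₀ ε η) (strongCont_genCLM h k₀ ε η)
    (norm_genCLM_le h k₀ ε η)

theorem isWellPosed_opL1 (h : IsAdmissibleCovariance R S) (k₀ ε η : ℝ)
    (γ : Fin p × Fin q) : IsWellPosed (opL1 (d := d) k₀ R ε η γ) :=
  isWellPosed_of_bounded (opL1_eq h k₀ ε η γ) (strongCont_transferCLM h k₀ ε η (colA γ))
    (norm_transferCLM_le h k₀ ε η (colA γ))

theorem damping_eq (h : IsAdmissibleCovariance R S) (k₀ ε η : ℝ) (z : ℝ) : damping p q k₀ R η z =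
    Real.exp (-(((p + q : ℕ) : ℝ) / 2 * (pairSystem (p := p) (q := q) h k₀ ε η).κ * z)) := by
  rw [damping, ← Real.exp_mul]
  congr 1
  simp only [pairSystem]
  ring

variable {Uγ : Fin p × Fin q → ℝ → Module.End ℂ (Meas d p q)}

theorem eq_pairSystem_V (h : IsAdmissibleCovariance R S) (k₀ ε η : ℝ)
    (hUγ : ∀ γ, IsSolutionOperator (opL1 k₀ R ε η γ) (Uγ γ))
    (γ : Fin p × Fin q) {z : ℝ} (hz : 0 ≤ z) : Uγ γ z = (pairSystem h k₀ ε η).V γ z :=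
  (hUγ γ).eq_of_strongDeriv (opL1_eq h k₀ ε η γ) ((pairSystem h k₀ ε η).norm_L γ)
    ((pairSystem h k₀ ε η).V_zero γ) ((pairSystem h k₀ ε η).deriv_V γ) hz

theorem pairProd_eq (h : IsAdmissibleCovariance R S) (k₀ ε η : ℝ)
    (hUγ : ∀ γ, IsSolutionOperator (opL1 k₀ R ε η γ) (Uγ γ))
    (Λ : Finset (Fin p × Fin q)) {z : ℝ} (hz : 0 ≤ z) :
    pairProd Uγ Λ z = ((pairSystem h k₀ ε η).prod Λ z : Module.End ℂ (Meas d p q)) := by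
  have h1 := map_orderedProd
    (ContinuousLinearMap.toLinearMapRingHom (R₁ := ℂ) (M₁ := Meas d p q)).toMonoidHom
    (fun γ => (pairSystem h k₀ ε η).V γ z - 1) Λ
  refine Eq.trans ?_ h1.symm
  change orderedProd (fun γ => Uγ γ z - 1) Λ = _
  congr 1
  funext γ
  rw [eq_pairSystem_V h k₀ ε η hUγ γ hz]
  rfl

/-- On `[0, ∞)`, `opN` is the damped sum over all matchings; the summand `U_η^{(p+q)/2}` is the term
of the empty matching. -/
theorem opN_apply (h : IsAdmissibleCovariance R S) (k₀ ε η : ℝ)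
    (hUγ : ∀ γ, IsSolutionOperator (opL1 k₀ R ε η γ) (Uγ γ)) {z : ℝ} (hz : 0 ≤ z)
    (ρ : Meas d p q) : opN k₀ R η Uγ z ρ = (pairSystem h k₀ ε η).approx z ρ := by
  simp only [opN, PairSystem.approx, PairSystem.total, sum_matchings, PairSystem.prod_empty,
    pairProd_eq h k₀ ε η hUγ _ hz, damping_eq h k₀ ε η, LinearMap.add_apply, LinearMap.smul_apply,
    LinearMap.sum_apply, smul_apply, add_apply, sum_apply,
    ContinuousLinearMap.coe_coe, smul_add]
  exact add_comm _ _

theorem errorSource_eq (h : IsAdmissibleCovariance R S) (k₀ ε η : ℝ)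
    (hUγ : ∀ γ, IsSolutionOperator (opL1 k₀ R ε η γ) (Uγ γ)) {z : ℝ}
    (hz : 0 ≤ z) (ρ : Meas d p q) : errorSource k₀ R ε η Uγ z ρ =
      (pairSystem h k₀ ε η).source (kindCLM h k₀ ε η) z ρ := by
  simp only [errorSource, PairSystem.source, sum_matchings, conflicting_empty, Finset.sum_empty,
    zero_add, pairProd_eq h k₀ ε η hUγ _ hz, damping_eq h k₀ ε η, opN_apply h k₀ ε η hUγ hz,
    opL1_eq h, opL2Sum_eq h, smul_apply, add_apply, sum_apply, ContinuousLinearMap.coe_coe]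
  rfl

theorem commute_of_isSolutionOperator (h : IsAdmissibleCovariance R S) (k₀ ε η : ℝ)
    (hUγ : ∀ γ, IsSolutionOperator (opL1 k₀ R ε η γ) (Uγ γ)) {γ γ' : Fin p × Fin q}
    (h1 : γ.1 ≠ γ'.1) (h2 : γ.2 ≠ γ'.2) {z z' : ℝ} (hz : 0 ≤ z) (hz' : 0 ≤ z') :
    Commute (Uγ γ z) (Uγ γ' z') := by
  rw [eq_pairSystem_V h k₀ ε η hUγ γ hz, eq_pairSystem_V h k₀ ε η hUγ γ' hz']
  exact ((pairSystem h k₀ ε η).commute_V h1 h2 z z').map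
    (ContinuousLinearMap.toLinearMapRingHom (R₁ := ℂ) (M₁ := Meas d p q))

variable {U : ℝ → Module.End ℂ (Meas d p q)}

/-- The solution operators of the full equation that have an extension to all of `ℝ` as strongly
differentiable bounded operators; every solution operator agrees with them on `[0, ∞)`. -/
theorem exists_genCLM_solution (h : IsAdmissibleCovariance R S) (k₀ ε η : ℝ) :
    ∃ V : ℝ → Meas d p q →L[ℂ] Meas d p q, V 0 = 1 ∧
      StrongDeriv V (fun z => genCLM h k₀ ε η z * V z) ∧
      ∀ {U : ℝ → Module.End ℂ (Meas d p q)}, IsSolutionOperator (generator k₀ R ε η) U →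
        ∀ {z : ℝ}, 0 ≤ z → U z = V z := by
  obtain ⟨V, h0, hV, -⟩ := exists_solutionOperator (strongCont_genCLM (p := p) (q := q) h k₀ ε η)
    (norm_genCLM_le h k₀ ε η)
  exact ⟨V, h0, hV, fun hU _ hz =>
    hU.eq_of_strongDeriv (generator_eq h k₀ ε η) (norm_genCLM_le h k₀ ε η) h0 hV hz⟩

/-- The error `U - N` solves the full equation with source `errorSource`. -/
theorem exists_error (h : IsAdmissibleCovariance R S) (k₀ ε η : ℝ)
    (hU : IsSolutionOperator (generator k₀ R ε η) U)
    (hUγ : ∀ γ, IsSolutionOperator (opL1 k₀ R ε η γ) (Uγ γ)) :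
    ∃ E : ℝ → Module.End ℂ (Meas d p q), (∀ z, U z = opN k₀ R η Uγ z + E z) ∧ E 0 = 0 ∧
      ∀ ρ, HasTVDeriv (fun z => E z ρ)
        (fun z => generator k₀ R ε η z (E z ρ) + errorSource k₀ R ε η Uγ z ρ) := by
  obtain ⟨V, hV0, hV, hUV⟩ := exists_genCLM_solution (p := p) (q := q) h k₀ ε η
  have hE : ∀ z, 0 ≤ z → ∀ ρ, (U z - opN k₀ R η Uγ z) ρ =
      (V z - (pairSystem h k₀ ε η).approx z : Meas d p q →L[ℂ] Meas d p q) ρ := fun z hz ρ => by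
    rw [LinearMap.sub_apply, opN_apply h k₀ ε η hUγ hz, hUV hU hz]
    rfl
  refine ⟨fun z => U z - opN k₀ R η Uγ z, fun z => (add_sub_cancel _ _).symm,
    LinearMap.ext fun ρ => ?_,
    fun ρ => hasTVDeriv_iff.2 fun z hz => ?_⟩
  · rw [hE 0 le_rfl, hV0, PairSystem.approx, PairSystem.total_zero]
    simp
  · rw [generator_eq h, errorSource_eq h k₀ ε η hUγ hz]
    simp only
    rw [hE z hz]
    exact ((pairSystem h k₀ ε η).deriv_error hV ρ z).hasDerivWithinAt.congr
      (fun s hs => hE s hs ρ) (hE z hz ρ)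

/-- A bound of the error of the extended solution operators for the variation norm bounds the error,
up to a factor `2`, for the sum of the total variations of real and imaginary parts. -/
theorem opNormLE_error (h : IsAdmissibleCovariance R S) (k₀ ε η : ℝ) {B z : ℝ}
    (hz : 0 ≤ z) (hU : IsSolutionOperator (generator k₀ R ε η) U)
    (hUγ : ∀ γ, IsSolutionOperator (opL1 k₀ R ε η γ) (Uγ γ))
    (hB : ∀ V : ℝ → Meas d p q →L[ℂ] Meas d p q, V 0 = 1 →
      StrongDeriv V (fun z => genCLM h k₀ ε η z * V z) →
      2 * ‖V z - (pairSystem h k₀ ε η).approx z‖ ≤ B) :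
    OpNormLE (U z - opN k₀ R η Uγ z) B := by
  obtain ⟨V, hV0, hV, hUV⟩ := exists_genCLM_solution (p := p) (q := q) h k₀ ε η
  have hVB := hB V hV0 hV
  have h1 : OpNormLE (U z - opN k₀ R η Uγ z) (2 * (B / 2)) := by
    refine opNormLE_of_norm_le (by linarith [norm_nonneg (V z - (pairSystem h k₀ ε η).approx z)])
      fun ρ => ?_
    rw [LinearMap.sub_apply, opN_apply h k₀ ε η hUγ hz, hUV hU hz]
    exact ContinuousLinearMap.le_of_opNorm_le (V z - (pairSystem h k₀ ε η).approx z)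
      (c := B / 2) (by linarith) ρ
  rwa [mul_div_cancel₀ _ two_ne_zero] at h1

end Error

end ItoSchrodinger

end

/-! ### The expansion and its error -/

theorem theorem4p1 (d : ℕ) (hd : 1 ≤ d) (p q : ℕ) (k₀ : ℝ) (hk₀ : 0 < k₀) (R₀ : ℝ) :
    ∃ c C₂ : ℝ, 0 < c ∧ 0 < C₂ ∧
      ∀ R S : ItoSchrodinger.Lateral d → ℝ, ItoSchrodinger.IsAdmissibleCovariance R S →
        R 0 = R₀ →
        -- the evolution equations have solution operators, the operators `U_γ` that enter a product
        -- commute, and the error `U - N` solves its evolution equation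
        (∀ ε η : ℝ, 0 < ε → 0 < η →
          ItoSchrodinger.IsWellPosed
            (ItoSchrodinger.generator (d := d) (p := p) (q := q) k₀ R ε η) ∧
          (∀ γ : Fin p × Fin q,
            ItoSchrodinger.IsWellPosed (ItoSchrodinger.opL1 (d := d) k₀ R ε η γ)) ∧
          ∀ (U : ℝ → Module.End ℂ (ItoSchrodinger.Meas d p q))
            (Uγ : Fin p × Fin q → ℝ → Module.End ℂ (ItoSchrodinger.Meas d p q)),
            ItoSchrodinger.IsSolutionOperator (ItoSchrodinger.generator k₀ R ε η) U →
            (∀ γ, ItoSchrodinger.IsSolutionOperator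
              (ItoSchrodinger.opL1 k₀ R ε η γ) (Uγ γ)) →
            (∀ γ γ' : Fin p × Fin q, γ.1 ≠ γ'.1 → γ.2 ≠ γ'.2 →
              ∀ z z' : ℝ, 0 ≤ z → 0 ≤ z' → Commute (Uγ γ z) (Uγ γ' z')) ∧
            ∃ E : ℝ → Module.End ℂ (ItoSchrodinger.Meas d p q),
              (∀ z : ℝ, U z = ItoSchrodinger.opN k₀ R η Uγ z + E z) ∧
              E 0 = 0 ∧
              ∀ ρ : ItoSchrodinger.Meas d p q,
                ItoSchrodinger.HasTVDeriv (fun z => E z ρ)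
                  (fun z => ItoSchrodinger.generator k₀ R ε η z (E z ρ) +
                    ItoSchrodinger.errorSource k₀ R ε η Uγ z ρ)) ∧
        -- the bounds on the error, in the kinetic and in the diffusive scaling
        (∀ η : ℝ → ℝ, η = ItoSchrodinger.etaKinetic ∨ η = ItoSchrodinger.etaDiffusive →
          ∀ Z : ℝ, 0 ≤ Z → ∃ ε₀ : ℝ, 0 < ε₀ ∧
            ∀ z : ℝ, 0 ≤ z → z ≤ Z → ∀ ε : ℝ, 0 < ε → ε ≤ ε₀ →
            ∀ (U : ℝ → Module.End ℂ (ItoSchrodinger.Meas d p q))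
              (Uγ : Fin p × Fin q → ℝ → Module.End ℂ (ItoSchrodinger.Meas d p q)),
              ItoSchrodinger.IsSolutionOperator (ItoSchrodinger.generator k₀ R ε (η ε)) U →
              (∀ γ, ItoSchrodinger.IsSolutionOperator
                (ItoSchrodinger.opL1 k₀ R ε (η ε) γ) (Uγ γ)) →
              (∀ z' : ℝ, 0 ≤ z' → z' ≤ z →
                ItoSchrodinger.OpNormLE (U z' - ItoSchrodinger.opN k₀ R (η ε) Uγ z')
                  (ε ^ (1 / 3 : ℝ))) ∧
              (MemLp S ⊤ →
                (∀ z' : ℝ, 0 ≤ z' → z' ≤ z →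
                  ItoSchrodinger.OpNormLE (U z' - ItoSchrodinger.opN k₀ R (η ε) Uγ z')
                    (ItoSchrodinger.errorBound p q k₀ R S c C₂ ε (η ε) z)) ∧
                ItoSchrodinger.errorBound p q k₀ R S c C₂ ε (η ε) z ≤ ε ^ (1 / 3 : ℝ))) := by
  obtain ⟨c, hc, hbound⟩ := ItoSchrodinger.exists_errorBound d hd p q k₀ hk₀ R₀
  refine ⟨c, k₀, hc, hk₀, fun R S h hR => ⟨fun ε η _ _ =>
    ⟨ItoSchrodinger.isWellPosed_generator h k₀ ε η, ItoSchrodinger.isWellPosed_opL1 h k₀ ε η,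
      fun U Uγ hU hUγ => ⟨fun γ γ' h1 h2 z z' hz hz' =>
        ItoSchrodinger.commute_of_isSolutionOperator h k₀ ε η hUγ h1 h2 hz hz',
        ItoSchrodinger.exists_error h k₀ ε η hU hUγ⟩⟩, fun η hη Z _ => ?_⟩⟩
  -- the truncated majorant is bounded even if `S` is not; it gives the bound `ε^{1/3}`
  have h' := h.truncate_majorant
  obtain ⟨ε₁, hε₁, H₁⟩ := ItoSchrodinger.exists_errorBound_le p q hk₀ hc h.apply_zero_nonneg
    (fun ξ => min (S ξ) (∫ x, ‖R x‖)) hη Z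
  obtain ⟨ε₂, hε₂, H₂⟩ := ItoSchrodinger.exists_errorBound_le p q hk₀ hc h.apply_zero_nonneg
    S hη Z
  refine ⟨min ε₁ ε₂, lt_min hε₁ hε₂, fun z hz hzZ ε hε hεε U Uγ hU hUγ => ?_⟩
  obtain ⟨hη0, hη1, h1, h2, h3⟩ := H₁ z ε hz hzZ hε (hεε.trans (min_le_left _ _))
  obtain ⟨-, -, -, -, h4⟩ := H₂ z ε hz hzZ hε (hεε.trans (min_le_right _ _))
  refine ⟨fun z' hz' hzz => ?_, fun hS => ⟨fun z' hz' hzz => ?_, h4⟩⟩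
  · exact ItoSchrodinger.opNormLE_error h' k₀ ε (η ε) hz' hU hUγ fun V hV0 hV =>
      (hbound h' hR h.memLp_truncate_majorant hε hη0 hη1 h1 h2 V hV0 hV z' ⟨hz', hzz⟩).trans h3
  · exact ItoSchrodinger.opNormLE_error h k₀ ε (η ε) hz' hU hUγ fun V hV0 hV =>
      hbound h hR hS hε hη0 hη1 h1 h2 V hV0 hV z' ⟨hz', hzz⟩
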